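/- Let $k$ be a field; $\otimes$ means $\otimes_k$, and Sweedler notation is used. Let $H$ be a coquasi-Hopf algebra over $k$: a coassociative counital coalgebra $(H,\Delta,\varepsilon)$ with coalgebra maps $m:H\otimes H\to H$, $m(h\otimes g)=hg$, and $k\to H$, $1\mapsto 1_H$, a convolution invertible $\omega\in(H\otimes H\otimes H)^*$, a coalgebra antihomomorphism $S:H\to H$ (the antipode) and $\alpha,\beta\in H^*$ such that for all $h,g,f,l\in H$ $$h_1(g_1f_1)\,\omega(h_2,g_2,f_2)=\omega(h_1,g_1,f_1)\,(h_2g_2)f_2,\qquad 1_Hh=h1_H=h,$$ $$\omega(h_1,g_1,f_1l_1)\,\omega(h_2g_2,f_2,l_2)=\omega(g_1,f_1,l_1)\,\omega(h_1,g_2f_2,l_2)\,\omega(h_2,g_3,f_3),\qquad \omega(h,1_H,g)=\varepsilon(h)\varepsilon(g),$$ $$S(h_1)\alpha(h_2)h_3=\alpha(h)1_H,\qquad h_1\beta(h_2)S(h_3)=\beta(h)1_H,$$ $$\omega(h_1\beta(h_2),S(h_3),\alpha(h_4)h_5)=\omega^{-1}(S(h_1),\alpha(h_2)h_3\beta(h_4),S(h_5))=\varepsilon(h).$$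 Let $A$ be a right $H$-comodule algebra: a right $H$-comodule with $H$-colinear multiplication and unit ($\rho(ab)=a_0b_0\otimes a_1b_1$, $\rho(1_A)=1_A\otimes 1_H$) such that $1_Aa=a1_A=a$ and $(ab)c=a_0(b_0c_0)\,\omega(a_1,b_1,c_1)$. Let $B=A^{coH}=\{a\in A:\rho(a)=a\otimes 1_H\}$, an associative unital algebra. Let $\mathcal M_B$ be the category of right $B$-modules and $\mathcal M_A^H$ the category of relative right $(H,A)$-Hopf modules: right $H$-comodules $M$ with an action $M\otimes A\to M$ such that $m1_A=m$, $(ma)b=m_0(a_0b_0)\,\omega(m_1,a_1,b_1)$ and $\rho(ma)=m_0a_0\otimes m_1a_1$; morphisms are the colinear maps that respect the $A$-action. The coinvariants functor $\mathcal M_A^H\to\mathcal M_B$ is $M\mapsto M^{coH}=\{m:\rho(m)=m\otimes 1_H\}$; the induction functor $\mathcal M_B\to\mathcal M_A^H$ is $N\mapsto N\otimes_BA$ with $\rho(n\otimes_Ba)=n\otimes_Ba_0\otimes a_1$ and $(n\otimes_Ba)b=n\otimes_Bab$. For $M\in\mathcal M_A^H$ let $$can_M:M\otimes_BA\to M\otimes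 H,\qquad can_M(m\otimes_Ba)=m_0a_0\otimes\omega^{-1}(m_1,a_1\beta(a_2),S(a_3))\,a_4 .$$ $A$ is called a Galois extension of $B$ if $can=can_A:A\otimes_BA\to A\otimes H$ is bijective. (a) If the antipode $S$ is bijective, then the following are equivalent: (1) $A$ is faithfully flat as a left $B$-module, and $A$ is a Galois extension of $B$; (2) the functor of coinvariants and the induction functor are a pair of inverse equivalences between $\mathcal M_A^H$ and $\mathcal M_B$. (b) If $can$ is bijective, then $can_M$ is bijective for every $M\in\mathcal M_A^H$ (bijectivity of $S$ is not needed here). -/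

import Mathlib

open TensorProduct CategoryTheory

universe u

noncomputable section

namespace CoquasiHopf

/-! ## Sweedler calculus with linear maps -/

section Sweedler

variable {k C D V W : Type*} [Field k]
  [AddCommGroup C] [Module k C] [AddCommGroup D] [Module k D]
  [AddCommGroup V] [Module k V] [AddCommGroup W] [Module k W]

/-- `c ↦ φ(c₁) f(c₂)`; for `V = k` this is the convolution product of two functionals. -/
def convL [Coalgebra k C] (φ : C →ₗ[k] k) (f : C →ₗ[k] V) : C →ₗ[k] V :=
  (TensorProduct.lid k V).toLinearMap ∘ₗ TensorProduct.map φ f ∘ₗ Coalgebra.comul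

/-- `c ↦ f(c₁) φ(c₂)`. -/
def convR [Coalgebra k C] (f : C →ₗ[k] V) (φ : C →ₗ[k] k) : C →ₗ[k] V :=
  (TensorProduct.rid k V).toLinearMap ∘ₗ TensorProduct.map f φ ∘ₗ Coalgebra.comul

/-- `c ↦ c₁ ⊗ (c₂ ⊗ c₃)`. -/
def comul₃ (k C : Type*) [Field k] [AddCommGroup C] [Module k C] [Coalgebra k C] :
    C →ₗ[k] C ⊗[k] (C ⊗[k] C) :=
  TensorProduct.map LinearMap.id Coalgebra.comul ∘ₗ Coalgebra.comul

/-- From `ρ : V → V ⊗ C` and `σ : W → W ⊗ D` the map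
`v ⊗ w ↦ (v₀ ⊗ w₀) ⊗ (v₁ ⊗ w₁)`. -/
def prodCoact (ρ : V →ₗ[k] V ⊗[k] C) (σ : W →ₗ[k] W ⊗[k] D) :
    V ⊗[k] W →ₗ[k] (V ⊗[k] W) ⊗[k] (C ⊗[k] D) :=
  (TensorProduct.tensorTensorTensorComm k V C W D).toLinearMap ∘ₗ TensorProduct.map ρ σ

/-- From `ρ : V → V ⊗ C` and a functional `φ` on `C` the map `v ↦ φ(v₁) v₀`. -/
def applyCoact (φ : C →ₗ[k] k) (ρ : V →ₗ[k] V ⊗[k] C) : V →ₗ[k] V :=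
  (TensorProduct.rid k V).toLinearMap ∘ₗ TensorProduct.map LinearMap.id φ ∘ₗ ρ

end Sweedler

/-! ## Coquasi-bialgebras and coquasi-Hopf algebras -/

/-- A coquasi-bialgebra `(H, m, u, ω, Δ, ε)` over `k`.  The reassociator is a functional on
`H ⊗ (H ⊗ H)`. -/
class CoquasiBialgebra (k H : Type*) [Field k] [AddCommGroup H] [Module k H]
    extends Coalgebra k H where
  /-- the multiplication, a coalgebra map -/
  mul : H ⊗[k] H →ₗc[k] H
  /-- the unit; the next two fields say that `k → H`, `c ↦ c • one` is a coalgebra map -/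
  one : H
  comul_one : Coalgebra.comul (R := k) one = one ⊗ₜ[k] one
  counit_one : Coalgebra.counit (R := k) one = 1
  /-- the reassociator -/
  ω : H ⊗[k] (H ⊗[k] H) →ₗ[k] k
  /-- the convolution inverse of the reassociator -/
  ωInv : H ⊗[k] (H ⊗[k] H) →ₗ[k] k
  ω_ωInv : convL ω ωInv = Coalgebra.counit
  ωInv_ω : convL ωInv ω = Coalgebra.counit
  /-- `h₁(g₁k₁) ω(h₂,g₂,k₂) = ω(h₁,g₁,k₁) (h₂g₂)k₂` -/
  quasi_assoc :
    convR (mul.toLinearMap ∘ₗ TensorProduct.map LinearMap.id mul.toLinearMap) ω =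
      convL ω (mul.toLinearMap ∘ₗ TensorProduct.map mul.toLinearMap LinearMap.id ∘ₗ
        (TensorProduct.assoc k H H H).symm.toLinearMap)
  one_mul : ∀ h : H, mul (one ⊗ₜ[k] h) = h
  mul_one : ∀ h : H, mul (h ⊗ₜ[k] one) = h
  /-- `ω(h₁,g₁,k₁l₁) ω(h₂g₂,k₂,l₂) = ω(g₁,k₁,l₁) ω(h₁,g₂k₂,l₂) ω(h₂,g₃,k₃)`, written as an identity
  of convolution products of functionals of `h ⊗ (g ⊗ (k ⊗ l))` -/
  cocycle :
    convL
      (ω ∘ₗ TensorProduct.map LinearMap.id (TensorProduct.map LinearMap.id mul.toLinearMap))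
      (ω ∘ₗ TensorProduct.map mul.toLinearMap LinearMap.id ∘ₗ
        (TensorProduct.assoc k H H (H ⊗[k] H)).symm.toLinearMap) =
    convL
      (ω ∘ₗ (TensorProduct.lid k (H ⊗[k] (H ⊗[k] H))).toLinearMap ∘ₗ
        TensorProduct.map Coalgebra.counit LinearMap.id)
      (convL
        (ω ∘ₗ TensorProduct.map LinearMap.id
          (TensorProduct.map mul.toLinearMap LinearMap.id ∘ₗ
            (TensorProduct.assoc k H H H).symm.toLinearMap))
        (ω ∘ₗ TensorProduct.map LinearMap.id (TensorProduct.map LinearMap.id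
          ((TensorProduct.rid k H).toLinearMap ∘ₗ
            TensorProduct.map LinearMap.id Coalgebra.counit))))
  ω_one_mid : ∀ h g : H, ω (h ⊗ₜ[k] (one ⊗ₜ[k] g)) =
    Coalgebra.counit (R := k) h * Coalgebra.counit (R := k) g

/-- A coquasi-Hopf algebra: a coquasi-bialgebra with an antipode `(S, α, β)`. -/
class CoquasiHopfAlgebra (k H : Type*) [Field k] [AddCommGroup H] [Module k H]
    extends CoquasiBialgebra k H where
  /-- the antipode, a coalgebra antihomomorphism -/
  S : H →ₗ[k] H
  comul_S : ∀ h : H, Coalgebra.comul (R := k) (S h) =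
    TensorProduct.comm k H H (TensorProduct.map S S (Coalgebra.comul (R := k) h))
  counit_S : ∀ h : H, Coalgebra.counit (R := k) (S h) = Coalgebra.counit (R := k) h
  α : H →ₗ[k] k
  β : H →ₗ[k] k
  /-- `S(h₁) α(h₂) h₃ = α(h) 1` -/
  S_α_id : ∀ h : H, mul (TensorProduct.map S (convL α LinearMap.id)
    (Coalgebra.comul (R := k) h)) = α h • one
  /-- `h₁ β(h₂) S(h₃) = β(h) 1` -/
  id_β_S : ∀ h : H, mul (TensorProduct.map (convR LinearMap.id β) S
    (Coalgebra.comul (R := k) h)) = β h • one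
  /-- `ω(h₁β(h₂), S(h₃), α(h₄)h₅) = ε(h)` -/
  ω_antipode : ∀ h : H, ω (TensorProduct.map (convR LinearMap.id β)
    (TensorProduct.map S (convL α LinearMap.id)) (comul₃ k H h)) = Coalgebra.counit (R := k) h
  /-- `ω⁻¹(S(h₁), α(h₂)h₃β(h₄), S(h₅)) = ε(h)` -/
  ωInv_antipode : ∀ h : H, ωInv (TensorProduct.map S
    (TensorProduct.map (convL α (convR LinearMap.id β)) S) (comul₃ k H h)) =
      Coalgebra.counit (R := k) h

/-! ## Comodules, comodule algebras, relative Hopf modules -/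

/-- A right comodule over the coalgebra `C`. -/
class RightComodule (k C V : Type*) [Field k] [AddCommGroup C] [Module k C] [Coalgebra k C]
    [AddCommGroup V] [Module k V] where
  coact : V →ₗ[k] V ⊗[k] C
  coact_coassoc : ∀ v : V,
    TensorProduct.assoc k V C C (TensorProduct.map coact LinearMap.id (coact v)) =
      TensorProduct.map LinearMap.id Coalgebra.comul (coact v)
  coact_counit : ∀ v : V, TensorProduct.rid k V
    (TensorProduct.map LinearMap.id (Coalgebra.counit (R := k)) (coact v)) = v

open RightComodule

/-- A right `H`-comodule algebra: an algebra in the monoidal category of right `H`-comodules. -/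
class ComoduleAlgebra (k H A : Type*) [Field k] [AddCommGroup H] [Module k H]
    [CoquasiBialgebra k H] [AddCommGroup A] [Module k A] extends RightComodule k H A where
  mul : A ⊗[k] A →ₗ[k] A
  one : A
  /-- colinearity of the multiplication: `ρ(ab) = a₀b₀ ⊗ a₁b₁` -/
  coact_mul : ∀ a b : A, coact (mul (a ⊗ₜ[k] b)) =
    TensorProduct.map mul (CoquasiBialgebra.mul (k := k) (H := H)).toLinearMap
      (prodCoact coact coact (a ⊗ₜ[k] b))
  /-- colinearity of the unit -/
  coact_one : coact one = one ⊗ₜ[k] (CoquasiBialgebra.one k : H)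
  one_mul : ∀ a : A, mul (one ⊗ₜ[k] a) = a
  mul_one : ∀ a : A, mul (a ⊗ₜ[k] one) = a
  /-- `(ab)c = a₀(b₀c₀) ω(a₁,b₁,c₁)` -/
  mul_quasi_assoc : ∀ a b c : A, mul (mul (a ⊗ₜ[k] b) ⊗ₜ[k] c) =
    mul (TensorProduct.map LinearMap.id mul
      (applyCoact (CoquasiBialgebra.ω (k := k) (H := H))
        (prodCoact coact (prodCoact coact coact)) (a ⊗ₜ[k] (b ⊗ₜ[k] c))))

/-- A relative right `(H, A)`-Hopf module: a right `A`-module in the monoidal category of right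
`H`-comodules. -/
class RelHopfModule (k H A M : Type*) [Field k] [AddCommGroup H] [Module k H]
    [CoquasiBialgebra k H] [AddCommGroup A] [Module k A] [ComoduleAlgebra k H A]
    [AddCommGroup M] [Module k M] extends RightComodule k H M where
  act : M ⊗[k] A →ₗ[k] M
  /-- `ρ(ma) = m₀a₀ ⊗ m₁a₁` -/
  coact_act : ∀ (m : M) (a : A), coact (act (m ⊗ₜ[k] a)) =
    TensorProduct.map act (CoquasiBialgebra.mul (k := k) (H := H)).toLinearMap
      (prodCoact coact (RightComodule.coact (k := k) (C := H)) (m ⊗ₜ[k] a))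
  act_one : ∀ m : M, act (m ⊗ₜ[k] ComoduleAlgebra.one k H) = m
  /-- `(ma)b = m₀(a₀b₀) ω(m₁,a₁,b₁)` -/
  act_quasi_assoc : ∀ (m : M) (a b : A), act (act (m ⊗ₜ[k] a) ⊗ₜ[k] b) =
    act (TensorProduct.map LinearMap.id (ComoduleAlgebra.mul (k := k) (H := H))
      (applyCoact (CoquasiBialgebra.ω (k := k) (H := H))
        (prodCoact coact (prodCoact (RightComodule.coact (k := k) (C := H))
          (RightComodule.coact (k := k) (C := H)))) (m ⊗ₜ[k] (a ⊗ₜ[k] b))))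

/-- `A` as a relative Hopf module over itself. -/
instance selfHopfModule (k H A : Type*) [Field k] [AddCommGroup H] [Module k H]
    [CoquasiBialgebra k H] [AddCommGroup A] [Module k A] [ComoduleAlgebra k H A] :
    RelHopfModule k H A A where
  act := ComoduleAlgebra.mul (k := k) (H := H)
  coact_act := ComoduleAlgebra.coact_mul
  act_one := ComoduleAlgebra.mul_one
  act_quasi_assoc := ComoduleAlgebra.mul_quasi_assoc

/-! ## Normalisation of the reassociator -/

section Normalisation

variable {k H : Type*} [Field k] [AddCommGroup H] [Module k H]

section
variable {C D V : Type*} [AddCommGroup C] [Module k C] [Coalgebra k C]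
  [AddCommGroup D] [Module k D] [Coalgebra k D] [AddCommGroup V] [Module k V]

theorem convL_comp (φ : C →ₗ[k] k) (f : C →ₗ[k] V) (F : D →ₗ[k] C)
    (hF : Coalgebra.comul ∘ₗ F = TensorProduct.map F F ∘ₗ Coalgebra.comul) :
    convL φ f ∘ₗ F = convL (φ ∘ₗ F) (f ∘ₗ F) := by
  simp only [convL, LinearMap.comp_assoc, hF, TensorProduct.map_comp]

theorem convL_eq (φ ψ : C →ₗ[k] k) :
    convL φ ψ = (WithConv.toConv φ * WithConv.toConv ψ).ofConv := by
  rw [LinearMap.convMul_def, convL]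
  congr 1

theorem convL_counit (φ : C →ₗ[k] k) : convL φ Coalgebra.counit = φ := by
  have := mul_one (WithConv.toConv φ)
  rw [convL_eq]
  exact congrArg WithConv.ofConv this

theorem counit_convL (φ : C →ₗ[k] k) : convL Coalgebra.counit φ = φ := by
  have := one_mul (WithConv.toConv φ)
  rw [convL_eq]
  exact congrArg WithConv.ofConv this

theorem convL_assoc (φ ψ χ : C →ₗ[k] k) : convL (convL φ ψ) χ = convL φ (convL ψ χ) := by
  simp only [convL_eq, WithConv.toConv_ofConv, mul_assoc]

theorem eq_counit_of_idem {w v : C →ₗ[k] k} (h : w = convL w w)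
    (hv : convL v w = Coalgebra.counit) : w = Coalgebra.counit := by
  rw [← hv, h, ← convL_assoc, hv, counit_convL, ← h]

end

section
variable (k H) [CoquasiBialgebra k H]

open CoquasiBialgebra

/-- The unit as a coalgebra map. -/
def unitHom : k →ₗc[k] H where
  toLinearMap := LinearMap.toSpanSingleton k H (one k)
  counit_comp := by ext; simp [counit_one]
  map_comp_comul := by ext; simp [comul_one]

/-- `x ↦ 1 ⊗ x` as a coalgebra map. -/
def insL (X : Type*) [AddCommGroup X] [Module k X] [Coalgebra k X] : X →ₗc[k] H ⊗[k] X :=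
  (Coalgebra.TensorProduct.map (unitHom k H) (CoalgHom.id k X)).comp
    (Coalgebra.TensorProduct.lid k X).symm.toCoalgHom

/-- `x ↦ x ⊗ 1` as a coalgebra map. -/
def insR (X : Type*) [AddCommGroup X] [Module k X] [Coalgebra k X] : X →ₗc[k] X ⊗[k] H :=
  (Coalgebra.TensorProduct.map (CoalgHom.id k X) (unitHom k H)).comp
    (Coalgebra.TensorProduct.rid k k X).symm.toCoalgHom

variable {k H}

theorem insL_apply {X : Type*} [AddCommGroup X] [Module k X] [Coalgebra k X] (x : X) :
    (insL k H X).toLinearMap x = (one k : H) ⊗ₜ[k] x := by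
  change (unitHom k H) 1 ⊗ₜ[k] x = _
  congr 1
  exact one_smul k _

theorem insR_apply {X : Type*} [AddCommGroup X] [Module k X] [Coalgebra k X] (x : X) :
    (insR k H X).toLinearMap x = x ⊗ₜ[k] (one k : H) := by
  change x ⊗ₜ[k] (unitHom k H) 1 = _
  congr 1
  exact one_smul k _

theorem ω_one_left (h g : H) : ω ((one k : H) ⊗ₜ[k] (h ⊗ₜ[k] g)) =
    Coalgebra.counit (R := k) h * Coalgebra.counit (R := k) g := by
  set w : H ⊗[k] H →ₗ[k] k := ω ∘ₗ (insL k H (H ⊗[k] H)).toLinearMap with hw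
  have hv : convL (ωInv ∘ₗ (insL k H (H ⊗[k] H)).toLinearMap) w = Coalgebra.counit := by
    rw [hw, ← convL_comp _ _ _ (insL k H (H ⊗[k] H)).map_comp_comul.symm, ωInv_ω]
    exact (insL k H (H ⊗[k] H)).counit_comp
  have hc := congrArg (fun f => f ∘ₗ
    ((insL k H (H ⊗[k] (H ⊗[k] H))).comp (insL k H (H ⊗[k] H))).toLinearMap)
    (cocycle (k := k) (H := H))
  have hF := ((insL k H (H ⊗[k] (H ⊗[k] H))).comp
    (insL k H (H ⊗[k] H))).map_comp_comul.symm
  rw [convL_comp _ _ _ hF, convL_comp _ _ _ hF, convL_comp _ _ _ hF] at hc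
  have key : w = convL w w := by
    have e1 : ∀ φ : H ⊗[k] (H ⊗[k] (H ⊗[k] H)) →ₗ[k] k, ∀ a b : H,
        (φ ∘ₗ ((insL k H (H ⊗[k] (H ⊗[k] H))).comp (insL k H (H ⊗[k] H))).toLinearMap)
          (a ⊗ₜ[k] b) = φ (one k ⊗ₜ[k] (one k ⊗ₜ[k] (a ⊗ₜ[k] b))) := by
      intro φ a b
      rw [← insL_apply, ← insL_apply]
      rfl
    have ew : ∀ a b : H, w (a ⊗ₜ[k] b) = ω (one k ⊗ₜ[k] (a ⊗ₜ[k] b)) := by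
      intro a b
      rw [hw, ← insL_apply]
      rfl
    convert hc using 1
    · conv_lhs => rw [← counit_convL w]
      congr 1
      · refine TensorProduct.ext' fun a b => ?_
        rw [e1]
        simp [ω_one_mid, counit_one, mul_comm]
      · refine TensorProduct.ext' fun a b => ?_
        rw [e1, ew]
        simp [CoquasiBialgebra.one_mul]
    · congr 1
      · refine TensorProduct.ext' fun a b => ?_
        rw [e1, ew]
        simp [counit_one]
      · conv_lhs => rw [← convL_counit w]
        congr 1
        · refine TensorProduct.ext' fun a b => ?_
          rw [e1, ew]
          simp [CoquasiBialgebra.one_mul]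
        · refine TensorProduct.ext' fun a b => ?_
          rw [e1]
          simp [ω_one_mid, counit_one, mul_comm]
  have := eq_counit_of_idem key hv
  have h2 := congrArg (fun f => f (h ⊗ₜ[k] g)) this
  simp only [hw, LinearMap.comp_apply, insL_apply] at h2
  rw [h2]
  simp [mul_comm]

theorem ω_one_right (h g : H) : ω (h ⊗ₜ[k] (g ⊗ₜ[k] (one k : H))) =
    Coalgebra.counit (R := k) h * Coalgebra.counit (R := k) g := by
  set G := Coalgebra.TensorProduct.map (CoalgHom.id k H) (insR k H H) with hG
  have eG : ∀ a b : H, G.toLinearMap (a ⊗ₜ[k] b) = a ⊗ₜ[k] (b ⊗ₜ[k] one k) := by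
    intro a b
    rw [← insR_apply]
    rfl
  set w : H ⊗[k] H →ₗ[k] k := ω ∘ₗ G.toLinearMap with hw
  have hv : convL (ωInv ∘ₗ G.toLinearMap) w = Coalgebra.counit := by
    rw [hw, ← convL_comp _ _ _ G.map_comp_comul.symm, ωInv_ω]
    exact G.counit_comp
  set F := (Coalgebra.TensorProduct.map (CoalgHom.id k H)
    (Coalgebra.TensorProduct.map (CoalgHom.id k H) (insR k H H))).comp G with hFdef
  have hc := congrArg (fun f => f ∘ₗ F.toLinearMap) (cocycle (k := k) (H := H))
  have hF := F.map_comp_comul.symm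
  rw [convL_comp _ _ _ hF, convL_comp _ _ _ hF, convL_comp _ _ _ hF] at hc
  have key : w = convL w w := by
    have e1 : ∀ φ : H ⊗[k] (H ⊗[k] (H ⊗[k] H)) →ₗ[k] k, ∀ a b : H,
        (φ ∘ₗ F.toLinearMap) (a ⊗ₜ[k] b) =
          φ (a ⊗ₜ[k] (b ⊗ₜ[k] (one k ⊗ₜ[k] one k))) := by
      intro φ a b
      have : F.toLinearMap (a ⊗ₜ[k] b) = a ⊗ₜ[k] (b ⊗ₜ[k] (one k ⊗ₜ[k] one k)) := by
        change (Coalgebra.TensorProduct.map (CoalgHom.id k H)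
          (Coalgebra.TensorProduct.map (CoalgHom.id k H) (insR k H H)))
            (G.toLinearMap (a ⊗ₜ[k] b)) = _
        rw [eG, ← insR_apply (one k : H)]
        rfl
      rw [← this]
      rfl
    have ew : ∀ a b : H, w (a ⊗ₜ[k] b) = ω (a ⊗ₜ[k] (b ⊗ₜ[k] one k)) := by
      intro a b
      rw [hw, ← eG]
      rfl
    convert hc using 1
    · conv_lhs => rw [← convL_counit w]
      congr 1
      · refine TensorProduct.ext' fun a b => ?_
        rw [e1, ew]
        simp [CoquasiBialgebra.mul_one]
      · refine TensorProduct.ext' fun a b => ?_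
        rw [e1]
        simp [ω_one_mid, counit_one, mul_comm]
    · rw [← counit_convL (convL w w)]
      congr 1
      · refine TensorProduct.ext' fun a b => ?_
        rw [e1]
        simp [ω_one_mid, counit_one, mul_comm]
      · congr 1
        · refine TensorProduct.ext' fun a b => ?_
          rw [e1, ew]
          simp [CoquasiBialgebra.mul_one]
        · refine TensorProduct.ext' fun a b => ?_
          rw [e1, ew]
          simp [counit_one]
  have := eq_counit_of_idem key hv
  have h2 := congrArg (fun f => f (h ⊗ₜ[k] g)) this
  simp only [hw, LinearMap.comp_apply, eG] at h2
  rw [h2]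
  simp [mul_comm]

end

end Normalisation

/-! ## Coinvariants -/

section Coinvariants

variable (k H : Type*) [Field k] [AddCommGroup H] [Module k H] [CoquasiBialgebra k H]

/-- `V^{co H} = {v | ρ(v) = v ⊗ 1}` for a right `H`-comodule `V`. -/
def coinvariants (V : Type*) [AddCommGroup V] [Module k V] [RightComodule k H V] :
    Submodule k V where
  carrier := {v | coact v = v ⊗ₜ[k] (CoquasiBialgebra.one k : H)}
  add_mem' := by
    intro a b ha hb
    simp only [Set.mem_ofPred_eq] at *
    rw [map_add, ha, hb, TensorProduct.add_tmul]
  zero_mem' := by simp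
  smul_mem' := by
    intro c a ha
    simp only [Set.mem_ofPred_eq] at *
    rw [map_smul, ha, TensorProduct.smul_tmul']

variable {k H}
variable {A M : Type*} [AddCommGroup A] [Module k A] [ComoduleAlgebra k H A]
  [AddCommGroup M] [Module k M] [RelHopfModule k H A M]

theorem mem_coinvariants {V : Type*} [AddCommGroup V] [Module k V] [RightComodule k H V] {v : V} :
    v ∈ coinvariants k H V ↔ coact v = v ⊗ₜ[k] (CoquasiBialgebra.one k : H) := Iff.rfl

section
variable {U V W : Type*} [AddCommGroup U] [Module k U] [RightComodule k H U]
  [AddCommGroup V] [Module k V] [RightComodule k H V]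
  [AddCommGroup W] [Module k W] [RightComodule k H W]

open CoquasiBialgebra in
theorem applyCoact_mid (u : U) (v : V) (w : W) (hv : v ∈ coinvariants k H V) :
    applyCoact (ω (k := k) (H := H)) (prodCoact coact (prodCoact coact coact))
      (u ⊗ₜ[k] (v ⊗ₜ[k] w)) = u ⊗ₜ[k] (v ⊗ₜ[k] w) := by
  have key : ∀ (x : U ⊗[k] H) (y : W ⊗[k] H),
      TensorProduct.rid k _ (TensorProduct.map LinearMap.id ω
        (TensorProduct.tensorTensorTensorComm k U H _ _ (x ⊗ₜ[k]
          TensorProduct.tensorTensorTensorComm k V H W H ((v ⊗ₜ[k] one k) ⊗ₜ[k] y)))) =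
      TensorProduct.rid k U (TensorProduct.map LinearMap.id (Coalgebra.counit (R := k)) x) ⊗ₜ[k]
        (v ⊗ₜ[k] TensorProduct.rid k W
          (TensorProduct.map LinearMap.id (Coalgebra.counit (R := k)) y)) := by
    intro x y
    induction x with
    | zero => simp
    | add x₁ x₂ h₁ h₂ => simp only [TensorProduct.add_tmul, map_add, h₁, h₂]
    | tmul u' h =>
      induction y with
      | zero => simp
      | add y₁ y₂ h₁ h₂ => simp only [TensorProduct.tmul_add, map_add, h₁, h₂]
      | tmul w' g =>
        simp [ω_one_mid, ← TensorProduct.smul_tmul', TensorProduct.tmul_smul, smul_smul, mul_comm]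
  have hv' : coact v = v ⊗ₜ[k] (one k : H) := hv
  have := key (coact u) (coact w)
  rw [coact_counit, coact_counit] at this
  simp only [applyCoact, prodCoact, LinearMap.comp_apply, TensorProduct.map_tmul, hv']
  exact this

open CoquasiBialgebra in
theorem applyCoact_left (u : U) (v : V) (w : W) (hu : u ∈ coinvariants k H U) :
    applyCoact (ω (k := k) (H := H)) (prodCoact coact (prodCoact coact coact))
      (u ⊗ₜ[k] (v ⊗ₜ[k] w)) = u ⊗ₜ[k] (v ⊗ₜ[k] w) := by
  have key : ∀ (x : V ⊗[k] H) (y : W ⊗[k] H),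
      TensorProduct.rid k _ (TensorProduct.map LinearMap.id ω
        (TensorProduct.tensorTensorTensorComm k U H _ _ ((u ⊗ₜ[k] one k) ⊗ₜ[k]
          TensorProduct.tensorTensorTensorComm k V H W H (x ⊗ₜ[k] y)))) =
      u ⊗ₜ[k] (TensorProduct.rid k V
          (TensorProduct.map LinearMap.id (Coalgebra.counit (R := k)) x) ⊗ₜ[k]
        TensorProduct.rid k W
          (TensorProduct.map LinearMap.id (Coalgebra.counit (R := k)) y)) := by
    intro x y
    induction x with
    | zero => simp
    | add x₁ x₂ h₁ h₂ =>
      simp only [TensorProduct.add_tmul, TensorProduct.tmul_add, map_add, h₁, h₂]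
    | tmul u' h =>
      induction y with
      | zero => simp
      | add y₁ y₂ h₁ h₂ => simp only [TensorProduct.tmul_add, map_add, h₁, h₂]
      | tmul w' g =>
        simp [ω_one_left, ← TensorProduct.smul_tmul', TensorProduct.tmul_smul, smul_smul, mul_comm]
  have hu' : coact u = u ⊗ₜ[k] (one k : H) := hu
  have := key (coact v) (coact w)
  rw [coact_counit, coact_counit] at this
  simp only [applyCoact, prodCoact, LinearMap.comp_apply, TensorProduct.map_tmul, hu']
  exact this

open CoquasiBialgebra in
theorem applyCoact_right (u : U) (v : V) (w : W) (hw : w ∈ coinvariants k H W) :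
    applyCoact (ω (k := k) (H := H)) (prodCoact coact (prodCoact coact coact))
      (u ⊗ₜ[k] (v ⊗ₜ[k] w)) = u ⊗ₜ[k] (v ⊗ₜ[k] w) := by
  have key : ∀ (x : U ⊗[k] H) (y : V ⊗[k] H),
      TensorProduct.rid k _ (TensorProduct.map LinearMap.id ω
        (TensorProduct.tensorTensorTensorComm k U H _ _ (x ⊗ₜ[k]
          TensorProduct.tensorTensorTensorComm k V H W H (y ⊗ₜ[k] (w ⊗ₜ[k] one k))))) =
      TensorProduct.rid k U (TensorProduct.map LinearMap.id (Coalgebra.counit (R := k)) x) ⊗ₜ[k]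
        (TensorProduct.rid k V
          (TensorProduct.map LinearMap.id (Coalgebra.counit (R := k)) y) ⊗ₜ[k] w) := by
    intro x y
    induction x with
    | zero => simp
    | add x₁ x₂ h₁ h₂ => simp only [TensorProduct.add_tmul, map_add, h₁, h₂]
    | tmul u' h =>
      induction y with
      | zero => simp
      | add y₁ y₂ h₁ h₂ =>
        simp only [TensorProduct.tmul_add, TensorProduct.add_tmul, map_add, h₁, h₂]
      | tmul w' g =>
        simp [ω_one_right, ← TensorProduct.smul_tmul', TensorProduct.tmul_smul, smul_smul, mul_comm]
  have hw' : coact w = w ⊗ₜ[k] (one k : H) := hw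
  have := key (coact u) (coact v)
  rw [coact_counit, coact_counit] at this
  simp only [applyCoact, prodCoact, LinearMap.comp_apply, TensorProduct.map_tmul, hw']
  exact this

end

/-- `(mb)c = m(bc)` for coinvariant `b`. -/
theorem act_act_mid (m : M) (b c : A) (hb : b ∈ coinvariants k H A) :
    RelHopfModule.act H (RelHopfModule.act H (m ⊗ₜ[k] b) ⊗ₜ[k] c) =
      RelHopfModule.act H (m ⊗ₜ[k] ComoduleAlgebra.mul H (b ⊗ₜ[k] c)) := by
  rw [RelHopfModule.act_quasi_assoc, applyCoact_mid m b c hb, TensorProduct.map_tmul,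
    LinearMap.id_apply]

/-- `(ba)c = b(ac)` for coinvariant `b`. -/
theorem mul_mul_left (b a c : A) (hb : b ∈ coinvariants k H A) :
    ComoduleAlgebra.mul H (ComoduleAlgebra.mul H (b ⊗ₜ[k] a) ⊗ₜ[k] c) =
      ComoduleAlgebra.mul H (b ⊗ₜ[k] ComoduleAlgebra.mul H (a ⊗ₜ[k] c)) := by
  rw [ComoduleAlgebra.mul_quasi_assoc, applyCoact_left b a c hb, TensorProduct.map_tmul,
    LinearMap.id_apply]

theorem coact_act_coinv (m : M) (b : A) (hb : b ∈ coinvariants k H A) :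
    coact (RelHopfModule.act H (m ⊗ₜ[k] b)) =
      TensorProduct.map (RelHopfModule.act H ∘ₗ (TensorProduct.mk k M A).flip b)
        (LinearMap.id : H →ₗ[k] H) (coact m) := by
  have hb' : coact b = b ⊗ₜ[k] (CoquasiBialgebra.one k : H) := hb
  rw [RelHopfModule.coact_act]
  simp only [prodCoact, LinearMap.comp_apply, TensorProduct.map_tmul, hb']
  induction (coact m : M ⊗[k] H) with
  | zero => simp
  | add x y hx hy => simp only [TensorProduct.add_tmul, map_add, hx, hy]
  | tmul x h => simp [CoquasiBialgebra.mul_one]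

theorem coact_coinv_mul (b a : A) (hb : b ∈ coinvariants k H A) :
    coact (ComoduleAlgebra.mul H (b ⊗ₜ[k] a)) =
      TensorProduct.map (ComoduleAlgebra.mul H ∘ₗ TensorProduct.mk k A A b)
        (LinearMap.id : H →ₗ[k] H) (coact a) := by
  have hb' : coact b = b ⊗ₜ[k] (CoquasiBialgebra.one k : H) := hb
  rw [ComoduleAlgebra.coact_mul]
  simp only [prodCoact, LinearMap.comp_apply, TensorProduct.map_tmul, hb']
  induction (coact a : A ⊗[k] H) with
  | zero => simp
  | add x y hx hy => simp only [TensorProduct.tmul_add, map_add, hx, hy]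
  | tmul x h => simp [CoquasiBialgebra.one_mul]

theorem act_mem_coinvariants {m : M} {b : A} (hm : m ∈ coinvariants k H M)
    (hb : b ∈ coinvariants k H A) :
    RelHopfModule.act H (m ⊗ₜ[k] b) ∈ coinvariants k H M := by
  have hm' : coact m = m ⊗ₜ[k] (CoquasiBialgebra.one k : H) := hm
  rw [mem_coinvariants, coact_act_coinv m b hb, hm']
  simp

/-- The algebra structure of `B = A^{co H}`, induced by that of `A`. -/
instance coinvariantsRing : Ring (coinvariants k H A) where
  __ := (inferInstance : AddCommGroup (coinvariants k H A))
  mul a b := ⟨ComoduleAlgebra.mul H (a.1 ⊗ₜ[k] b.1), act_mem_coinvariants (M := A) a.2 b.2⟩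
  one := ⟨ComoduleAlgebra.one k H, ComoduleAlgebra.coact_one⟩
  mul_assoc a b c := Subtype.ext (mul_mul_left a.1 b.1 c.1 a.2)
  one_mul a := Subtype.ext (ComoduleAlgebra.one_mul a.1)
  mul_one a := Subtype.ext (ComoduleAlgebra.mul_one a.1)
  left_distrib a b c := Subtype.ext (by
    change ComoduleAlgebra.mul H (a.1 ⊗ₜ[k] (b.1 + c.1)) = _ + _
    rw [TensorProduct.tmul_add, map_add]
    rfl)
  right_distrib a b c := Subtype.ext (by
    change ComoduleAlgebra.mul H ((a.1 + b.1) ⊗ₜ[k] c.1) = _ + _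
    rw [TensorProduct.add_tmul, map_add]
    rfl)
  zero_mul a := Subtype.ext (by
    change ComoduleAlgebra.mul H ((0 : A) ⊗ₜ[k] a.1) = 0
    simp)
  mul_zero a := Subtype.ext (by
    change ComoduleAlgebra.mul H (a.1 ⊗ₜ[k] (0 : A)) = 0
    simp)

theorem coinvariants_coe_mul (a b : coinvariants k H A) :
    ((a * b : coinvariants k H A) : A) = ComoduleAlgebra.mul H (a.1 ⊗ₜ[k] b.1) := rfl

theorem coinvariants_coe_one :
    ((1 : coinvariants k H A) : A) = ComoduleAlgebra.one k H := rfl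

instance coinvariantsAlgebra : Algebra k (coinvariants k H A) :=
  Algebra.ofModule
    (fun r x y => Subtype.ext (by
      change ComoduleAlgebra.mul H ((r • x.1) ⊗ₜ[k] y.1) = r • ComoduleAlgebra.mul H (x.1 ⊗ₜ[k] y.1)
      rw [← TensorProduct.smul_tmul', map_smul]))
    (fun r x y => Subtype.ext (by
      change ComoduleAlgebra.mul H (x.1 ⊗ₜ[k] (r • y.1)) = r • ComoduleAlgebra.mul H (x.1 ⊗ₜ[k] y.1)
      rw [TensorProduct.tmul_smul, map_smul]))

/-- `A` as a left `B`-module. -/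
instance leftModule : Module (coinvariants k H A) A where
  smul b a := ComoduleAlgebra.mul H (b.1 ⊗ₜ[k] a)
  one_smul a := ComoduleAlgebra.one_mul a
  mul_smul b c a := mul_mul_left b.1 c.1 a b.2
  smul_zero b := by change ComoduleAlgebra.mul H (b.1 ⊗ₜ[k] (0 : A)) = 0; simp
  smul_add b x y := by
    change ComoduleAlgebra.mul H (b.1 ⊗ₜ[k] (x + y)) = _ + _
    rw [TensorProduct.tmul_add, map_add]
    rfl
  add_smul b c a := by
    change ComoduleAlgebra.mul H ((b.1 + c.1) ⊗ₜ[k] a) = _ + _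
    rw [TensorProduct.add_tmul, map_add]
    rfl
  zero_smul a := by change ComoduleAlgebra.mul H ((0 : A) ⊗ₜ[k] a) = 0; simp

theorem coinv_smul_def (b : coinvariants k H A) (a : A) :
    b • a = ComoduleAlgebra.mul H (b.1 ⊗ₜ[k] a) := rfl

/-- A relative Hopf module is a right `B`-module by restriction of the `A`-action. -/
instance rightModule : Module (coinvariants k H A)ᵐᵒᵖ M where
  smul b m := RelHopfModule.act H (m ⊗ₜ[k] b.unop.1)
  one_smul m := RelHopfModule.act_one m
  mul_smul b c m := (act_act_mid m c.unop.1 b.unop.1 c.unop.2).symm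
  smul_zero b := by change RelHopfModule.act H ((0 : M) ⊗ₜ[k] b.unop.1) = 0; simp
  smul_add b x y := by
    change RelHopfModule.act H ((x + y) ⊗ₜ[k] b.unop.1) = _ + _
    rw [TensorProduct.add_tmul, map_add]
    rfl
  add_smul b c m := by
    change RelHopfModule.act H (m ⊗ₜ[k] (b.unop.1 + c.unop.1)) = _ + _
    rw [TensorProduct.tmul_add, map_add]
    rfl
  zero_smul m := by change RelHopfModule.act H (m ⊗ₜ[k] (0 : A)) = 0; simp

theorem op_smul_def (b : (coinvariants k H A)ᵐᵒᵖ) (m : M) :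
    b • m = RelHopfModule.act H (m ⊗ₜ[k] b.unop.1) := rfl

variable (k H A M) in
/-- `M^{co H}` as a right `B`-submodule of `M`. -/
def coinvariantsB : Submodule (coinvariants k H A)ᵐᵒᵖ M where
  carrier := {m | coact m = m ⊗ₜ[k] (CoquasiBialgebra.one k : H)}
  add_mem' ha hb := (coinvariants k H M).add_mem ha hb
  zero_mem' := (coinvariants k H M).zero_mem
  smul_mem' b _ hm := act_mem_coinvariants hm b.unop.2

end Coinvariants

/-! ## The tensor product over a noncommutative algebra, and faithful flatness -/

section Balanced

variable (k B N A : Type*) [Field k] [Ring B] [Algebra k B]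
  [AddCommGroup N] [Module k N] [Module Bᵐᵒᵖ N] [AddCommGroup A] [Module k A] [Module B A]

/-- The subspace of `N ⊗ A` spanned by the `nb ⊗ a - n ⊗ ba`. -/
def balancedRel : Submodule k (N ⊗[k] A) :=
  Submodule.span k {x | ∃ (n : N) (b : B) (a : A),
    x = (MulOpposite.op b • n) ⊗ₜ[k] a - n ⊗ₜ[k] (b • a)}

/-- `N ⊗_B A` for a right `B`-module `N` and a left `B`-module `A`. -/
abbrev BalTensor : Type _ := (N ⊗[k] A) ⧸ balancedRel k B N A

variable {k B N A}

/-- The element `n ⊗_B a`. -/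
def BalTensor.tmul (k : Type*) {B N A : Type*} [Field k] [Ring B] [Algebra k B]
    [AddCommGroup N] [Module k N] [Module Bᵐᵒᵖ N] [AddCommGroup A] [Module k A] [Module B A]
    (n : N) (a : A) : BalTensor k B N A :=
  (balancedRel k B N A).mkQ (n ⊗ₜ[k] a)

/-- The map out of `N ⊗_B A` induced by a balanced map. -/
def BalTensor.lift {X : Type*} [AddCommGroup X] [Module k X] (f : N ⊗[k] A →ₗ[k] X)
    (hf : ∀ (n : N) (b : B) (a : A), f ((MulOpposite.op b • n) ⊗ₜ[k] a) = f (n ⊗ₜ[k] (b • a))) :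
    BalTensor k B N A →ₗ[k] X :=
  (balancedRel k B N A).liftQ f (by
    rw [balancedRel, Submodule.span_le]
    rintro _ ⟨n, b, a, rfl⟩
    simp [hf])

@[simp]
theorem BalTensor.lift_tmul {X : Type*} [AddCommGroup X] [Module k X] (f : N ⊗[k] A →ₗ[k] X)
    (hf : ∀ (n : N) (b : B) (a : A), f ((MulOpposite.op b • n) ⊗ₜ[k] a) = f (n ⊗ₜ[k] (b • a)))
    (n : N) (a : A) : BalTensor.lift f hf (BalTensor.tmul k n a) = f (n ⊗ₜ[k] a) := rfl

theorem BalTensor.balanced (n : N) (b : B) (a : A) :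
    BalTensor.tmul (B := B) k (MulOpposite.op b • n) a = BalTensor.tmul k n (b • a) := by
  rw [BalTensor.tmul, BalTensor.tmul, ← sub_eq_zero, ← map_sub, Submodule.mkQ_apply,
    Submodule.Quotient.mk_eq_zero]
  exact Submodule.subset_span ⟨n, b, a, rfl⟩

theorem BalTensor.hom_ext {X : Type*} [AddCommGroup X] [Module k X]
    {f g : BalTensor k B N A →ₗ[k] X}
    (h : ∀ (n : N) (a : A), f (BalTensor.tmul k n a) = g (BalTensor.tmul k n a)) : f = g :=
  Submodule.linearMap_qext _ (TensorProduct.ext' h)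

variable {N' : Type*} [AddCommGroup N'] [Module k N'] [Module Bᵐᵒᵖ N']

/-- `g ⊗_B A` for a right `B`-linear map `g`. -/
def BalTensor.mapLeft (A : Type*) [AddCommGroup A] [Module k A] [Module B A]
    [IsScalarTower k Bᵐᵒᵖ N] [IsScalarTower k Bᵐᵒᵖ N'] (g : N →ₗ[Bᵐᵒᵖ] N') :
    BalTensor k B N A →ₗ[k] BalTensor k B N' A :=
  BalTensor.lift
    ((balancedRel k B N' A).mkQ ∘ₗ TensorProduct.map (g.restrictScalars k) LinearMap.id) (by
      intro n b a
      have h := BalTensor.balanced (k := k) (g n) b a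
      rw [← map_smul] at h
      exact h)

@[simp]
theorem BalTensor.mapLeft_tmul
    [IsScalarTower k Bᵐᵒᵖ N] [IsScalarTower k Bᵐᵒᵖ N'] (g : N →ₗ[Bᵐᵒᵖ] N') (n : N) (a : A) :
    BalTensor.mapLeft A g (BalTensor.tmul k n a) = BalTensor.tmul k (g n) a := rfl

end Balanced

open scoped ModuleCat in
/-- The left `B`-module `A` is faithfully flat: a sequence `N₁ → N₂ → N₃` of right `B`-modules is
exact if and only if `N₁ ⊗_B A → N₂ ⊗_B A → N₃ ⊗_B A` is. -/
def LeftFaithfullyFlat (k B A : Type u) [Field k] [Ring B] [Algebra k B]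
    [AddCommGroup A] [Module k A] [Module B A] : Prop :=
  ∀ (N₁ N₂ N₃ : ModuleCat.{u} Bᵐᵒᵖ) (f : N₁ ⟶ N₂) (g : N₂ ⟶ N₃),
    Function.Exact f.hom g.hom ↔
      Function.Exact (BalTensor.mapLeft (k := k) A f.hom) (BalTensor.mapLeft (k := k) A g.hom)

/-! ## The Galois map -/

section Galois

variable {k H A M : Type*} [Field k] [AddCommGroup H] [Module k H] [CoquasiHopfAlgebra k H]
  [AddCommGroup A] [Module k A] [ComoduleAlgebra k H A]
  [AddCommGroup M] [Module k M] [RelHopfModule k H A M]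

open CoquasiBialgebra CoquasiHopfAlgebra

variable (k H) in
/-- `h ↦ h₁β(h₂) ⊗ (S(h₃) ⊗ h₄)`. -/
def canAux : H →ₗ[k] H ⊗[k] (H ⊗[k] H) :=
  TensorProduct.map (convR LinearMap.id β) (TensorProduct.map S LinearMap.id) ∘ₗ comul₃ k H

variable (k H) in
/-- `x ⊗ (y ⊗ (z ⊗ t)) ↦ ω⁻¹(x, y, z) t`. -/
def ωInvApply : H ⊗[k] (H ⊗[k] (H ⊗[k] H)) →ₗ[k] H :=
  (TensorProduct.lid k H).toLinearMap ∘ₗ TensorProduct.map ωInv LinearMap.id ∘ₗ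
    (TensorProduct.assoc k H (H ⊗[k] H) H).symm.toLinearMap ∘ₗ
      TensorProduct.map LinearMap.id (TensorProduct.assoc k H H H).symm.toLinearMap

variable (H A M) in
/-- `m ⊗ a ↦ m₀a₀ ⊗ ω⁻¹(m₁, a₁β(a₂), S(a₃)) a₄` on `M ⊗ A`. -/
def canPre : M ⊗[k] A →ₗ[k] M ⊗[k] H :=
  TensorProduct.map (RelHopfModule.act H) (ωInvApply k H) ∘ₗ
    prodCoact coact (TensorProduct.map LinearMap.id (canAux k H) ∘ₗ coact)

theorem canPre_balanced (m : M) (b : coinvariants k H A) (a : A) :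
    canPre H A M ((MulOpposite.op b • m) ⊗ₜ[k] a) = canPre H A M (m ⊗ₜ[k] (b • a)) := by
  simp only [canPre, prodCoact, LinearMap.comp_apply, TensorProduct.map_tmul, op_smul_def,
    coinv_smul_def, MulOpposite.unop_op, coact_act_coinv m b.1 b.2, coact_coinv_mul b.1 a b.2]
  induction (coact m : M ⊗[k] H) with
  | zero => simp
  | add x y hx hy => simp only [TensorProduct.add_tmul, map_add, hx, hy]
  | tmul m' h =>
    induction (coact a : A ⊗[k] H) with
    | zero => simp
    | add x y hx hy => simp only [TensorProduct.tmul_add, map_add, hx, hy]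
    | tmul a' g =>
      simp only [TensorProduct.map_tmul, LinearMap.id_apply]
      induction (canAux k H g) with
      | zero => simp
      | add x y hx hy => simp only [TensorProduct.tmul_add, map_add, hx, hy]
      | tmul p q => simp [act_act_mid m' b.1 a' b.2]

variable (k H A M) in
/-- The map `can_M : M ⊗_B A → M ⊗ H`,
`m ⊗_B a ↦ m₀a₀ ⊗ ω⁻¹(m₁, a₁β(a₂), S(a₃)) a₄`, for a relative Hopf module `M`. -/
def canMap : BalTensor k (coinvariants k H A) M A →ₗ[k] M ⊗[k] H :=
  BalTensor.lift (canPre H A M) canPre_balanced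

variable (k H A) in
/-- `B ⊆ A` is Galois: `can : A ⊗_B A → A ⊗ H`,
`a ⊗_B b ↦ a₀b₀ ⊗ ω⁻¹(a₁, b₁β(b₂), S(b₃)) b₄`, is bijective. -/
def IsGaloisExtension : Prop := Function.Bijective (canMap k H A A)

end Galois

/-! ## The category of relative Hopf modules -/

section Cat

variable (k H A : Type u) [Field k] [AddCommGroup H] [Module k H] [CoquasiBialgebra k H]
  [AddCommGroup A] [Module k A] [ComoduleAlgebra k H A]

/-- Objects of the category of relative right `(H, A)`-Hopf modules. -/
structure HopfModuleCat where
  carrier : Type u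
  [addCommGroup : AddCommGroup carrier]
  [module : Module k carrier]
  [hopf : RelHopfModule k H A carrier]

attribute [instance] HopfModuleCat.addCommGroup HopfModuleCat.module HopfModuleCat.hopf

variable {k H A}

/-- Morphisms of relative Hopf modules: colinear maps that respect the `A`-action. -/
@[ext]
structure HopfModuleHom (M N : HopfModuleCat k H A) where
  hom : M.carrier →ₗ[k] N.carrier
  colinear : ∀ m, (coact (hom m) : N.carrier ⊗[k] H) =
    TensorProduct.map hom LinearMap.id (coact m)
  map_act : ∀ (m : M.carrier) (a : A),
    hom (RelHopfModule.act H (m ⊗ₜ[k] a)) = RelHopfModule.act H (hom m ⊗ₜ[k] a)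

instance : Category (HopfModuleCat k H A) where
  Hom M N := HopfModuleHom M N
  id M := ⟨LinearMap.id, fun m => by rw [TensorProduct.map_id]; rfl, fun _ _ => rfl⟩
  comp f g := ⟨g.hom ∘ₗ f.hom,
    fun m => by
      rw [LinearMap.comp_apply, g.colinear, f.colinear, ← LinearMap.comp_apply,
        ← TensorProduct.map_comp, LinearMap.id_comp],
    fun m a => by simp only [LinearMap.comp_apply, f.map_act, g.map_act]⟩

@[simp] theorem id_hom (M : HopfModuleCat k H A) : HopfModuleHom.hom (𝟙 M) = LinearMap.id := rfl

@[simp] theorem comp_hom {M N P : HopfModuleCat k H A} (f : M ⟶ N) (g : N ⟶ P) :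
    HopfModuleHom.hom (f ≫ g) = g.hom ∘ₗ f.hom := rfl

variable (k H A)

/-- The functor of coinvariants `M ↦ M^{co H}` to right `B`-modules. -/
def coinvFunctor : HopfModuleCat k H A ⥤ ModuleCat.{u} (coinvariants k H A)ᵐᵒᵖ where
  obj M := ModuleCat.of _ (coinvariantsB k H A M.carrier)
  map {M N} f := ModuleCat.ofHom
    { toFun := fun m => ⟨f.hom m.1, by
        have hm : coact m.1 = m.1 ⊗ₜ[k] (CoquasiBialgebra.one k : H) := m.2
        change coact (f.hom m.1) = f.hom m.1 ⊗ₜ[k] (CoquasiBialgebra.one k : H)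
        rw [f.colinear, hm, TensorProduct.map_tmul, LinearMap.id_apply]⟩
      map_add' := fun x y => Subtype.ext (map_add f.hom x.1 y.1)
      map_smul' := fun b x => Subtype.ext (f.map_act x.1 b.unop.1) }

end Cat

/-! ## The induction functor -/

section Induction

variable {k H A N : Type*} [Field k] [AddCommGroup H] [Module k H] [CoquasiBialgebra k H]
  [AddCommGroup A] [Module k A] [ComoduleAlgebra k H A]
  [AddCommGroup N] [Module k N] [Module (coinvariants k H A)ᵐᵒᵖ N]

variable (k H A N) in
/-- `n ⊗_B a ↦ (n ⊗_B a₀) ⊗ a₁`. -/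
def inducedCoact : BalTensor k (coinvariants k H A) N A →ₗ[k]
    BalTensor k (coinvariants k H A) N A ⊗[k] H :=
  BalTensor.lift
    (TensorProduct.map (balancedRel k (coinvariants k H A) N A).mkQ LinearMap.id ∘ₗ
      (TensorProduct.assoc k N A H).symm.toLinearMap ∘ₗ TensorProduct.map LinearMap.id coact) (by
    intro n b a
    simp only [LinearMap.comp_apply, TensorProduct.map_tmul, LinearMap.id_apply, coinv_smul_def,
      coact_coinv_mul b.1 a b.2]
    induction (coact a : A ⊗[k] H) with
    | zero => simp
    | add x y hx hy => simp only [TensorProduct.tmul_add, map_add, hx, hy]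
    | tmul a' h =>
      exact congrArg (· ⊗ₜ[k] h) (BalTensor.balanced (k := k) n b a'))

theorem inducedCoact_tmul (n : N) (a : A) :
    inducedCoact k H A N (BalTensor.tmul k n a) =
      TensorProduct.map ((balancedRel k (coinvariants k H A) N A).mkQ ∘ₗ TensorProduct.mk k N A n)
        LinearMap.id (coact a) := by
  change TensorProduct.map _ LinearMap.id ((TensorProduct.assoc k N A H).symm
    (n ⊗ₜ[k] coact a)) = _
  induction (coact a : A ⊗[k] H) with
  | zero => simp
  | add x y hx hy => simp only [TensorProduct.tmul_add, map_add, hx, hy]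
  | tmul a' h => rfl

variable (k H A N) in
/-- `(n ⊗_B a) ⊗ c ↦ n ⊗_B ac`. -/
def inducedAct : BalTensor k (coinvariants k H A) N A ⊗[k] A →ₗ[k]
    BalTensor k (coinvariants k H A) N A :=
  TensorProduct.lift (BalTensor.lift
    (TensorProduct.lift
      { toFun := fun n =>
          (TensorProduct.curry (ComoduleAlgebra.mul (k := k) (A := A) H)).compr₂
            ((balancedRel k (coinvariants k H A) N A).mkQ ∘ₗ TensorProduct.mk k N A n)
        map_add' := fun x y => by
          ext a c
          simp
        map_smul' := fun r x => by
          ext a c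
          simp })
    (by
      intro n b a
      ext c
      change BalTensor.tmul k (MulOpposite.op b • n) (ComoduleAlgebra.mul H (a ⊗ₜ[k] c)) =
        BalTensor.tmul k n (ComoduleAlgebra.mul H (ComoduleAlgebra.mul H (b.1 ⊗ₜ[k] a) ⊗ₜ[k] c))
      rw [BalTensor.balanced, mul_mul_left b.1 a c b.2]
      rfl))

theorem inducedAct_tmul (n : N) (a c : A) :
    inducedAct k H A N (BalTensor.tmul k n a ⊗ₜ[k] c) =
      BalTensor.tmul k n (ComoduleAlgebra.mul H (a ⊗ₜ[k] c)) := rfl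

/-- An identity that is linear in `v ∈ N ⊗_B A` may be checked on the elements `n ⊗_B a`. -/
theorem BalTensor.induction {k B N A : Type*} [Field k] [Ring B] [Algebra k B]
    [AddCommGroup N] [Module k N] [Module Bᵐᵒᵖ N] [AddCommGroup A] [Module k A] [Module B A]
    {P : BalTensor k B N A → Prop} (h0 : P 0) (ht : ∀ n a, P (BalTensor.tmul k n a))
    (ha : ∀ x y, P x → P y → P (x + y)) (v : BalTensor k B N A) : P v := by
  obtain ⟨x, rfl⟩ := Submodule.mkQ_surjective _ v
  induction x with
  | zero => simpa using h0
  | tmul n a => exact ht n a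
  | add x y hx hy => rw [map_add]; exact ha _ _ hx hy

instance inducedComodule : RightComodule k H (BalTensor k (coinvariants k H A) N A) where
  coact := inducedCoact k H A N
  coact_coassoc v := by
    induction v using BalTensor.induction with
    | h0 => simp
    | ha x y hx hy => simp only [map_add, hx, hy]
    | ht n a =>
      rw [inducedCoact_tmul]
      set j := (balancedRel k (coinvariants k H A) N A).mkQ ∘ₗ TensorProduct.mk k N A n with hj
      have key : ∀ x : A ⊗[k] H, TensorProduct.assoc k _ H H
          (TensorProduct.map (inducedCoact k H A N) LinearMap.id
            (TensorProduct.map j LinearMap.id x)) =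
          TensorProduct.map j LinearMap.id (TensorProduct.assoc k A H H
            (TensorProduct.map coact LinearMap.id x)) := by
        intro x
        induction x with
        | zero => simp
        | add x y hx hy => simp only [map_add, hx, hy]
        | tmul a' h =>
          have e : inducedCoact k H A N (j a') = TensorProduct.map j LinearMap.id (coact a') :=
            inducedCoact_tmul n a'
          simp only [TensorProduct.map_tmul, LinearMap.id_apply, e]
          induction (coact a' : A ⊗[k] H) with
          | zero => simp
          | add x y hx hy => simp only [map_add, TensorProduct.add_tmul, hx, hy]
          | tmul p q => simp
      rw [key, coact_coassoc]
      induction (coact a : A ⊗[k] H) with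
      | zero => simp
      | add x y hx hy => simp only [map_add, hx, hy]
      | tmul p q => simp
  coact_counit v := by
    induction v using BalTensor.induction with
    | h0 => simp
    | ha x y hx hy => simp only [map_add, hx, hy]
    | ht n a =>
      rw [inducedCoact_tmul]
      set j := (balancedRel k (coinvariants k H A) N A).mkQ ∘ₗ TensorProduct.mk k N A n with hj
      have key : ∀ x : A ⊗[k] H, TensorProduct.rid k _
          (TensorProduct.map LinearMap.id (Coalgebra.counit (R := k))
            (TensorProduct.map j LinearMap.id x)) =
          j (TensorProduct.rid k A
            (TensorProduct.map LinearMap.id (Coalgebra.counit (R := k)) x)) := by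
        intro x
        induction x with
        | zero => simp
        | add x y hx hy => simp only [map_add, hx, hy]
        | tmul a' h => simp
      rw [key, coact_counit]
      rfl

instance inducedHopfModule : RelHopfModule k H A (BalTensor k (coinvariants k H A) N A) where
  act := inducedAct k H A N
  coact_act v c := by
    induction v using BalTensor.induction with
    | h0 => simp
    | ha x y hx hy => simp only [map_add, TensorProduct.add_tmul, hx, hy]
    | ht n a =>
      rw [inducedAct_tmul]
      change inducedCoact k H A N _ = TensorProduct.map (inducedAct k H A N) _
        (TensorProduct.tensorTensorTensorComm k _ H A H
          (inducedCoact k H A N (BalTensor.tmul k n a) ⊗ₜ[k] coact c))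
      rw [inducedCoact_tmul, inducedCoact_tmul, ComoduleAlgebra.coact_mul]
      simp only [prodCoact, LinearMap.comp_apply, TensorProduct.map_tmul]
      induction (coact a : A ⊗[k] H) with
      | zero => simp
      | add x y hx hy => simp only [map_add, TensorProduct.add_tmul, hx, hy]
      | tmul p q =>
        induction (coact c : A ⊗[k] H) with
        | zero => simp
        | add x y hx hy => simp only [map_add, TensorProduct.tmul_add, hx, hy]
        | tmul r s => rfl
  act_one v := by
    induction v using BalTensor.induction with
    | h0 => simp
    | ha x y hx hy => simp only [map_add, TensorProduct.add_tmul, hx, hy]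
    | ht n a => rw [inducedAct_tmul, ComoduleAlgebra.mul_one]
  act_quasi_assoc v b c := by
    induction v using BalTensor.induction with
    | h0 => simp
    | ha x y hx hy => simp only [map_add, TensorProduct.add_tmul, hx, hy]
    | ht n a =>
      set j := (balancedRel k (coinvariants k H A) N A).mkQ ∘ₗ TensorProduct.mk k N A n with hj
      rw [inducedAct_tmul, inducedAct_tmul, ComoduleAlgebra.mul_quasi_assoc]
      have key : applyCoact (CoquasiBialgebra.ω (k := k) (H := H))
          (prodCoact (inducedCoact k H A N) (prodCoact coact coact))
            (BalTensor.tmul k n a ⊗ₜ[k] (b ⊗ₜ[k] c)) =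
          TensorProduct.map j LinearMap.id (applyCoact (CoquasiBialgebra.ω (k := k) (H := H))
            (prodCoact coact (prodCoact coact coact)) (a ⊗ₜ[k] (b ⊗ₜ[k] c))) := by
        change TensorProduct.rid k _ (TensorProduct.map LinearMap.id CoquasiBialgebra.ω
            (TensorProduct.tensorTensorTensorComm k _ H _ _
              (inducedCoact k H A N (BalTensor.tmul k n a) ⊗ₜ[k]
                prodCoact coact coact (b ⊗ₜ[k] c)))) =
          TensorProduct.map j LinearMap.id (TensorProduct.rid k _
            (TensorProduct.map LinearMap.id CoquasiBialgebra.ω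
              (TensorProduct.tensorTensorTensorComm k A H _ _
                (coact a ⊗ₜ[k] prodCoact coact coact (b ⊗ₜ[k] c)))))
        rw [inducedCoact_tmul]
        induction (coact a : A ⊗[k] H) with
        | zero => simp
        | add x y hx hy => simp only [map_add, TensorProduct.add_tmul, hx, hy]
        | tmul p q =>
          induction (prodCoact coact coact (b ⊗ₜ[k] c) : (A ⊗[k] A) ⊗[k] (H ⊗[k] H)) with
          | zero => simp
          | add x y hx hy => simp only [map_add, TensorProduct.tmul_add, hx, hy]
          | tmul r s => simp [j]
      refine Eq.trans ?_ (congrArg (fun z => inducedAct k H A N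
        (TensorProduct.map LinearMap.id (ComoduleAlgebra.mul H) z)) key.symm)
      change j _ = _
      induction (applyCoact (CoquasiBialgebra.ω (k := k) (H := H))
            (prodCoact coact (prodCoact coact coact)) (a ⊗ₜ[k] (b ⊗ₜ[k] c))) with
      | zero => simp
      | add x y hx hy => simp only [map_add, hx, hy]
      | tmul r s => rfl

end Induction

section Functor

variable (k H A : Type u) [Field k] [AddCommGroup H] [Module k H] [CoquasiBialgebra k H]
  [AddCommGroup A] [Module k A] [ComoduleAlgebra k H A]

open scoped ModuleCat in
/-- The induction functor `N ↦ N ⊗_B A` from right `B`-modules to relative Hopf modules. -/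
def inductionFunctor : ModuleCat.{u} (coinvariants k H A)ᵐᵒᵖ ⥤ HopfModuleCat k H A where
  obj N := HopfModuleCat.mk (BalTensor k (coinvariants k H A) N A)
  map {N N'} f :=
    { hom := BalTensor.mapLeft A f.hom
      colinear := fun v => by
        induction v using BalTensor.induction with
        | h0 => simp
        | ha x y hx hy => simp only [map_add, hx, hy]
        | ht n a =>
          change inducedCoact k H A N' (BalTensor.tmul k (f.hom n) a) =
            TensorProduct.map _ _ (inducedCoact k H A N (BalTensor.tmul k n a))
          rw [inducedCoact_tmul, inducedCoact_tmul]
          induction (coact a : A ⊗[k] H) with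
          | zero => simp
          | add x y hx hy => simp only [map_add, hx, hy]
          | tmul r s => rfl
      map_act := fun v c => by
        induction v using BalTensor.induction with
        | h0 => simp
        | ha x y hx hy => simp only [map_add, TensorProduct.add_tmul, hx, hy]
        | ht n a => rfl }
  map_id N := by
    refine HopfModuleHom.ext (BalTensor.hom_ext fun n a => ?_)
    rfl
  map_comp f g := by
    refine HopfModuleHom.ext (BalTensor.hom_ext fun n a => ?_)
    rfl

end Functor

end CoquasiHopf
end

/-! Right `H`-comodules form a monoidal category. Its associator on `U ⊗ V ⊗ W` is the operator by
which the functional `ω` acts through the coactions (`act₃`), the cocycle identity is the pentagon,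
and `A` is an algebra in this category. The proof replaces Sweedler computations by operators:
convolution of functionals becomes composition (`IsCoaction.applyCoact_convL`), and operators of
this kind commute with colinear maps (`act₃_naturality`).

Let `H^S` be `H` with coaction `h ↦ h₂ ⊗ S(h₁)`. For every comodule `V` the map `v ↦ v₀ ⊗ β(v₁)v₂`
from `V` to `V ⊗ H^S` is injective with coinvariant values (`betaCoact_injective`,
`mulCoact_betaCoact`). By `canPre_eq`, `can_M` is this map for `A`, followed by the inverse
associator `M ⊗ (A ⊗ H^S) → (M ⊗ A) ⊗ H^S` and the action of `A` on `M`. So it is natural and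
colinear. The pentagon shows that on a free module `V ⊗ A` it is, up to an isomorphism, `V ⊗ can`
(`canPre_free`). If `can` is bijective, so is `can_M` for free `M`, and then for all `M`, since `(M
⊗ A) ⊗ A ⇉ M ⊗ A → M` is a coequalizer split over `k` (`canMap_bijective`). This is (b).

For (1) ⟹ (2): on `M^{co H} ⊗_B A` the map `can_M` equals the counit `m ⊗ a ↦ ma` followed by the
injective map `betaCoact` (`canMap_mapLeft_coinvariant`). Injectivity of the counit then follows
from flatness. For surjectivity, the preimage under `can_M` of `m₀ ⊗ β(m₁)m₂` is coinvariant for the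
coaction on the left factor of `M ⊗_B A`, hence lies in `M^{co H} ⊗_B A` by flatness. The unit is
bijective because it becomes so after the faithful functor `- ⊗_B A`, by a triangle identity.

For (2) ⟹ (1): kernels of morphisms of Hopf modules are Hopf modules, so a morphism injective on
coinvariants is injective. With the unit isomorphism this gives faithful flatness
(`leftFaithfullyFlat_of_unit_counit`). The Galois property comes from the counit of the single
module `H ⊗ A`, whose Galois map is `H ⊗ can` up to `twist`. The functional `ω⁻¹(S(h₁), α(h₂)h₃, g)`
removes the extra factor `H`. The inverse of `S` is used to embed `A` into the coinvariants of `H ⊗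
A` (`canMap_injective_of_counitMap`). -/

noncomputable section

namespace CoquasiHopf


/-! ## Coactions as linear maps -/

section Coaction

variable {k C D E V W U X Y : Type*} [Field k]
  [AddCommGroup C] [Module k C] [AddCommGroup D] [Module k D] [AddCommGroup E] [Module k E]
  [AddCommGroup V] [Module k V] [AddCommGroup W] [Module k W] [AddCommGroup U] [Module k U]
  [AddCommGroup X] [Module k X] [AddCommGroup Y] [Module k Y]

/-- The axioms of a right coaction for a linear map `ρ : V → V ⊗ C`. -/
structure IsCoaction [Coalgebra k C] (ρ : V →ₗ[k] V ⊗[k] C) : Prop where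
  coassoc : ∀ v : V, TensorProduct.assoc k V C C (TensorProduct.map ρ LinearMap.id (ρ v)) =
    TensorProduct.map LinearMap.id Coalgebra.comul (ρ v)
  counit : ∀ v : V, TensorProduct.rid k V
    (TensorProduct.map LinearMap.id (Coalgebra.counit (R := k)) (ρ v)) = v

theorem isCoaction_coact [Coalgebra k C] [RightComodule k C V] :
    IsCoaction (RightComodule.coact : V →ₗ[k] V ⊗[k] C) :=
  ⟨RightComodule.coact_coassoc, RightComodule.coact_counit⟩

/-- `v ↦ v₀ ⊗ f(v₁)`. -/
def push (f : C →ₗ[k] X) (ρ : V →ₗ[k] V ⊗[k] C) : V →ₗ[k] V ⊗[k] X :=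
  TensorProduct.map LinearMap.id f ∘ₗ ρ

theorem push_apply (f : C →ₗ[k] X) (ρ : V →ₗ[k] V ⊗[k] C) (v : V) :
    push f ρ v = TensorProduct.map LinearMap.id f (ρ v) := rfl

theorem push_id (ρ : V →ₗ[k] V ⊗[k] C) : push LinearMap.id ρ = ρ := by
  rw [push, TensorProduct.map_id, LinearMap.id_comp]

theorem push_push (f : C →ₗ[k] X) (g : X →ₗ[k] Y) (ρ : V →ₗ[k] V ⊗[k] C) :
    push g (push f ρ) = push (g ∘ₗ f) ρ := by
  rw [push, push, push, ← LinearMap.comp_assoc, ← TensorProduct.map_comp, LinearMap.id_comp]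

theorem applyCoact_push (φ : X →ₗ[k] k) (f : C →ₗ[k] X) (ρ : V →ₗ[k] V ⊗[k] C) :
    applyCoact φ (push f ρ) = applyCoact (φ ∘ₗ f) ρ := by
  change (TensorProduct.rid k V).toLinearMap ∘ₗ push φ (push f ρ) = _
  rw [push_push]
  rfl

/-- `F` intertwines `ρ` and `σ`. -/
def Colinear (ρ : V →ₗ[k] V ⊗[k] C) (σ : W →ₗ[k] W ⊗[k] C) (F : V →ₗ[k] W) : Prop :=
  σ ∘ₗ F = TensorProduct.map F LinearMap.id ∘ₗ ρ

theorem Colinear.push {ρ : V →ₗ[k] V ⊗[k] C} {σ : W →ₗ[k] W ⊗[k] C} {F : V →ₗ[k] W}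
    (h : Colinear ρ σ F) (f : C →ₗ[k] X) : Colinear (push f ρ) (push f σ) F := by
  rw [Colinear, CoquasiHopf.push, CoquasiHopf.push, LinearMap.comp_assoc, h,
    ← LinearMap.comp_assoc, ← LinearMap.comp_assoc, ← TensorProduct.map_comp,
    ← TensorProduct.map_comp]
  rfl

theorem Colinear.apply {ρ : V →ₗ[k] V ⊗[k] C} {σ : W →ₗ[k] W ⊗[k] C} {F : V →ₗ[k] W}
    (h : Colinear ρ σ F) (v : V) : σ (F v) = TensorProduct.map F LinearMap.id (ρ v) :=
  LinearMap.congr_fun h v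

theorem Colinear.comp {ρ : V →ₗ[k] V ⊗[k] C} {σ : W →ₗ[k] W ⊗[k] C} {τ : U →ₗ[k] U ⊗[k] C}
    {F : V →ₗ[k] W} {G : W →ₗ[k] U} (hG : Colinear σ τ G) (hF : Colinear ρ σ F) :
    Colinear ρ τ (G ∘ₗ F) := by
  rw [Colinear, ← LinearMap.comp_assoc, hG, LinearMap.comp_assoc, hF, ← LinearMap.comp_assoc,
    ← TensorProduct.map_comp, LinearMap.id_comp]

theorem Colinear.id (ρ : V →ₗ[k] V ⊗[k] C) : Colinear ρ ρ LinearMap.id := by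
  rw [Colinear, TensorProduct.map_id]
  rfl

theorem Colinear.applyCoact {ρ : V →ₗ[k] V ⊗[k] C} {σ : W →ₗ[k] W ⊗[k] C} {F : V →ₗ[k] W}
    (h : Colinear ρ σ F) (φ : C →ₗ[k] k) (v : V) :
    applyCoact φ σ (F v) = F (applyCoact φ ρ v) := by
  change TensorProduct.rid k W (TensorProduct.map LinearMap.id φ (σ (F v))) =
    F (TensorProduct.rid k V (TensorProduct.map LinearMap.id φ (ρ v)))
  rw [h.apply]
  induction ρ v with
  | zero => simp
  | add x y hx hy => simp only [map_add, hx, hy]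
  | tmul x y => simp

theorem Colinear.prod {V' W' : Type*} [AddCommGroup V'] [Module k V'] [AddCommGroup W'] [Module k W']
    {ρ : V →ₗ[k] V ⊗[k] C} {σ : W →ₗ[k] W ⊗[k] C} {F : V →ₗ[k] W}
    {ρ' : V' →ₗ[k] V' ⊗[k] D} {σ' : W' →ₗ[k] W' ⊗[k] D} {F' : V' →ₗ[k] W'}
    (h : Colinear ρ σ F) (h' : Colinear ρ' σ' F') :
    Colinear (prodCoact ρ ρ') (prodCoact σ σ') (TensorProduct.map F F') := by
  refine TensorProduct.ext' fun v v' => ?_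
  change TensorProduct.tensorTensorTensorComm k W C W' D (σ (F v) ⊗ₜ[k] σ' (F' v')) =
    TensorProduct.map (TensorProduct.map F F') LinearMap.id
      (TensorProduct.tensorTensorTensorComm k V C V' D (ρ v ⊗ₜ[k] ρ' v'))
  rw [h.apply, h'.apply]
  induction ρ v with
  | zero => simp
  | add x y hx hy => simp only [TensorProduct.add_tmul, map_add, hx, hy]
  | tmul x y =>
    induction ρ' v' with
    | zero => simp
    | add x y hx hy => simp only [TensorProduct.tmul_add, map_add, hx, hy]
    | tmul x y => simp

theorem prodCoact_push_push {X' : Type*} [AddCommGroup X'] [Module k X'] (f : C →ₗ[k] X)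
    (g : D →ₗ[k] X') (ρ : V →ₗ[k] V ⊗[k] C) (σ : W →ₗ[k] W ⊗[k] D) :
    prodCoact (push f ρ) (push g σ) = push (TensorProduct.map f g) (prodCoact ρ σ) := by
  refine TensorProduct.ext' fun v w => ?_
  change TensorProduct.tensorTensorTensorComm k V X W X'
      (TensorProduct.map LinearMap.id f (ρ v) ⊗ₜ[k] TensorProduct.map LinearMap.id g (σ w)) =
    TensorProduct.map LinearMap.id (TensorProduct.map f g)
      (TensorProduct.tensorTensorTensorComm k V C W D (ρ v ⊗ₜ[k] σ w))
  induction ρ v with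
  | zero => simp
  | add x y hx hy => simp only [TensorProduct.add_tmul, map_add, hx, hy]
  | tmul x y =>
    induction σ w with
    | zero => simp
    | add x y hx hy => simp only [TensorProduct.tmul_add, map_add, hx, hy]
    | tmul x y => simp

theorem prodCoact_push (g : D →ₗ[k] X) (ρ : V →ₗ[k] V ⊗[k] C) (σ : W →ₗ[k] W ⊗[k] D) :
    prodCoact ρ (push g σ) = push (TensorProduct.map LinearMap.id g) (prodCoact ρ σ) := by
  conv_lhs => rw [← push_id ρ, prodCoact_push_push]

theorem push_prodCoact (f : C →ₗ[k] X) (ρ : V →ₗ[k] V ⊗[k] C) (σ : W →ₗ[k] W ⊗[k] D) :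
    prodCoact (push f ρ) σ = push (TensorProduct.map f LinearMap.id) (prodCoact ρ σ) := by
  conv_lhs => rw [← push_id σ, prodCoact_push_push]

/-- Reassociation of three coactions. -/
theorem colinear_assoc (ρ : U →ₗ[k] U ⊗[k] C) (σ : V →ₗ[k] V ⊗[k] D) (τ : W →ₗ[k] W ⊗[k] E) :
    Colinear (push (TensorProduct.assoc k C D E).toLinearMap (prodCoact (prodCoact ρ σ) τ))
      (prodCoact ρ (prodCoact σ τ)) (TensorProduct.assoc k U V W).toLinearMap := by
  refine TensorProduct.ext_threefold fun u v w => ?_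
  change TensorProduct.tensorTensorTensorComm k U C _ _ (ρ u ⊗ₜ[k]
      TensorProduct.tensorTensorTensorComm k V D W E (σ v ⊗ₜ[k] τ w)) =
    TensorProduct.map (TensorProduct.assoc k U V W).toLinearMap LinearMap.id
      (TensorProduct.map LinearMap.id (TensorProduct.assoc k C D E).toLinearMap
        (TensorProduct.tensorTensorTensorComm k _ _ W E
          (TensorProduct.tensorTensorTensorComm k U C V D (ρ u ⊗ₜ[k] σ v) ⊗ₜ[k] τ w)))
  induction ρ u with
  | zero => simp
  | add x y hx hy => simp only [TensorProduct.add_tmul, map_add, hx, hy]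
  | tmul x y =>
    induction σ v with
    | zero => simp
    | add x y hx hy => simp only [TensorProduct.tmul_add, TensorProduct.add_tmul, map_add, hx, hy]
    | tmul x y =>
      induction τ w with
      | zero => simp
      | add x y hx hy => simp only [TensorProduct.tmul_add, map_add, hx, hy]
      | tmul x y => simp

theorem Colinear.of_inverse {ρ : V →ₗ[k] V ⊗[k] C} {σ : W →ₗ[k] W ⊗[k] C}
    {F : V →ₗ[k] W} {G : W →ₗ[k] V} (h : Colinear ρ σ F)
    (hl : G ∘ₗ F = LinearMap.id) (hr : F ∘ₗ G = LinearMap.id) : Colinear σ ρ G := by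
  have h1 : TensorProduct.map G LinearMap.id ∘ₗ (σ ∘ₗ F) ∘ₗ G =
      TensorProduct.map G LinearMap.id ∘ₗ (TensorProduct.map F LinearMap.id ∘ₗ ρ) ∘ₗ G := by
    rw [h]
  rw [LinearMap.comp_assoc, hr, LinearMap.comp_id, LinearMap.comp_assoc, ← LinearMap.comp_assoc,
    ← LinearMap.comp_assoc, ← TensorProduct.map_comp, hl, LinearMap.id_comp, TensorProduct.map_id,
    LinearMap.id_comp] at h1
  exact h1.symm

/-- The action of a functional on `C ⊗ (D ⊗ E)` on a triple tensor product of comodules. -/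
def act₃ (φ : C ⊗[k] (D ⊗[k] E) →ₗ[k] k) (ρ : U →ₗ[k] U ⊗[k] C) (σ : V →ₗ[k] V ⊗[k] D)
    (τ : W →ₗ[k] W ⊗[k] E) : U ⊗[k] (V ⊗[k] W) →ₗ[k] U ⊗[k] (V ⊗[k] W) :=
  applyCoact φ (prodCoact ρ (prodCoact σ τ))

/-- An operator that only reads the coacted legs cannot see a colinear map applied to the other
legs. For `φ = ω` this is naturality of the associator. -/
theorem act₃_naturality {U' V' W' : Type*} [AddCommGroup U'] [Module k U'] [AddCommGroup V']
    [Module k V'] [AddCommGroup W'] [Module k W'] {ρ' : U' →ₗ[k] U' ⊗[k] C}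
    {σ' : V' →ₗ[k] V' ⊗[k] D} {τ' : W' →ₗ[k] W' ⊗[k] E} {ρ : U →ₗ[k] U ⊗[k] C}
    {σ : V →ₗ[k] V ⊗[k] D} {τ : W →ₗ[k] W ⊗[k] E} {F : U →ₗ[k] U'} {G : V →ₗ[k] V'}
    {K : W →ₗ[k] W'} (φ : C ⊗[k] (D ⊗[k] E) →ₗ[k] k) (hF : Colinear ρ ρ' F)
    (hG : Colinear σ σ' G) (hK : Colinear τ τ' K) (x : U ⊗[k] (V ⊗[k] W)) :
    act₃ φ ρ' σ' τ' (TensorProduct.map F (TensorProduct.map G K) x) =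
      TensorProduct.map F (TensorProduct.map G K) (act₃ φ ρ σ τ x) :=
  (hF.prod (hG.prod hK)).applyCoact φ x

variable [Coalgebra k C] [Coalgebra k D]

/-- `v₀ ⊗ f(v₁) ⊗ g(v₂)`. -/
theorem IsCoaction.push_comul {ρ : V →ₗ[k] V ⊗[k] C} (h : IsCoaction ρ) (f : C →ₗ[k] X)
    (g : C →ₗ[k] Y) (v : V) :
    TensorProduct.assoc k V X Y (TensorProduct.map (push f ρ) g (ρ v)) =
      push (TensorProduct.map f g ∘ₗ Coalgebra.comul) ρ v := by
  rw [← push_push]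
  refine Eq.trans ?_ (congrArg (TensorProduct.map LinearMap.id (TensorProduct.map f g))
    (h.coassoc v))
  induction ρ v with
  | zero => simp
  | add x y hx hy => simp only [map_add, hx, hy]
  | tmul x y =>
    simp only [TensorProduct.map_tmul, push_apply, LinearMap.id_apply]
    induction ρ x with
    | zero => simp
    | add x y hx hy => simp only [map_add, TensorProduct.add_tmul, hx, hy]
    | tmul x y => simp

/-- By coassociativity both sides are `v₀ ⊗ f(v₁)φ(v₂)`. The next lemma is the mirror case `v₀ ⊗
φ(v₁)f(v₂)`. Together they turn quasi-associativity of `H` into colinearity of the associator. -/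
theorem IsCoaction.push_applyCoact {ρ : V →ₗ[k] V ⊗[k] C} (h : IsCoaction ρ) (f : C →ₗ[k] X)
    (φ : C →ₗ[k] k) (v : V) : push f ρ (applyCoact φ ρ v) = push (convR f φ) ρ v := by
  have := congrArg (TensorProduct.map LinearMap.id (TensorProduct.rid k X).toLinearMap)
    (h.push_comul f φ v)
  rw [← push_apply, push_push] at this
  refine Eq.trans ?_ this
  change push f ρ (TensorProduct.rid k V (TensorProduct.map LinearMap.id φ (ρ v))) = _
  induction ρ v with
  | zero => simp
  | add x y hx hy => simp only [map_add, hx, hy]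
  | tmul x y =>
    simp only [TensorProduct.map_tmul, LinearMap.id_apply, TensorProduct.rid_tmul, map_smul]
    induction push f ρ x with
    | zero => simp
    | add x y hx hy => simp only [map_add, TensorProduct.add_tmul, smul_add, hx, hy]
    | tmul x y => simp

theorem IsCoaction.map_applyCoact_push {ρ : V →ₗ[k] V ⊗[k] C} (h : IsCoaction ρ) (f : C →ₗ[k] X)
    (φ : C →ₗ[k] k) (v : V) :
    TensorProduct.map (applyCoact φ ρ) LinearMap.id (push f ρ v) = push (convL φ f) ρ v := by
  have := congrArg (TensorProduct.map LinearMap.id (TensorProduct.lid k X).toLinearMap)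
    (h.push_comul φ f v)
  rw [← push_apply, push_push] at this
  refine Eq.trans ?_ this
  rw [push_apply]
  induction ρ v with
  | zero => simp
  | add x y hx hy => simp only [map_add, hx, hy]
  | tmul x y =>
    change TensorProduct.rid k V (push φ ρ x) ⊗ₜ[k] f y = _
    simp only [TensorProduct.map_tmul]
    induction push φ ρ x with
    | zero => simp
    | add x y hx hy => simp only [map_add, TensorProduct.add_tmul, hx, hy]
    | tmul x y => simp [TensorProduct.smul_tmul]

theorem convR_eq_convL (φ ψ : C →ₗ[k] k) : convR φ ψ = convL φ ψ := by
  ext c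
  simp only [convR, convL, LinearMap.comp_apply]
  induction (Coalgebra.comul c : C ⊗[k] C) with
  | zero => simp
  | add x y hx hy => simp only [map_add, hx, hy]
  | tmul x y => simp [mul_comm]

/-- A right comodule is a left module over the convolution algebra of its coalgebra. This is the
device that turns identities between functionals into identities between operators. -/
theorem IsCoaction.applyCoact_convL {ρ : V →ₗ[k] V ⊗[k] C} (h : IsCoaction ρ)
    (φ ψ : C →ₗ[k] k) (v : V) : applyCoact (convL φ ψ) ρ v =
      applyCoact φ ρ (applyCoact ψ ρ v) := by
  change TensorProduct.rid k V (push (convL φ ψ) ρ v) =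
    TensorProduct.rid k V (push φ ρ (applyCoact ψ ρ v))
  rw [h.push_applyCoact, convR_eq_convL]

theorem IsCoaction.applyCoact_counit {ρ : V →ₗ[k] V ⊗[k] C} (h : IsCoaction ρ) (v : V) :
    applyCoact (Coalgebra.counit (R := k)) ρ v = v := h.counit v

theorem IsCoaction.applyCoact_cancel {ρ : V →ₗ[k] V ⊗[k] C} (h : IsCoaction ρ)
    {φ ψ : C →ₗ[k] k} (hφ : convL φ ψ = Coalgebra.counit) (v : V) :
    applyCoact φ ρ (applyCoact ψ ρ v) = v := by
  rw [← h.applyCoact_convL, hφ, h.applyCoact_counit]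

theorem IsCoaction.push {ρ : V →ₗ[k] V ⊗[k] C} (h : IsCoaction ρ) (f : C →ₗc[k] D) :
    IsCoaction (push f.toLinearMap ρ) where
  coassoc v := by
    have := h.push_comul f.toLinearMap f.toLinearMap v
    rw [f.map_comp_comul, ← push_push, push_apply] at this
    refine Eq.trans ?_ this
    rw [push_apply]
    congr 1
    induction ρ v with
    | zero => simp
    | add x y hx hy => simp only [map_add, hx, hy]
    | tmul x y => simp
  counit v := by
    refine Eq.trans ?_ (h.counit v)
    rw [push_apply, ← f.counit_comp]
    congr 1
    induction ρ v with
    | zero => simp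
    | add x y hx hy => simp only [map_add, hx, hy]
    | tmul x y => simp

theorem IsCoaction.prod {ρ : V →ₗ[k] V ⊗[k] C} (h : IsCoaction ρ) {σ : W →ₗ[k] W ⊗[k] D}
    (h' : IsCoaction σ) : IsCoaction (prodCoact ρ σ) where
  coassoc z := by
    induction z with
    | zero => simp
    | add x y hx hy => simp only [map_add, hx, hy]
    | tmul v w =>
      have e1 : ∀ (x : V ⊗[k] C) (y : W ⊗[k] D),
          TensorProduct.assoc k (V ⊗[k] W) (C ⊗[k] D) (C ⊗[k] D)
            (TensorProduct.map (prodCoact ρ σ) LinearMap.id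
              (TensorProduct.tensorTensorTensorComm k V C W D (x ⊗ₜ[k] y))) =
          TensorProduct.map LinearMap.id
            (TensorProduct.tensorTensorTensorComm k C C D D).toLinearMap
            (TensorProduct.tensorTensorTensorComm k V (C ⊗[k] C) W (D ⊗[k] D)
              (TensorProduct.assoc k V C C (TensorProduct.map ρ LinearMap.id x) ⊗ₜ[k]
                TensorProduct.assoc k W D D (TensorProduct.map σ LinearMap.id y))) := by
        intro x y
        induction x with
        | zero => simp
        | add x y hx hy => simp only [TensorProduct.add_tmul, map_add, hx, hy]
        | tmul x c =>
          induction y with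
          | zero => simp
          | add x y hx hy => simp only [TensorProduct.tmul_add, map_add, hx, hy]
          | tmul y d =>
            simp only [TensorProduct.map_tmul, TensorProduct.tensorTensorTensorComm_tmul, prodCoact,
              LinearMap.comp_apply, LinearEquiv.coe_coe, LinearMap.id_apply]
            induction ρ x with
            | zero => simp
            | add x y hx hy => simp only [TensorProduct.add_tmul, map_add, hx, hy]
            | tmul x c =>
              induction σ y with
              | zero => simp
              | add x y hx hy =>
                simp only [TensorProduct.tmul_add, TensorProduct.add_tmul, map_add, hx, hy]
              | tmul y d => simp
      have e2 : ∀ (x : V ⊗[k] C) (y : W ⊗[k] D),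
          TensorProduct.map LinearMap.id Coalgebra.comul
            (TensorProduct.tensorTensorTensorComm k V C W D (x ⊗ₜ[k] y)) =
          TensorProduct.map LinearMap.id
            (TensorProduct.tensorTensorTensorComm k C C D D).toLinearMap
            (TensorProduct.tensorTensorTensorComm k V (C ⊗[k] C) W (D ⊗[k] D)
              (TensorProduct.map LinearMap.id Coalgebra.comul x ⊗ₜ[k]
                TensorProduct.map LinearMap.id Coalgebra.comul y)) := by
        intro x y
        induction x with
        | zero => simp
        | add x y hx hy => simp only [TensorProduct.add_tmul, map_add, hx, hy]
        | tmul x c =>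
          induction y with
          | zero => simp
          | add x y hx hy => simp only [TensorProduct.tmul_add, map_add, hx, hy]
          | tmul y d => simp [TensorProduct.comul_tmul, TensorProduct.AlgebraTensorModule.tensorTensorTensorComm_eq]
      change TensorProduct.assoc k (V ⊗[k] W) (C ⊗[k] D) (C ⊗[k] D)
            (TensorProduct.map (prodCoact ρ σ) LinearMap.id
              (TensorProduct.tensorTensorTensorComm k V C W D (ρ v ⊗ₜ[k] σ w))) =
          TensorProduct.map LinearMap.id Coalgebra.comul
            (TensorProduct.tensorTensorTensorComm k V C W D (ρ v ⊗ₜ[k] σ w))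
      rw [e1, e2, h.coassoc, h'.coassoc]
  counit z := by
    induction z with
    | zero => simp
    | add x y hx hy => simp only [map_add, hx, hy]
    | tmul v w =>
      conv_rhs => rw [← h.counit v, ← h'.counit w]
      change TensorProduct.rid k _ (TensorProduct.map LinearMap.id Coalgebra.counit
        (TensorProduct.tensorTensorTensorComm k V C W D (ρ v ⊗ₜ[k] σ w))) = _
      induction ρ v with
      | zero => simp
      | add x y hx hy => simp only [TensorProduct.add_tmul, map_add, hx, hy]
      | tmul x c =>
        induction σ w with
        | zero => simp
        | add x y hx hy => simp only [TensorProduct.tmul_add, map_add, hx, hy]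
        | tmul y d =>
          simp [TensorProduct.smul_tmul', TensorProduct.tmul_smul, smul_smul, mul_comm]

/-- Functionals that ignore the first tensor factor. -/
theorem applyCoact_lid {ρ : V →ₗ[k] V ⊗[k] C} (h : IsCoaction ρ) (σ : W →ₗ[k] W ⊗[k] E)
    (φ : E →ₗ[k] k) (v : V) (w : W) :
    applyCoact (φ ∘ₗ (TensorProduct.lid k E).toLinearMap ∘ₗ
      TensorProduct.map Coalgebra.counit LinearMap.id) (prodCoact ρ σ) (v ⊗ₜ[k] w) =
      v ⊗ₜ[k] applyCoact φ σ w := by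
  conv_rhs => rw [← h.counit v]
  change TensorProduct.rid k _ (TensorProduct.map LinearMap.id _
        (TensorProduct.tensorTensorTensorComm k V C W E (ρ v ⊗ₜ[k] σ w))) =
    _ ⊗ₜ[k] TensorProduct.rid k W (TensorProduct.map LinearMap.id φ (σ w))
  induction ρ v with
  | zero => simp
  | add x y hx hy => simp only [TensorProduct.add_tmul, map_add, hx, hy]
  | tmul x c =>
    induction σ w with
    | zero => simp
    | add x y hx hy => simp only [TensorProduct.tmul_add, map_add, hx, hy]
    | tmul y d =>
      simp [TensorProduct.smul_tmul', TensorProduct.tmul_smul, smul_smul, mul_comm]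

/-- Functionals that ignore the last tensor factor. -/
theorem applyCoact_rid (ρ : W →ₗ[k] W ⊗[k] E) {σ : V →ₗ[k] V ⊗[k] C} (h : IsCoaction σ)
    (φ : E →ₗ[k] k) (v : V) (w : W) :
    applyCoact (φ ∘ₗ (TensorProduct.rid k E).toLinearMap ∘ₗ
      TensorProduct.map LinearMap.id Coalgebra.counit) (prodCoact ρ σ) (w ⊗ₜ[k] v) =
      applyCoact φ ρ w ⊗ₜ[k] v := by
  conv_rhs => rw [← h.counit v]
  change TensorProduct.rid k _ (TensorProduct.map LinearMap.id _
        (TensorProduct.tensorTensorTensorComm k W E V C (ρ w ⊗ₜ[k] σ v))) =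
    TensorProduct.rid k W (TensorProduct.map LinearMap.id φ (ρ w)) ⊗ₜ[k] _
  induction σ v with
  | zero => simp
  | add x y hx hy => simp only [TensorProduct.tmul_add, map_add, hx, hy]
  | tmul x c =>
    induction ρ w with
    | zero => simp
    | add x y hx hy => simp only [TensorProduct.add_tmul, map_add, hx, hy]
    | tmul y d =>
      simp [TensorProduct.smul_tmul', TensorProduct.tmul_smul, smul_smul]

end Coaction


/-! ## The reassociator acting on comodules -/

section Reassociator

open CoquasiBialgebra

variable (k H : Type*) [Field k] [AddCommGroup H] [Module k H] [CoquasiBialgebra k H]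

/-- `h ⊗ g ⊗ f ⊗ l ↦ h ⊗ g ⊗ fl`. -/
def pentA : H ⊗[k] (H ⊗[k] (H ⊗[k] H)) →ₗc[k] H ⊗[k] (H ⊗[k] H) :=
  Coalgebra.TensorProduct.map (CoalgHom.id k H)
    (Coalgebra.TensorProduct.map (CoalgHom.id k H) mul)

/-- `h ⊗ g ⊗ f ⊗ l ↦ hg ⊗ f ⊗ l`. -/
def pentB : H ⊗[k] (H ⊗[k] (H ⊗[k] H)) →ₗc[k] H ⊗[k] (H ⊗[k] H) :=
  (Coalgebra.TensorProduct.map mul (CoalgHom.id k (H ⊗[k] H))).comp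
    (Coalgebra.TensorProduct.assoc k k H H (H ⊗[k] H)).symm.toCoalgHom

/-- `h ⊗ g ⊗ f ⊗ l ↦ ε(h) g ⊗ f ⊗ l`. -/
def pentC : H ⊗[k] (H ⊗[k] (H ⊗[k] H)) →ₗc[k] H ⊗[k] (H ⊗[k] H) :=
  (Coalgebra.TensorProduct.lid k (H ⊗[k] (H ⊗[k] H))).toCoalgHom.comp
    (Coalgebra.TensorProduct.map (Coalgebra.counitCoalgHom k H) (CoalgHom.id k _))

/-- `h ⊗ g ⊗ f ⊗ l ↦ h ⊗ gf ⊗ l`. -/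
def pentD : H ⊗[k] (H ⊗[k] (H ⊗[k] H)) →ₗc[k] H ⊗[k] (H ⊗[k] H) :=
  Coalgebra.TensorProduct.map (CoalgHom.id k H)
    ((Coalgebra.TensorProduct.map mul (CoalgHom.id k H)).comp
      (Coalgebra.TensorProduct.assoc k k H H H).symm.toCoalgHom)

/-- `h ⊗ g ⊗ f ⊗ l ↦ ε(l) h ⊗ g ⊗ f`. -/
def pentE : H ⊗[k] (H ⊗[k] (H ⊗[k] H)) →ₗc[k] H ⊗[k] (H ⊗[k] H) :=
  Coalgebra.TensorProduct.map (CoalgHom.id k H)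
    (Coalgebra.TensorProduct.map (CoalgHom.id k H)
      ((Coalgebra.TensorProduct.rid k k H).toCoalgHom.comp
        (Coalgebra.TensorProduct.map (CoalgHom.id k H) (Coalgebra.counitCoalgHom k H))))

/-- The axiom `cocycle`, with the five arguments of `ω` recognised as coalgebra maps, so that each
factor has a convolution inverse given by `ωInv`. -/
theorem pentagon :
    convL (ω ∘ₗ (pentA k H).toLinearMap) (ω ∘ₗ (pentB k H).toLinearMap) =
      convL (ω ∘ₗ (pentC k H).toLinearMap) (convL (ω ∘ₗ (pentD k H).toLinearMap)
        (ω ∘ₗ (pentE k H).toLinearMap)) := cocycle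

variable {k H}

theorem convL_ω_ωInv_comp {D : Type*} [AddCommGroup D] [Module k D] [Coalgebra k D]
    (F : D →ₗc[k] H ⊗[k] (H ⊗[k] H)) :
    convL (ω ∘ₗ F.toLinearMap) (ωInv ∘ₗ F.toLinearMap) = Coalgebra.counit := by
  rw [← convL_comp _ _ _ F.map_comp_comul.symm, ω_ωInv]
  exact F.counit_comp

theorem convL_ωInv_ω_comp {D : Type*} [AddCommGroup D] [Module k D] [Coalgebra k D]
    (F : D →ₗc[k] H ⊗[k] (H ⊗[k] H)) :
    convL (ωInv ∘ₗ F.toLinearMap) (ω ∘ₗ F.toLinearMap) = Coalgebra.counit := by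
  rw [← convL_comp _ _ _ F.map_comp_comul.symm, ωInv_ω]
  exact F.counit_comp

variable (k H) in
-- Writing the pentagon as `AB = CDE` in the convolution algebra, this is `D⁻¹C⁻¹A = EB⁻¹`. In this
-- form only the edges `A` and `E` carry `ω`, as needed for `canPre_free`.
theorem pentagon_inv :
    convL (ωInv ∘ₗ (pentD k H).toLinearMap) (convL (ωInv ∘ₗ (pentC k H).toLinearMap)
        (ω ∘ₗ (pentA k H).toLinearMap)) =
      convL (ω ∘ₗ (pentE k H).toLinearMap) (ωInv ∘ₗ (pentB k H).toLinearMap) := by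
  have h : ω ∘ₗ (pentA k H).toLinearMap = convL (convL (ω ∘ₗ (pentA k H).toLinearMap)
      (ω ∘ₗ (pentB k H).toLinearMap)) (ωInv ∘ₗ (pentB k H).toLinearMap) := by
    rw [convL_assoc, convL_ω_ωInv_comp, convL_counit]
  rw [h, pentagon, ← convL_assoc, ← convL_assoc, ← convL_assoc, convL_assoc _ _
    (ω ∘ₗ (pentC k H).toLinearMap), convL_ωInv_ω_comp, convL_counit, ← convL_assoc,
    convL_ωInv_ω_comp, counit_convL]

section Operators

variable {U V W X : Type*} [AddCommGroup U] [Module k U] [AddCommGroup V] [Module k V]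
  [AddCommGroup W] [Module k W] [AddCommGroup X] [Module k X]
  {ρ : U →ₗ[k] U ⊗[k] H} {σ : V →ₗ[k] V ⊗[k] H} {τ : W →ₗ[k] W ⊗[k] H} {υ : X →ₗ[k] X ⊗[k] H}

/-- The coaction of a tensor product of comodules. -/
def mulCoact (ρ : U →ₗ[k] U ⊗[k] H) (σ : V →ₗ[k] V ⊗[k] H) :
    U ⊗[k] V →ₗ[k] (U ⊗[k] V) ⊗[k] H :=
  push (mul (k := k) (H := H)).toLinearMap (prodCoact ρ σ)

theorem IsCoaction.mulCoact (hρ : IsCoaction ρ) (hσ : IsCoaction σ) :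
    IsCoaction (mulCoact ρ σ) := (hρ.prod hσ).push mul

theorem Colinear.mulCoact {U' V' : Type*} [AddCommGroup U'] [Module k U'] [AddCommGroup V']
    [Module k V'] {ρ' : U' →ₗ[k] U' ⊗[k] H} {σ' : V' →ₗ[k] V' ⊗[k] H} {F : U →ₗ[k] U'}
    {G : V →ₗ[k] V'} (hF : Colinear ρ ρ' F) (hG : Colinear σ σ' G) :
    Colinear (mulCoact ρ σ) (mulCoact ρ' σ') (TensorProduct.map F G) := (hF.prod hG).push _

theorem act₃_ω_ωInv (hρ : IsCoaction ρ) (hσ : IsCoaction σ) (hτ : IsCoaction τ)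
    (x : U ⊗[k] (V ⊗[k] W)) : act₃ ω ρ σ τ (act₃ ωInv ρ σ τ x) = x :=
  (hρ.prod (hσ.prod hτ)).applyCoact_cancel ω_ωInv x

theorem act₃_ωInv_ω (hρ : IsCoaction ρ) (hσ : IsCoaction σ) (hτ : IsCoaction τ)
    (x : U ⊗[k] (V ⊗[k] W)) : act₃ ωInv ρ σ τ (act₃ ω ρ σ τ x) = x :=
  (hρ.prod (hσ.prod hτ)).applyCoact_cancel ωInv_ω x

variable (ρ σ τ υ)

/-- Each of this and the next four lemmas identifies one edge of the pentagon: a functional pulled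
back to `H⊗H⊗H⊗H` acts on four comodules as an associator-type operator on three, where two of them
have been multiplied or one is a spectator. -/
theorem applyCoact_pentA (φ : H ⊗[k] (H ⊗[k] H) →ₗ[k] k) :
    applyCoact (φ ∘ₗ (pentA k H).toLinearMap) (prodCoact ρ (prodCoact σ (prodCoact τ υ))) =
      act₃ φ ρ σ (mulCoact τ υ) := by
  rw [act₃, mulCoact, prodCoact_push, prodCoact_push, applyCoact_push]
  rfl

theorem applyCoact_pentB (φ : H ⊗[k] (H ⊗[k] H) →ₗ[k] k) (z : (U ⊗[k] V) ⊗[k] (W ⊗[k] X)) :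
    applyCoact (φ ∘ₗ (pentB k H).toLinearMap) (prodCoact ρ (prodCoact σ (prodCoact τ υ)))
      (TensorProduct.assoc k U V (W ⊗[k] X) z) =
      TensorProduct.assoc k U V (W ⊗[k] X) (act₃ φ (mulCoact ρ σ) τ υ z) := by
  refine ((colinear_assoc ρ σ (prodCoact τ υ)).applyCoact _ z).trans ?_
  rw [applyCoact_push, act₃, mulCoact, push_prodCoact, applyCoact_push]
  have : (φ ∘ₗ (pentB k H).toLinearMap) ∘ₗ (TensorProduct.assoc k H H (H ⊗[k] H)).toLinearMap =
      φ ∘ₗ TensorProduct.map mul.toLinearMap LinearMap.id := by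
    rw [LinearMap.comp_assoc]
    congr 1
    refine LinearMap.ext fun x => ?_
    change TensorProduct.map mul.toLinearMap LinearMap.id
      ((TensorProduct.assoc k H H (H ⊗[k] H)).symm (TensorProduct.assoc k H H (H ⊗[k] H) x)) = _
    rw [LinearEquiv.symm_apply_apply]
  rw [this]
  rfl

theorem applyCoact_pentC (hρ : IsCoaction ρ) (φ : H ⊗[k] (H ⊗[k] H) →ₗ[k] k) :
    applyCoact (φ ∘ₗ (pentC k H).toLinearMap) (prodCoact ρ (prodCoact σ (prodCoact τ υ))) =
      TensorProduct.map LinearMap.id (act₃ φ σ τ υ) :=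
  TensorProduct.ext' fun u z => applyCoact_lid hρ _ φ u z

theorem applyCoact_pentD (φ : H ⊗[k] (H ⊗[k] H) →ₗ[k] k) (z : U ⊗[k] ((V ⊗[k] W) ⊗[k] X)) :
    applyCoact (φ ∘ₗ (pentD k H).toLinearMap) (prodCoact ρ (prodCoact σ (prodCoact τ υ)))
      (TensorProduct.map LinearMap.id (TensorProduct.assoc k V W X).toLinearMap z) =
      TensorProduct.map LinearMap.id (TensorProduct.assoc k V W X).toLinearMap
        (act₃ φ ρ (mulCoact σ τ) υ z) := by
  refine (((Colinear.id ρ).prod (colinear_assoc σ τ υ)).applyCoact _ z).trans ?_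
  rw [prodCoact_push, applyCoact_push, act₃, mulCoact, push_prodCoact, prodCoact_push,
    applyCoact_push]
  congr 3
  rw [LinearMap.comp_assoc]
  congr 1
  refine TensorProduct.ext' fun x y => ?_
  change x ⊗ₜ[k] TensorProduct.map mul.toLinearMap LinearMap.id
      ((TensorProduct.assoc k H H H).symm (TensorProduct.assoc k H H H y)) = _
  rw [LinearEquiv.symm_apply_apply]
  rfl

theorem applyCoact_pentE (hυ : IsCoaction υ) (φ : H ⊗[k] (H ⊗[k] H) →ₗ[k] k)
    (z : (U ⊗[k] (V ⊗[k] W)) ⊗[k] X) :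
    applyCoact (φ ∘ₗ (pentE k H).toLinearMap) (prodCoact ρ (prodCoact σ (prodCoact τ υ)))
      (TensorProduct.map LinearMap.id (TensorProduct.assoc k V W X).toLinearMap
        (TensorProduct.assoc k U (V ⊗[k] W) X z)) =
      TensorProduct.map LinearMap.id (TensorProduct.assoc k V W X).toLinearMap
        (TensorProduct.assoc k U (V ⊗[k] W) X
          (TensorProduct.map (act₃ φ ρ σ τ) LinearMap.id z)) := by
  refine (((Colinear.id ρ).prod (colinear_assoc σ τ υ)).applyCoact _ _).trans ?_
  rw [prodCoact_push, applyCoact_push]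
  congr 1
  refine ((colinear_assoc ρ (prodCoact σ τ) υ).applyCoact _ _).trans ?_
  rw [applyCoact_push]
  refine congrArg (TensorProduct.assoc k U (V ⊗[k] W) X) ?_
  have e : ((φ ∘ₗ (pentE k H).toLinearMap) ∘ₗ TensorProduct.map LinearMap.id
      (TensorProduct.assoc k H H H).toLinearMap) ∘ₗ
        (TensorProduct.assoc k H (H ⊗[k] H) H).toLinearMap =
      φ ∘ₗ (TensorProduct.rid k _).toLinearMap ∘ₗ
        TensorProduct.map LinearMap.id Coalgebra.counit := by
    rw [LinearMap.comp_assoc, LinearMap.comp_assoc]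
    congr 1
    refine TensorProduct.ext' fun x y => ?_
    induction x with
    | zero => simp
    | add x y hx hy => simp only [TensorProduct.add_tmul, map_add, hx, hy]
    | tmul a x =>
      induction x with
      | zero => simp
      | add x y hx hy => simp only [TensorProduct.add_tmul, TensorProduct.tmul_add, map_add, hx, hy]
      | tmul b c =>
        change a ⊗ₜ[k] (b ⊗ₜ[k] (Coalgebra.counit (R := k) y • c)) =
          Coalgebra.counit (R := k) y • (a ⊗ₜ[k] (b ⊗ₜ[k] c))
        rw [TensorProduct.tmul_smul, TensorProduct.tmul_smul]
  rw [e]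
  exact LinearMap.congr_fun (TensorProduct.ext' fun y x => applyCoact_rid _ hυ φ x y :
    applyCoact _ (prodCoact (prodCoact ρ (prodCoact σ τ)) υ) = _) z

variable {ρ σ τ υ}

/-- The reassociator is colinear. -/
theorem colinear_act₃_ω (hρ : IsCoaction ρ) (hσ : IsCoaction σ) (hτ : IsCoaction τ) :
    Colinear (mulCoact (mulCoact ρ σ) τ) (mulCoact ρ (mulCoact σ τ))
      (act₃ ω ρ σ τ ∘ₗ (TensorProduct.assoc k U V W).toLinearMap) := by
  refine Colinear.comp (σ := push (mul.toLinearMap ∘ₗ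
    TensorProduct.map mul.toLinearMap LinearMap.id ∘ₗ
      (TensorProduct.assoc k H H H).symm.toLinearMap) (prodCoact ρ (prodCoact σ τ))) ?_ ?_
  · refine LinearMap.ext fun x => ?_
    -- The two sides of `quasi_assoc` are the coaction taken after the operator `ω` and the operator
    -- applied to the other bracketing of the coaction.
    have h := (hρ.prod (hσ.prod hτ)).push_applyCoact (mul.toLinearMap ∘ₗ
      TensorProduct.map LinearMap.id mul.toLinearMap) ω x
    rw [quasi_assoc, ← (hρ.prod (hσ.prod hτ)).map_applyCoact_push] at h
    refine Eq.trans ?_ h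
    rw [mulCoact, mulCoact, prodCoact_push, push_push]
    rfl
  · have h := (colinear_assoc ρ σ τ).push (mul.toLinearMap ∘ₗ
      TensorProduct.map mul.toLinearMap LinearMap.id ∘ₗ
      (TensorProduct.assoc k H H H).symm.toLinearMap)
    rw [push_push] at h
    convert h using 1
    rw [mulCoact, mulCoact, push_prodCoact, push_push]
    congr 1
    rw [LinearMap.comp_assoc, LinearMap.comp_assoc, LinearEquiv.symm_comp, LinearMap.comp_id]

theorem colinear_act₃_ωInv (hρ : IsCoaction ρ) (hσ : IsCoaction σ) (hτ : IsCoaction τ) :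
    Colinear (mulCoact ρ (mulCoact σ τ)) (mulCoact (mulCoact ρ σ) τ)
      ((TensorProduct.assoc k U V W).symm.toLinearMap ∘ₗ act₃ ωInv ρ σ τ) := by
  refine (colinear_act₃_ω hρ hσ hτ).of_inverse ?_ ?_
  · refine LinearMap.ext fun x => ?_
    change (TensorProduct.assoc k U V W).symm (act₃ ωInv ρ σ τ (act₃ ω ρ σ τ
      (TensorProduct.assoc k U V W x))) = x
    rw [act₃_ωInv_ω hρ hσ hτ, LinearEquiv.symm_apply_apply]
  · refine LinearMap.ext fun x => ?_
    change act₃ ω ρ σ τ (TensorProduct.assoc k U V W ((TensorProduct.assoc k U V W).symm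
      (act₃ ωInv ρ σ τ x))) = x
    rw [LinearEquiv.apply_symm_apply, act₃_ω_ωInv hρ hσ hτ]

/-- Coinvariants behave like the unit object: `ω` is trivial as soon as one argument is `1`, so a
coinvariant in any slot makes the associator trivial. The next two lemmas treat the other slots. -/
theorem act₃_ω_left {u : U} (hu : ρ u = u ⊗ₜ[k] (one k : H)) (hσ : IsCoaction σ)
    (hτ : IsCoaction τ) (z : V ⊗[k] W) : act₃ ω ρ σ τ (u ⊗ₜ[k] z) = u ⊗ₜ[k] z := by
  conv_rhs => rw [← (hσ.prod hτ).counit z]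
  change TensorProduct.rid k _ (TensorProduct.map LinearMap.id ω
    (TensorProduct.tensorTensorTensorComm k U H _ _ (ρ u ⊗ₜ[k] prodCoact σ τ z))) = _
  rw [hu]
  induction prodCoact σ τ z with
  | zero => simp
  | add x y hx hy => simp only [TensorProduct.tmul_add, map_add, hx, hy]
  | tmul x q =>
    induction q with
    | zero => simp
    | add x y hx hy => simp only [TensorProduct.tmul_add, map_add, hx, hy]
    | tmul g f => simp [ω_one_left, mul_comm]

theorem act₃_ω_mid (hρ : IsCoaction ρ) {v : V} (hv : σ v = v ⊗ₜ[k] (one k : H))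
    (hτ : IsCoaction τ) (u : U) (w : W) :
    act₃ ω ρ σ τ (u ⊗ₜ[k] (v ⊗ₜ[k] w)) = u ⊗ₜ[k] (v ⊗ₜ[k] w) := by
  conv_rhs => rw [← hρ.counit u, ← hτ.counit w]
  change TensorProduct.rid k _ (TensorProduct.map LinearMap.id ω
    (TensorProduct.tensorTensorTensorComm k U H _ _ (ρ u ⊗ₜ[k]
      TensorProduct.tensorTensorTensorComm k V H W H (σ v ⊗ₜ[k] τ w)))) = _
  rw [hv]
  induction ρ u with
  | zero => simp
  | add x y hx hy => simp only [TensorProduct.add_tmul, map_add, hx, hy]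
  | tmul x h =>
    induction τ w with
    | zero => simp
    | add x y hx hy => simp only [TensorProduct.tmul_add, map_add, hx, hy]
    | tmul y g =>
      simp [ω_one_mid, ← TensorProduct.smul_tmul', TensorProduct.tmul_smul, smul_smul, mul_comm]

theorem act₃_ω_right (hρ : IsCoaction ρ) (hσ : IsCoaction σ) {w : W}
    (hw : τ w = w ⊗ₜ[k] (one k : H)) (u : U) (v : V) :
    act₃ ω ρ σ τ (u ⊗ₜ[k] (v ⊗ₜ[k] w)) = u ⊗ₜ[k] (v ⊗ₜ[k] w) := by
  conv_rhs => rw [← hρ.counit u, ← hσ.counit v]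
  change TensorProduct.rid k _ (TensorProduct.map LinearMap.id ω
    (TensorProduct.tensorTensorTensorComm k U H _ _ (ρ u ⊗ₜ[k]
      TensorProduct.tensorTensorTensorComm k V H W H (σ v ⊗ₜ[k] τ w)))) = _
  rw [hw]
  induction ρ u with
  | zero => simp
  | add x y hx hy => simp only [TensorProduct.add_tmul, map_add, hx, hy]
  | tmul x h =>
    induction σ v with
    | zero => simp
    | add x y hx hy => simp only [TensorProduct.tmul_add, TensorProduct.add_tmul, map_add, hx, hy]
    | tmul y g =>
      simp [ω_one_right, ← TensorProduct.smul_tmul', TensorProduct.tmul_smul, smul_smul, mul_comm]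

theorem act₃_ωInv_of_fixed (hρ : IsCoaction ρ) (hσ : IsCoaction σ) (hτ : IsCoaction τ)
    {x : U ⊗[k] (V ⊗[k] W)} (hx : act₃ ω ρ σ τ x = x) : act₃ ωInv ρ σ τ x = x := by
  conv_lhs => rw [← hx, act₃_ωInv_ω hρ hσ hτ]

/-- `x ↦ x ⊗ 1`. -/
def trivCoact (H U : Type*) [AddCommGroup H] [Module k H] [CoquasiBialgebra k H]
    [AddCommGroup U] [Module k U] : U →ₗ[k] U ⊗[k] H :=
  (TensorProduct.mk k U H).flip (one k)

theorem mulCoact_trivCoact (u : U) (v : V) : mulCoact ρ (trivCoact H V) (u ⊗ₜ[k] v) =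
    TensorProduct.map ((TensorProduct.mk k U V).flip v) LinearMap.id (ρ u) := by
  change TensorProduct.map LinearMap.id mul.toLinearMap
    (TensorProduct.tensorTensorTensorComm k U H V H (ρ u ⊗ₜ[k] (v ⊗ₜ[k] one k))) = _
  induction ρ u with
  | zero => simp
  | add x y hx hy => simp only [TensorProduct.add_tmul, map_add, hx, hy]
  | tmul x h => simp [CoquasiBialgebra.mul_one]

end Operators

end Reassociator


/-! ## Free relative Hopf modules -/

section Free

open CoquasiBialgebra RightComodule

variable (k H A V : Type*) [Field k] [AddCommGroup H] [Module k H] [CoquasiBialgebra k H]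
  [AddCommGroup A] [Module k A] [ComoduleAlgebra k H A]
  [AddCommGroup V] [Module k V] [RightComodule k H V]

/-- The tensor product of two comodules. -/
instance tensorComodule (W : Type*) [AddCommGroup W] [Module k W] [RightComodule k H W] :
    RightComodule k H (V ⊗[k] W) where
  coact := mulCoact coact coact
  coact_coassoc := (isCoaction_coact.mulCoact isCoaction_coact).coassoc
  coact_counit := (isCoaction_coact.mulCoact isCoaction_coact).counit

/-- `(v ⊗ a) ⊗ b ↦ v₀ ⊗ a₀b₀ ω(v₁,a₁,b₁)`. -/
def freeAct : (V ⊗[k] A) ⊗[k] A →ₗ[k] V ⊗[k] A :=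
  TensorProduct.map LinearMap.id (ComoduleAlgebra.mul H) ∘ₗ
    act₃ (ω (k := k) (H := H)) coact coact coact ∘ₗ
    (TensorProduct.assoc k V A A).toLinearMap

variable {k H A V}

theorem colinear_mul : Colinear (mulCoact (coact : A →ₗ[k] A ⊗[k] H) coact) coact
    (ComoduleAlgebra.mul (k := k) (A := A) H) := by
  refine TensorProduct.ext' fun a b => ?_
  refine (ComoduleAlgebra.coact_mul a b).trans ?_
  rw [LinearMap.comp_apply, mulCoact, push_apply, TensorProduct.map_map, LinearMap.comp_id,
    LinearMap.id_comp]

theorem colinear_act {M : Type*} [AddCommGroup M] [Module k M] [RelHopfModule k H A M] :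
    Colinear (mulCoact (coact : M →ₗ[k] M ⊗[k] H) (coact : A →ₗ[k] A ⊗[k] H)) coact
      (RelHopfModule.act (k := k) (A := A) (M := M) H) := by
  refine TensorProduct.ext' fun a b => ?_
  refine (RelHopfModule.coact_act a b).trans ?_
  rw [LinearMap.comp_apply, mulCoact, push_apply, TensorProduct.map_map, LinearMap.comp_id,
    LinearMap.id_comp]

theorem colinear_freeAct : Colinear (mulCoact (mulCoact coact coact) coact)
    (mulCoact (coact : V →ₗ[k] V ⊗[k] H) (coact : A →ₗ[k] A ⊗[k] H)) (freeAct k H A V) :=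
  ((Colinear.id _).mulCoact colinear_mul).comp
    (colinear_act₃_ω isCoaction_coact isCoaction_coact isCoaction_coact)

theorem mul_comp_map_mul : ComoduleAlgebra.mul (k := k) (A := A) H ∘ₗ
      TensorProduct.map (ComoduleAlgebra.mul H) LinearMap.id =
    ComoduleAlgebra.mul H ∘ₗ TensorProduct.map LinearMap.id (ComoduleAlgebra.mul H) ∘ₗ
      act₃ (ω (k := k) (H := H)) coact coact coact ∘ₗ
        (TensorProduct.assoc k A A A).toLinearMap :=
  TensorProduct.ext_threefold fun a b c => ComoduleAlgebra.mul_quasi_assoc a b c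

/-- The quasi-associativity of the free module is the pentagon for `V, A, A, A` combined with the
quasi-associativity of `A`. -/
instance freeHopfModule : RelHopfModule k H A (V ⊗[k] A) where
  act := freeAct k H A V
  coact_act y b := by
    refine (LinearMap.congr_fun colinear_freeAct (y ⊗ₜ[k] b)).trans ?_
    rw [LinearMap.comp_apply, mulCoact, push_apply, TensorProduct.map_map, LinearMap.comp_id,
      LinearMap.id_comp]
    rfl
  act_one y := by
    induction y with
    | zero => simp
    | add x y hx hy => simp only [map_add, TensorProduct.add_tmul, hx, hy]
    | tmul v a =>
      change TensorProduct.map LinearMap.id (ComoduleAlgebra.mul H)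
        (act₃ ω coact coact coact (v ⊗ₜ[k] (a ⊗ₜ[k] ComoduleAlgebra.one k H))) = _
      rw [act₃_ω_right isCoaction_coact isCoaction_coact ComoduleAlgebra.coact_one,
        TensorProduct.map_tmul, ComoduleAlgebra.mul_one, LinearMap.id_apply]
  act_quasi_assoc y b c := by
    induction y with
    | zero => simp
    | add x y hx hy => simp only [map_add, TensorProduct.add_tmul, hx, hy]
    | tmul v a =>
      have hE := applyCoact_pentE (coact : V →ₗ[k] V ⊗[k] H) (coact : A →ₗ[k] A ⊗[k] H)
        (coact : A →ₗ[k] A ⊗[k] H) (coact : A →ₗ[k] A ⊗[k] H) isCoaction_coact ω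
        ((v ⊗ₜ[k] (a ⊗ₜ[k] b)) ⊗ₜ[k] c)
      have hP := congrArg (fun f => applyCoact f (prodCoact (coact : V →ₗ[k] V ⊗[k] H)
        (prodCoact (coact : A →ₗ[k] A ⊗[k] H) (prodCoact (coact : A →ₗ[k] A ⊗[k] H)
        (coact : A →ₗ[k] A ⊗[k] H)))) (v ⊗ₜ[k] (a ⊗ₜ[k] (b ⊗ₜ[k] c)))) (pentagon k H)
      have h4 : IsCoaction (prodCoact (coact : V →ₗ[k] V ⊗[k] H)
        (prodCoact (coact : A →ₗ[k] A ⊗[k] H) (prodCoact (coact : A →ₗ[k] A ⊗[k] H)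
        (coact : A →ₗ[k] A ⊗[k] H)))) :=
        isCoaction_coact.prod (isCoaction_coact.prod (isCoaction_coact.prod isCoaction_coact))
      have hB := applyCoact_pentB (coact : V →ₗ[k] V ⊗[k] H) (coact : A →ₗ[k] A ⊗[k] H)
        (coact : A →ₗ[k] A ⊗[k] H) (coact : A →ₗ[k] A ⊗[k] H) ω
        ((v ⊗ₜ[k] a) ⊗ₜ[k] (b ⊗ₜ[k] c))
      set s := act₃ ω (coact : V →ₗ[k] V ⊗[k] H) (coact : A →ₗ[k] A ⊗[k] H)
        (coact : A →ₗ[k] A ⊗[k] H) (v ⊗ₜ[k] (a ⊗ₜ[k] b)) with hs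
      set t := act₃ ω (mulCoact (coact : V →ₗ[k] V ⊗[k] H) (coact : A →ₗ[k] A ⊗[k] H)) coact
        (coact : A →ₗ[k] A ⊗[k] H) ((v ⊗ₜ[k] a) ⊗ₜ[k] (b ⊗ₜ[k] c)) with ht
      simp only [h4.applyCoact_convL] at hP
      simp only [TensorProduct.map_tmul, TensorProduct.assoc_tmul, LinearMap.id_apply,
        LinearEquiv.coe_coe, ← hs] at hE hB
      rw [hE, applyCoact_pentD, applyCoact_pentC _ _ _ _ isCoaction_coact, hB,
        applyCoact_pentA] at hP
      change TensorProduct.map LinearMap.id (ComoduleAlgebra.mul H)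
        (act₃ ω coact coact coact (TensorProduct.assoc k V A A
          (TensorProduct.map LinearMap.id (ComoduleAlgebra.mul H) s ⊗ₜ[k] c))) =
        TensorProduct.map LinearMap.id (ComoduleAlgebra.mul H)
        (act₃ ω coact coact coact (TensorProduct.assoc k V A A
          (TensorProduct.map LinearMap.id (ComoduleAlgebra.mul H) t)))
      have e1 : TensorProduct.assoc k V A A
          (TensorProduct.map LinearMap.id (ComoduleAlgebra.mul H) s ⊗ₜ[k] c) =
          TensorProduct.map LinearMap.id
            (TensorProduct.map (ComoduleAlgebra.mul H) LinearMap.id)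
              (TensorProduct.assoc k V (A ⊗[k] A) A (s ⊗ₜ[k] c)) := by
        induction s with
        | zero => simp
        | add x y hx hy => simp only [map_add, TensorProduct.add_tmul, hx, hy]
        | tmul x y => simp
      have e2 : TensorProduct.assoc k V A A
          (TensorProduct.map LinearMap.id (ComoduleAlgebra.mul H) t) =
          TensorProduct.map LinearMap.id
            (TensorProduct.map LinearMap.id (ComoduleAlgebra.mul H))
              (TensorProduct.assoc k V A (A ⊗[k] A) t) := by
        induction t with
        | zero => simp
        | add x y hx hy => simp only [map_add, hx, hy]
        | tmul x y =>
          induction x with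
          | zero => simp
          | add x y hx hy => simp only [map_add, TensorProduct.add_tmul, hx, hy]
          | tmul x z => simp
      -- Naturality moves both multiplications out of the associators. The pentagon then leaves only
      -- the associator on `A ⊗ A ⊗ A`, which `mul_comp_map_mul` absorbs.
      rw [e1, e2, act₃_naturality ω (Colinear.id _) colinear_mul (Colinear.id _),
        act₃_naturality ω (Colinear.id _) (Colinear.id _) colinear_mul, hP]
      simp only [TensorProduct.map_map, LinearMap.id_comp]
      rw [mul_comp_map_mul]

end Free


/-! ## The regular coaction and convolution -/

section Regular

variable {k C D V X Y : Type*} [Field k]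
  [AddCommGroup C] [Module k C] [Coalgebra k C] [AddCommGroup D] [Module k D]
  [AddCommGroup V] [Module k V] [AddCommGroup X] [Module k X] [AddCommGroup Y] [Module k Y]

theorem isCoaction_comul : IsCoaction (Coalgebra.comul : C →ₗ[k] C ⊗[k] C) where
  coassoc := Coalgebra.coassoc_apply
  counit c := by
    refine (congrArg (TensorProduct.rid k C) (Coalgebra.lTensor_counit_comul c)).trans ?_
    simp

/-- `c₁ ⊗ φ(c₂) c₃ = c₁ φ(c₂) ⊗ c₃`. -/
theorem map_convL_comul (φ : C →ₗ[k] k) (f : C →ₗ[k] X) (g : C →ₗ[k] Y) (c : C) :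
    TensorProduct.map f (convL φ g) (Coalgebra.comul c) =
      TensorProduct.map (convR f φ) g (Coalgebra.comul c) := by
  have h := isCoaction_comul.map_applyCoact_push g φ c
  have h' := congrArg (TensorProduct.map f LinearMap.id) h
  rw [push_apply, push_apply, TensorProduct.map_map, TensorProduct.map_map] at h'
  refine Eq.trans ?_ (h'.symm.trans ?_)
  · rw [TensorProduct.map_map, LinearMap.comp_id, LinearMap.id_comp]
  · congr 2
    refine LinearMap.ext fun x => ?_
    change f (TensorProduct.rid k C (TensorProduct.map LinearMap.id φ (Coalgebra.comul x))) =
      TensorProduct.rid k X (TensorProduct.map f φ (Coalgebra.comul x))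
    induction (Coalgebra.comul x : C ⊗[k] C) with
    | zero => simp
    | add x y hx hy => simp only [map_add, hx, hy]
    | tmul x y => simp

/-- `Δ(φ(c₁) c₂) = φ(c₁) c₂ ⊗ c₃`. -/
theorem comul_convL (φ : C →ₗ[k] k) (c : C) :
    Coalgebra.comul (convL φ LinearMap.id c) =
      TensorProduct.map (convL φ LinearMap.id) LinearMap.id (Coalgebra.comul (R := k) c) := by
  have h := congrArg (TensorProduct.lid k (C ⊗[k] C)) (congrArg (TensorProduct.map φ LinearMap.id)
    (Coalgebra.coassoc_apply (R := k) c))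
  refine Eq.trans ?_ (h.symm.trans ?_)
  · change Coalgebra.comul (TensorProduct.lid k C (TensorProduct.map φ LinearMap.id
      (Coalgebra.comul c))) = TensorProduct.lid k (C ⊗[k] C) (TensorProduct.map φ LinearMap.id
        (TensorProduct.map LinearMap.id Coalgebra.comul (Coalgebra.comul c)))
    induction (Coalgebra.comul c : C ⊗[k] C) with
    | zero => simp
    | add x y hx hy => simp only [map_add, hx, hy]
    | tmul x y => simp
  · change TensorProduct.lid k (C ⊗[k] C) (TensorProduct.map φ LinearMap.id
      (TensorProduct.assoc k C C C (TensorProduct.map Coalgebra.comul LinearMap.id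
        (Coalgebra.comul c)))) = _
    induction (Coalgebra.comul c : C ⊗[k] C) with
    | zero => simp
    | add x y hx hy => simp only [map_add, hx, hy]
    | tmul x y =>
      simp only [convL, LinearMap.comp_apply, TensorProduct.map_tmul, LinearMap.id_apply]
      induction (Coalgebra.comul x : C ⊗[k] C) with
      | zero => simp
      | add x y hx hy => simp only [map_add, TensorProduct.add_tmul, hx, hy]
      | tmul x z => simp [TensorProduct.smul_tmul']

/-- `Δ(c₁ φ(c₂)) = c₁ ⊗ c₂ φ(c₃)`. -/
theorem comul_convR (φ : C →ₗ[k] k) (c : C) :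
    Coalgebra.comul (convR LinearMap.id φ c) =
      TensorProduct.map LinearMap.id (convR LinearMap.id φ) (Coalgebra.comul (R := k) c) := by
  have h := isCoaction_comul.push_applyCoact LinearMap.id φ c
  rw [push_id] at h
  exact h

/-- The coaction of `V ⊗ X` on `v₀ ⊗ f(v₁)`. -/
theorem IsCoaction.prodCoact_push_apply {ρ : V →ₗ[k] V ⊗[k] C} (h : IsCoaction ρ)
    (τ : X →ₗ[k] X ⊗[k] D) (f : C →ₗ[k] X) (v : V) :
    prodCoact ρ τ (CoquasiHopf.push f ρ v) = (TensorProduct.assoc k V X (C ⊗[k] D)).symm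
      (CoquasiHopf.push ((TensorProduct.leftComm k C X D).toLinearMap ∘ₗ
        TensorProduct.map LinearMap.id (τ ∘ₗ f) ∘ₗ Coalgebra.comul) ρ v) := by
  rw [← push_push, push_apply _ (CoquasiHopf.push _ _), ← h.push_comul, push_id, push_apply]
  induction ρ v with
  | zero => simp
  | add x y hx hy => simp only [map_add, hx, hy]
  | tmul x c =>
    change TensorProduct.tensorTensorTensorComm k V C X D (ρ x ⊗ₜ[k] τ (f c)) =
      (TensorProduct.assoc k V X (C ⊗[k] D)).symm (TensorProduct.map LinearMap.id
        (TensorProduct.leftComm k C X D).toLinearMap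
          (TensorProduct.assoc k V C (X ⊗[k] D) (ρ x ⊗ₜ[k] τ (f c))))
    induction ρ x with
    | zero => simp
    | add x y hx hy => simp only [map_add, TensorProduct.add_tmul, hx, hy]
    | tmul x y =>
      induction τ (f c) with
      | zero => simp
      | add x y hx hy => simp only [map_add, TensorProduct.tmul_add, hx, hy]
      | tmul z w => simp

end Regular

/-! ## The antipode coaction -/

section Antipode

open CoquasiBialgebra CoquasiHopfAlgebra RightComodule

variable (k H : Type*) [Field k] [AddCommGroup H] [Module k H] [CoquasiHopfAlgebra k H]

/-- `h ↦ h₂ ⊗ S(h₁)`. -/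
def antipodeCoact : H →ₗ[k] H ⊗[k] H :=
  TensorProduct.map LinearMap.id S ∘ₗ (TensorProduct.comm k H H).toLinearMap ∘ₗ Coalgebra.comul

/-- `h ⊗ g ⊗ f ↦ f ⊗ (h ⊗ g)`. -/
def rotate : H ⊗[k] (H ⊗[k] H) →ₗ[k] H ⊗[k] (H ⊗[k] H) :=
  (TensorProduct.comm k (H ⊗[k] H) H).toLinearMap ∘ₗ
    (TensorProduct.assoc k H H H).symm.toLinearMap

/-- Flipping `Δ` gives a left comodule read from the right, and the coalgebra antihomomorphism `S`
turns it into a right comodule. -/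
theorem isCoaction_antipodeCoact : IsCoaction (antipodeCoact k H) where
  coassoc h := by
    have e := congrArg (fun x => (TensorProduct.comm k (H ⊗[k] H) H).trans
      (TensorProduct.congr (LinearEquiv.refl k H) (TensorProduct.comm k H H))
        ((TensorProduct.assoc k H H H).symm x)) (Coalgebra.coassoc_apply (R := k) h)
    have e' := congrArg (TensorProduct.map LinearMap.id (TensorProduct.map S S)) e
    refine Eq.trans ?_ (e'.symm.trans ?_)
    · change TensorProduct.assoc k H H H (TensorProduct.map (antipodeCoact k H) LinearMap.id
        (TensorProduct.map LinearMap.id S (TensorProduct.comm k H H (Coalgebra.comul h)))) =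
          TensorProduct.map LinearMap.id (TensorProduct.map S S)
            ((TensorProduct.comm k (H ⊗[k] H) H).trans
      (TensorProduct.congr (LinearEquiv.refl k H) (TensorProduct.comm k H H))
        ((TensorProduct.assoc k H H H).symm (TensorProduct.map LinearMap.id Coalgebra.comul
          (Coalgebra.comul h))))
      induction (Coalgebra.comul h : H ⊗[k] H) with
      | zero => simp
      | add x y hx hy => simp only [map_add, hx, hy]
      | tmul x y =>
        simp only [antipodeCoact, LinearMap.comp_apply, TensorProduct.map_tmul,
          TensorProduct.comm_tmul, LinearMap.id_apply, LinearEquiv.coe_coe]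
        induction (Coalgebra.comul y : H ⊗[k] H) with
        | zero => simp
        | add x y hx hy => simp only [map_add, TensorProduct.tmul_add, TensorProduct.add_tmul,
            hx, hy]
        | tmul z w => simp
    · change TensorProduct.map LinearMap.id (TensorProduct.map S S)
            ((TensorProduct.comm k (H ⊗[k] H) H).trans
      (TensorProduct.congr (LinearEquiv.refl k H) (TensorProduct.comm k H H))
        ((TensorProduct.assoc k H H H).symm (TensorProduct.assoc k H H H
          (TensorProduct.map Coalgebra.comul LinearMap.id (Coalgebra.comul h))))) =
        TensorProduct.map LinearMap.id Coalgebra.comul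
          (TensorProduct.map LinearMap.id S (TensorProduct.comm k H H (Coalgebra.comul h)))
      rw [LinearEquiv.symm_apply_apply]
      induction (Coalgebra.comul h : H ⊗[k] H) with
      | zero => simp
      | add x y hx hy => simp only [map_add, hx, hy]
      | tmul x y =>
        simp only [TensorProduct.map_tmul, TensorProduct.comm_tmul, LinearMap.id_apply, comul_S]
        induction (Coalgebra.comul x : H ⊗[k] H) with
        | zero => simp
        | add x y hx hy => simp only [map_add, TensorProduct.tmul_add, TensorProduct.add_tmul,
            hx, hy]
        | tmul z w => simp
  counit h := by
    have e := congrArg (TensorProduct.lid k H) (Coalgebra.rTensor_counit_comul (R := k) h)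
    rw [TensorProduct.lid_tmul, one_smul] at e
    refine Eq.trans ?_ e
    change TensorProduct.rid k H (TensorProduct.map LinearMap.id Coalgebra.counit
      (TensorProduct.map LinearMap.id S (TensorProduct.comm k H H (Coalgebra.comul h)))) =
      TensorProduct.lid k H (TensorProduct.map Coalgebra.counit LinearMap.id (Coalgebra.comul h))
    induction (Coalgebra.comul h : H ⊗[k] H) with
    | zero => simp
    | add x y hx hy => simp only [map_add, hx, hy]
    | tmul x y => simp [counit_S]

/-- `h ↦ β(h₁) h₂`. -/
abbrev betaL : H →ₗ[k] H := convL β LinearMap.id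

/-- `h ↦ h₁ β(h₂)`. -/
abbrev betaR : H →ₗ[k] H := convR LinearMap.id β

theorem canAux_eq (h : H) : canAux k H h = TensorProduct.assoc k H H H
    (TensorProduct.map (TensorProduct.map (betaR k H) S ∘ₗ Coalgebra.comul) LinearMap.id
      (Coalgebra.comul h)) := by
  have e := congrArg (TensorProduct.map (betaR k H) (TensorProduct.map S LinearMap.id))
    (Coalgebra.coassoc_apply (R := k) h)
  refine e.symm.trans ?_
  change TensorProduct.map (betaR k H) (TensorProduct.map S LinearMap.id)
    (TensorProduct.assoc k H H H (TensorProduct.map Coalgebra.comul LinearMap.id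
      (Coalgebra.comul h))) = _
  rw [TensorProduct.map_map_assoc, TensorProduct.map_map, LinearMap.id_comp]

/-- Both sides are `h₄ ⊗ (h₁β(h₂) ⊗ S(h₃))`. This is where the Sweedler legs in the definition of
`can` are recognised as coming from the coaction of `H^S`. -/
theorem leftComm_antipodeCoact_betaL (h : H) :
    TensorProduct.leftComm k H H H (TensorProduct.map LinearMap.id
      (antipodeCoact k H ∘ₗ betaL k H) (Coalgebra.comul h)) = rotate k H (canAux k H h) := by
  have e : antipodeCoact k H ∘ₗ betaL k H = (TensorProduct.comm k H H).toLinearMap ∘ₗ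
      TensorProduct.map (S ∘ₗ betaL k H) LinearMap.id ∘ₗ Coalgebra.comul := by
    refine LinearMap.ext fun x => ?_
    simp only [antipodeCoact, LinearMap.comp_apply, comul_convL]
    induction (Coalgebra.comul x : H ⊗[k] H) with
    | zero => simp
    | add x y hx hy => simp only [map_add, hx, hy]
    | tmul x y => simp
  have e2 := congrArg (fun x => TensorProduct.leftComm k H H H
    (TensorProduct.map LinearMap.id ((TensorProduct.comm k H H).toLinearMap ∘ₗ
      TensorProduct.map (S ∘ₗ betaL k H) LinearMap.id) x)) (Coalgebra.coassoc_apply (R := k) h)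
  rw [e]
  refine Eq.trans ?_ (e2.symm.trans ?_)
  · refine congrArg (TensorProduct.leftComm k H H H) ?_
    refine Eq.trans ?_ (TensorProduct.map_map _ _ _ _ _).symm
    rfl
  · rw [canAux_eq]
    change TensorProduct.leftComm k H H H (TensorProduct.map LinearMap.id
      ((TensorProduct.comm k H H).toLinearMap ∘ₗ
      TensorProduct.map (S ∘ₗ betaL k H) LinearMap.id) (TensorProduct.assoc k H H H
        (TensorProduct.map Coalgebra.comul LinearMap.id (Coalgebra.comul h)))) =
      TensorProduct.comm k _ _ ((TensorProduct.assoc k H H H).symm (TensorProduct.assoc k H H H _))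
    rw [LinearEquiv.symm_apply_apply]
    induction (Coalgebra.comul h : H ⊗[k] H) with
    | zero => simp
    | add x y hx hy => simp only [map_add, hx, hy]
    | tmul x y =>
      have e3 := map_convL_comul (β (k := k)) LinearMap.id LinearMap.id x
      have e4 := congrArg (TensorProduct.map LinearMap.id S) e3
      rw [TensorProduct.map_map, TensorProduct.map_map] at e4
      simp only [TensorProduct.map_tmul, LinearMap.comp_apply, TensorProduct.comm_tmul]
      refine Eq.trans ?_ (congrArg (fun z => y ⊗ₜ[k] z) e4)
      induction (Coalgebra.comul x : H ⊗[k] H) with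
      | zero => simp
      | add x y hx hy => simp only [map_add, TensorProduct.add_tmul, TensorProduct.tmul_add, hx, hy]
      | tmul x z => simp

variable {k H} {V W : Type*} [AddCommGroup V] [Module k V] [AddCommGroup W] [Module k W]

/-- `v ↦ v₀ ⊗ β(v₁) v₂`. -/
def betaCoact (ρ : V →ₗ[k] V ⊗[k] H) : V →ₗ[k] V ⊗[k] H := push (betaL k H) ρ

theorem prodCoact_betaCoact {ρ : V →ₗ[k] V ⊗[k] H} (hρ : IsCoaction ρ) (v : V) :
    prodCoact ρ (antipodeCoact k H) (betaCoact ρ v) =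
      (TensorProduct.assoc k V H (H ⊗[k] H)).symm (push (rotate k H ∘ₗ canAux k H) ρ v) := by
  rw [betaCoact, hρ.prodCoact_push_apply]
  congr 3
  exact LinearMap.ext fun h => leftComm_antipodeCoact_betaL k H h

/-- `v₀ ⊗ β(v₁) v₂` is coinvariant. -/
theorem mulCoact_betaCoact {ρ : V →ₗ[k] V ⊗[k] H} (hρ : IsCoaction ρ) (v : V) :
    mulCoact ρ (antipodeCoact k H) (betaCoact ρ v) = betaCoact ρ v ⊗ₜ[k] (one k : H) := by
  rw [mulCoact, push_apply, prodCoact_betaCoact hρ, betaCoact, push_apply, push_apply]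
  induction ρ v with
  | zero => simp
  | add x y hx hy => simp only [map_add, TensorProduct.add_tmul, hx, hy]
  | tmul v h =>
    -- The coacted legs multiply to `h₁β(h₂)S(h₃) = β(h)1`, applied to the first leg of `Δ(h)`.
    have e : TensorProduct.map LinearMap.id mul.toLinearMap (rotate k H (canAux k H h)) =
        betaL k H h ⊗ₜ[k] (one k : H) := by
      rw [canAux_eq]
      change TensorProduct.map LinearMap.id mul.toLinearMap (TensorProduct.comm k _ _
        ((TensorProduct.assoc k H H H).symm (TensorProduct.assoc k H H H _))) =
          (TensorProduct.lid k H (TensorProduct.map β LinearMap.id (Coalgebra.comul h))) ⊗ₜ[k] _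
      rw [LinearEquiv.symm_apply_apply]
      induction (Coalgebra.comul h : H ⊗[k] H) with
      | zero => simp
      | add x y hx hy => simp only [map_add, TensorProduct.add_tmul, hx, hy]
      | tmul x y =>
        have := id_β_S (k := k) x
        simp only [TensorProduct.map_tmul, TensorProduct.comm_tmul, LinearMap.comp_apply]
        refine (congrArg (fun z => y ⊗ₜ[k] z) this).trans ?_
        simp [TensorProduct.smul_tmul]
    simp only [TensorProduct.map_tmul, LinearMap.id_apply, LinearMap.comp_apply]
    have e' := congrArg (fun z => (TensorProduct.assoc k V H H).symm (v ⊗ₜ[k] z)) e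
    refine Eq.trans ?_ e'
    induction rotate k H (canAux k H h) with
    | zero => simp
    | add x y hx hy => simp only [map_add, TensorProduct.tmul_add, hx, hy]
    | tmul x y => simp

theorem colinear_betaCoact {ρ : V →ₗ[k] V ⊗[k] H} (hρ : IsCoaction ρ) :
    Colinear (trivCoact H V) (mulCoact ρ (antipodeCoact k H)) (betaCoact ρ) :=
  LinearMap.ext fun v => mulCoact_betaCoact hρ v

/-- `v₀ ⊗ h ↦ v₀ ω(v₁, S(h₁), α(h₂)h₃)` recovers `v` from `v₀ ⊗ β(v₁) v₂`. -/
theorem betaCoact_injective {ρ : V →ₗ[k] V ⊗[k] H} (hρ : IsCoaction ρ) :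
    Function.Injective (betaCoact ρ) := by
  set f : H →ₗ[k] H ⊗[k] H := TensorProduct.map S (convL α LinearMap.id) ∘ₗ Coalgebra.comul
    with hf
  refine Function.LeftInverse.injective
    (g := (TensorProduct.rid k V).toLinearMap ∘ₗ TensorProduct.map LinearMap.id ω ∘ₗ
      (TensorProduct.assoc k V H (H ⊗[k] H)).toLinearMap ∘ₗ TensorProduct.map ρ f) fun v => ?_
  have e := congrArg (fun x => TensorProduct.rid k V (TensorProduct.map LinearMap.id ω x))
    (hρ.push_comul LinearMap.id (f ∘ₗ betaL k H) v)
  simp only [push_id] at e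
  refine Eq.trans ?_ (e.trans ?_)
  · change TensorProduct.rid k V (TensorProduct.map LinearMap.id ω
      (TensorProduct.assoc k V H (H ⊗[k] H) (TensorProduct.map ρ f (betaCoact ρ v)))) = _
    rw [betaCoact, push_apply, TensorProduct.map_map, LinearMap.comp_id]
  · rw [← push_apply, push_push]
    refine Eq.trans ?_ (hρ.counit v)
    rw [push_apply]
    congr 3
    refine LinearMap.ext fun h => ?_
    rw [← ω_antipode h]
    refine congrArg ω ?_
    have e2 := map_convL_comul (β (k := k)) LinearMap.id LinearMap.id h
    have e3 := congrArg (TensorProduct.map LinearMap.id f) e2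
    rw [TensorProduct.map_map, TensorProduct.map_map] at e3
    refine e3.trans ?_
    rw [comul₃, LinearMap.comp_apply, TensorProduct.map_map]
    rfl

end Antipode


/-! ## The Galois map through the monoidal structure -/

section Can

open CoquasiBialgebra CoquasiHopfAlgebra RightComodule

variable {k H A M : Type*} [Field k] [AddCommGroup H] [Module k H] [CoquasiHopfAlgebra k H]
  [AddCommGroup A] [Module k A] [ComoduleAlgebra k H A]
  [AddCommGroup M] [Module k M] [RelHopfModule k H A M]

/-- The inverse reassociator `U ⊗ (V ⊗ H) → (U ⊗ V) ⊗ H`, where `H` carries the antipode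
coaction. -/
def twist (k H U V : Type*) [Field k] [AddCommGroup H] [Module k H] [CoquasiHopfAlgebra k H]
    [AddCommGroup U] [Module k U] [RightComodule k H U]
    [AddCommGroup V] [Module k V] [RightComodule k H V] :
    U ⊗[k] (V ⊗[k] H) →ₗ[k] (U ⊗[k] V) ⊗[k] H :=
  (TensorProduct.assoc k U V H).symm.toLinearMap ∘ₗ
    act₃ (ωInv (k := k) (H := H)) coact coact (antipodeCoact k H)

theorem colinear_twist (U V : Type*) [AddCommGroup U] [Module k U] [RightComodule k H U]
    [AddCommGroup V] [Module k V] [RightComodule k H V] :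
    Colinear (mulCoact coact (mulCoact coact (antipodeCoact k H)))
      (mulCoact (mulCoact coact coact) (antipodeCoact k H)) (twist k H U V) :=
  colinear_act₃_ωInv isCoaction_coact isCoaction_coact (isCoaction_antipodeCoact k H)

theorem twist_bijective (U V : Type*) [AddCommGroup U] [Module k U] [RightComodule k H U]
    [AddCommGroup V] [Module k V] [RightComodule k H V] :
    Function.Bijective (twist k H U V) := by
  refine (TensorProduct.assoc k U V H).symm.bijective.comp
    (Function.bijective_iff_has_inverse.mpr
      ⟨act₃ (ω (k := k) (H := H)) coact coact (antipodeCoact k H), fun x => ?_, fun x => ?_⟩)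
  · exact act₃_ω_ωInv isCoaction_coact isCoaction_coact (isCoaction_antipodeCoact k H) x
  · exact act₃_ωInv_ω isCoaction_coact isCoaction_coact (isCoaction_antipodeCoact k H) x

variable (k H A M) in
-- The explicit formula for `can_M` is a composite of maps natural in `M`, each of them colinear
-- once the source `A` carries the trivial coaction. Colinearity, naturality and the behaviour on
-- free modules are all read off from this factorisation.
theorem canPre_eq : canPre H A M = TensorProduct.map (RelHopfModule.act H) LinearMap.id ∘ₗ
    twist k H M A ∘ₗ TensorProduct.map LinearMap.id (betaCoact coact) := by
  refine TensorProduct.ext' fun m a => ?_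
  change TensorProduct.map (RelHopfModule.act H) (ωInvApply k H)
      (TensorProduct.tensorTensorTensorComm k M H A (H ⊗[k] (H ⊗[k] H))
        (coact m ⊗ₜ[k] TensorProduct.map LinearMap.id (canAux k H) (coact a))) =
    TensorProduct.map (RelHopfModule.act H) LinearMap.id ((TensorProduct.assoc k M A H).symm
      (TensorProduct.rid k _ (TensorProduct.map LinearMap.id (ωInv (k := k) (H := H))
        (TensorProduct.tensorTensorTensorComm k M H (A ⊗[k] H) (H ⊗[k] H) (coact m ⊗ₜ[k]
          prodCoact coact (antipodeCoact k H) (betaCoact coact a))))))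
  rw [prodCoact_betaCoact isCoaction_coact, push_apply]
  induction (coact m : M ⊗[k] H) with
  | zero => simp
  | add x y hx hy => simp only [map_add, TensorProduct.add_tmul, hx, hy]
  | tmul x h =>
    induction (coact a : A ⊗[k] H) with
    | zero => simp
    | add x y hx hy => simp only [map_add, TensorProduct.tmul_add, hx, hy]
    | tmul a g =>
      simp only [TensorProduct.map_tmul, LinearMap.comp_apply, LinearMap.id_apply]
      induction canAux k H g with
      | zero => simp
      | add x y hx hy => simp only [map_add, TensorProduct.tmul_add, hx, hy]
      | tmul p q =>
        induction q with
        | zero => simp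
        | add x y hx hy => simp only [map_add, TensorProduct.tmul_add, hx, hy]
        | tmul q t => simp [rotate, ωInvApply]

theorem canPre_apply (m : M) (a : A) : canPre H A M (m ⊗ₜ[k] a) =
    TensorProduct.map (RelHopfModule.act H) LinearMap.id
      (twist k H M A (m ⊗ₜ[k] betaCoact coact a)) := by
  rw [canPre_eq]
  rfl

/-- `can_M` is colinear for the coaction of the first factor of `M ⊗ A` and the tensor product
coaction of `M ⊗ H`. -/
theorem colinear_canPre : Colinear (mulCoact (coact : M →ₗ[k] M ⊗[k] H) (trivCoact H A))
    (mulCoact coact (antipodeCoact k H)) (canPre H A M) := by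
  rw [canPre_eq]
  exact (colinear_act.mulCoact (Colinear.id _)).comp ((colinear_twist M A).comp
    ((Colinear.id _).mulCoact (colinear_betaCoact isCoaction_coact)))

theorem act_coinvariant_colinear {m : M} (hm : m ∈ coinvariants k H M) :
    Colinear (coact : A →ₗ[k] A ⊗[k] H) (coact : M →ₗ[k] M ⊗[k] H)
      (RelHopfModule.act H ∘ₗ TensorProduct.mk k M A m) := by
  refine colinear_act.comp (LinearMap.ext fun a => ?_)
  have hm' : coact m = m ⊗ₜ[k] (one k : H) := hm
  change TensorProduct.map LinearMap.id mul.toLinearMap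
    (TensorProduct.tensorTensorTensorComm k M H A H (coact m ⊗ₜ[k] coact a)) =
      TensorProduct.map (TensorProduct.mk k M A m) LinearMap.id (coact a)
  rw [hm']
  induction (coact a : A ⊗[k] H) with
  | zero => simp
  | add x y hx hy => simp only [map_add, TensorProduct.tmul_add, hx, hy]
  | tmul x y => simp [CoquasiBialgebra.one_mul]

theorem twist_left {U V : Type*} [AddCommGroup U] [Module k U] [RightComodule k H U]
    [AddCommGroup V] [Module k V] [RightComodule k H V] {u : U} (hu : u ∈ coinvariants k H U)
    (z : V ⊗[k] H) : twist k H U V (u ⊗ₜ[k] z) = (TensorProduct.assoc k U V H).symm (u ⊗ₜ[k] z) := by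
  refine congrArg (TensorProduct.assoc k U V H).symm ?_
  exact act₃_ωInv_of_fixed isCoaction_coact isCoaction_coact (isCoaction_antipodeCoact k H)
    (act₃_ω_left hu isCoaction_coact (isCoaction_antipodeCoact k H) z)

theorem twist_mid {U V : Type*} [AddCommGroup U] [Module k U] [RightComodule k H U]
    [AddCommGroup V] [Module k V] [RightComodule k H V] {v : V} (hv : v ∈ coinvariants k H V)
    (u : U) (h : H) : twist k H U V (u ⊗ₜ[k] (v ⊗ₜ[k] h)) = (u ⊗ₜ[k] v) ⊗ₜ[k] h := by
  refine (congrArg (TensorProduct.assoc k U V H).symm ?_).trans (by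
    rw [TensorProduct.assoc_symm_tmul])
  exact act₃_ωInv_of_fixed isCoaction_coact isCoaction_coact (isCoaction_antipodeCoact k H)
    (act₃_ω_mid isCoaction_coact hv (isCoaction_antipodeCoact k H) u h)

/-- `can_M(m ⊗ a) = (ma)₀ ⊗ β((ma)₁) (ma)₂` for coinvariant `m`. -/
theorem canPre_coinvariant {m : M} (hm : m ∈ coinvariants k H M) (a : A) :
    canPre H A M (m ⊗ₜ[k] a) = betaCoact coact (RelHopfModule.act H (m ⊗ₜ[k] a)) := by
  rw [canPre_apply, twist_left hm]
  have h := (act_coinvariant_colinear (A := A) hm).push (betaL k H)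
  have h' := (push_apply _ _ _).trans (congrArg (TensorProduct.map LinearMap.id (betaL k H))
    ((act_coinvariant_colinear (A := A) hm).apply a))
  rw [TensorProduct.map_map] at h'
  refine Eq.trans ?_ h'.symm
  rw [betaCoact, push_apply]
  induction (coact a : A ⊗[k] H) with
  | zero => simp
  | add x y hx hy => simp only [map_add, TensorProduct.tmul_add, hx, hy]
  | tmul x y => simp

/-- Naturality of `can`. -/
theorem canPre_naturality {N : Type*} [AddCommGroup N] [Module k N] [RelHopfModule k H A N]
    {F : M →ₗ[k] N} (hF : Colinear (coact : M →ₗ[k] M ⊗[k] H) coact F)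
    (hact : ∀ m a, F (RelHopfModule.act H (m ⊗ₜ[k] a)) = RelHopfModule.act (A := A) H (F m ⊗ₜ[k] a))
    (x : M ⊗[k] A) : canPre H A N (TensorProduct.map F LinearMap.id x) =
      TensorProduct.map F LinearMap.id (canPre H A M x) := by
  have hact' : F ∘ₗ RelHopfModule.act H = RelHopfModule.act H ∘ₗ
      TensorProduct.map F (LinearMap.id : A →ₗ[k] A) := TensorProduct.ext' hact
  have h1 : ∀ y, twist k H N A (TensorProduct.map F LinearMap.id y) =
      TensorProduct.map (TensorProduct.map F LinearMap.id) LinearMap.id (twist k H M A y) := by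
    intro y
    have := act₃_naturality (ωInv (k := k) (H := H)) hF
      (Colinear.id (coact : A →ₗ[k] A ⊗[k] H)) (Colinear.id (antipodeCoact k H)) y
    rw [TensorProduct.map_id] at this
    refine (congrArg (TensorProduct.assoc k N A H).symm this).trans ?_
    rw [← TensorProduct.map_id, ← TensorProduct.map_map_assoc_symm]
    rfl
  rw [canPre_eq, canPre_eq]
  simp only [LinearMap.comp_apply]
  have h2 : TensorProduct.map LinearMap.id (betaCoact (coact : A →ₗ[k] A ⊗[k] H))
      (TensorProduct.map F LinearMap.id x) =
      TensorProduct.map F LinearMap.id (TensorProduct.map LinearMap.id (betaCoact coact) x) := by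
    simp only [TensorProduct.map_map, LinearMap.id_comp, LinearMap.comp_id]
  rw [h2, h1, TensorProduct.map_map, TensorProduct.map_map, ← hact']

/-- The Galois map of a free Hopf module. -/
theorem canPre_free {V : Type*} [AddCommGroup V] [Module k V] [RightComodule k H V]
    (v : V) (a b : A) : canPre H A (V ⊗[k] A) ((v ⊗ₜ[k] a) ⊗ₜ[k] b) =
      twist k H V A (v ⊗ₜ[k] canPre H A A (a ⊗ₜ[k] b)) := by
  set w : A ⊗[k] H := betaCoact coact b with hw
  have hA : IsCoaction (coact : A →ₗ[k] A ⊗[k] H) := isCoaction_coact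
  have hV : IsCoaction (coact : V →ₗ[k] V ⊗[k] H) := isCoaction_coact
  have hS := isCoaction_antipodeCoact k H
  have h4 := hV.prod (hA.prod (hA.prod hS))
  -- The pentagon for `V, A, A, H^S`, evaluated at `v ⊗ a ⊗ (b₀ ⊗ β(b₁)b₂)`.
  have hP := congrArg (fun f => applyCoact f (prodCoact (coact : V →ₗ[k] V ⊗[k] H)
    (prodCoact (coact : A →ₗ[k] A ⊗[k] H) (prodCoact (coact : A →ₗ[k] A ⊗[k] H)
      (antipodeCoact k H)))) (v ⊗ₜ[k] (a ⊗ₜ[k] w))) (pentagon_inv k H)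
  have hB := applyCoact_pentB (coact : V →ₗ[k] V ⊗[k] H) (coact : A →ₗ[k] A ⊗[k] H)
    (coact : A →ₗ[k] A ⊗[k] H) (antipodeCoact k H) ωInv ((v ⊗ₜ[k] a) ⊗ₜ[k] w)
  set y := act₃ ωInv (mulCoact (coact : V →ₗ[k] V ⊗[k] H) (coact : A →ₗ[k] A ⊗[k] H)) coact
    (antipodeCoact k H) ((v ⊗ₜ[k] a) ⊗ₜ[k] w) with hy
  set z := act₃ ωInv (coact : A →ₗ[k] A ⊗[k] H) coact (antipodeCoact k H) (a ⊗ₜ[k] w) with hz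
  have e1 : ∀ y : (V ⊗[k] A) ⊗[k] (A ⊗[k] H), TensorProduct.assoc k V A (A ⊗[k] H) y =
      TensorProduct.map LinearMap.id (TensorProduct.assoc k A A H).toLinearMap
        (TensorProduct.assoc k V (A ⊗[k] A) H (TensorProduct.map
          (TensorProduct.assoc k V A A).toLinearMap LinearMap.id
            ((TensorProduct.assoc k (V ⊗[k] A) A H).symm y))) := by
    intro y
    induction y with
    | zero => simp
    | add x y hx hy => simp only [map_add, hx, hy]
    | tmul x y =>
      induction x with
      | zero => simp
      | add x y hx hy => simp only [map_add, TensorProduct.add_tmul, hx, hy]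
      | tmul p q =>
        induction y with
        | zero => simp
        | add x y hx hy => simp only [map_add, TensorProduct.tmul_add, hx, hy]
        | tmul r s => simp
  have e2 : ∀ z : A ⊗[k] (A ⊗[k] H), v ⊗ₜ[k] z = TensorProduct.map LinearMap.id
      (TensorProduct.assoc k A A H).toLinearMap
        (v ⊗ₜ[k] (TensorProduct.assoc k A A H).symm z) := by
    intro z
    rw [TensorProduct.map_tmul, LinearEquiv.coe_coe, LinearEquiv.apply_symm_apply,
      LinearMap.id_apply]
  -- The edge `A` of the pentagon disappears because `b₀ ⊗ β(b₁)b₂` is coinvariant in `A ⊗ H^S`.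
  have hAw : act₃ ω (coact : V →ₗ[k] V ⊗[k] H) (coact : A →ₗ[k] A ⊗[k] H)
      (mulCoact (coact : A →ₗ[k] A ⊗[k] H) (antipodeCoact k H)) (v ⊗ₜ[k] (a ⊗ₜ[k] w)) =
      v ⊗ₜ[k] (a ⊗ₜ[k] w) :=
    act₃_ω_right hV hA (mulCoact_betaCoact hA b) v a
  rw [TensorProduct.assoc_tmul] at hB
  simp only [h4.applyCoact_convL] at hP
  rw [applyCoact_pentA, hAw, applyCoact_pentC _ _ _ _ hV, TensorProduct.map_tmul,
    LinearMap.id_apply, ← hz, e2, applyCoact_pentD, hB, e1, applyCoact_pentE _ _ _ _ hS] at hP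
  have hinj : Function.Injective (TensorProduct.map (LinearMap.id : V →ₗ[k] V)
      (TensorProduct.assoc k A A H).toLinearMap) :=
    (TensorProduct.congr (LinearEquiv.refl k V) (TensorProduct.assoc k A A H)).injective
  have hP' := hinj hP
  rw [canPre_apply, canPre_apply]
  change TensorProduct.map (TensorProduct.map LinearMap.id (ComoduleAlgebra.mul H) ∘ₗ
      act₃ ω coact coact coact ∘ₗ (TensorProduct.assoc k V A A).toLinearMap) LinearMap.id
        ((TensorProduct.assoc k (V ⊗[k] A) A H).symm y) =
    (TensorProduct.assoc k V A H).symm (act₃ ωInv coact coact (antipodeCoact k H)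
      (v ⊗ₜ[k] TensorProduct.map (ComoduleAlgebra.mul H) LinearMap.id
        ((TensorProduct.assoc k A A H).symm z)))
  -- The multiplication inside `can_A` is pulled out of the inverse associator, after which `hP'`
  -- applies. The remaining `ω` on `V, A, A` is the one in the free action.
  have e3 := act₃_naturality (ωInv (k := k) (H := H)) (Colinear.id (coact : V →ₗ[k] V ⊗[k] H))
    (colinear_mul (A := A)) (Colinear.id (antipodeCoact k H))
      (v ⊗ₜ[k] (TensorProduct.assoc k A A H).symm z)
  rw [TensorProduct.map_tmul, LinearMap.id_apply, hP', TensorProduct.map_map_assoc] at e3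
  rw [e3, LinearEquiv.symm_apply_apply, TensorProduct.map_map, TensorProduct.map_map]
  rfl

end Can


/-! ## The Galois map of an arbitrary relative Hopf module -/

section BalTensorLemmas

variable {k B N N' N'' A : Type*} [Field k] [Ring B] [Algebra k B]
  [AddCommGroup N] [Module k N] [Module Bᵐᵒᵖ N] [IsScalarTower k Bᵐᵒᵖ N]
  [AddCommGroup N'] [Module k N'] [Module Bᵐᵒᵖ N'] [IsScalarTower k Bᵐᵒᵖ N']
  [AddCommGroup N''] [Module k N''] [Module Bᵐᵒᵖ N''] [IsScalarTower k Bᵐᵒᵖ N'']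
  [AddCommGroup A] [Module k A] [Module B A]

theorem BalTensor.mapLeft_mapLeft (g : N' →ₗ[Bᵐᵒᵖ] N'') (f : N →ₗ[Bᵐᵒᵖ] N')
    (x : BalTensor k B N A) : BalTensor.mapLeft A g (BalTensor.mapLeft (k := k) A f x) =
      BalTensor.mapLeft A (g ∘ₗ f) x := by
  induction x using BalTensor.induction with
  | h0 => simp
  | ha x y hx hy => simp only [map_add, hx, hy]
  | ht n a => rfl

theorem BalTensor.mapLeft_surjective {g : N →ₗ[Bᵐᵒᵖ] N'} (hg : Function.Surjective g) :
    Function.Surjective (BalTensor.mapLeft (k := k) A g) := by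
  intro x
  induction x using BalTensor.induction with
  | h0 => exact ⟨0, map_zero _⟩
  | ha x y hx hy =>
    obtain ⟨a, rfl⟩ := hx
    obtain ⟨b, rfl⟩ := hy
    exact ⟨a + b, map_add _ _ _⟩
  | ht n a =>
    obtain ⟨m, rfl⟩ := hg n
    exact ⟨BalTensor.tmul k m a, rfl⟩

theorem BalTensor.mapLeft_zero (x : BalTensor k B N A) :
    BalTensor.mapLeft A (0 : N →ₗ[Bᵐᵒᵖ] N') x = 0 := by
  induction x using BalTensor.induction with
  | h0 => simp
  | ha x y hx hy => simp only [map_add, hx, hy, add_zero]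
  | ht n a =>
    rw [BalTensor.mapLeft_tmul, LinearMap.zero_apply, BalTensor.tmul, TensorProduct.zero_tmul,
      map_zero]

end BalTensorLemmas

/-! ### Relative Hopf modules over the coinvariants, and induction of free modules -/

section Tower

variable {k H A M : Type*} [Field k] [AddCommGroup H] [Module k H] [CoquasiBialgebra k H]
  [AddCommGroup A] [Module k A] [ComoduleAlgebra k H A]
  [AddCommGroup M] [Module k M] [RelHopfModule k H A M]

instance rightModule_isScalarTower : IsScalarTower k (coinvariants k H A)ᵐᵒᵖ M where
  smul_assoc r b m := by
    change RelHopfModule.act H (m ⊗ₜ[k] (r • b.unop.1)) = r • RelHopfModule.act H (m ⊗ₜ[k] b.unop.1)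
    rw [TensorProduct.tmul_smul, map_smul]

variable {N : Type*} [AddCommGroup N] [Module k N] [RelHopfModule k H A N]

/-- An `A`-linear map is linear over the coinvariants. -/
def toLinearMapB (F : M →ₗ[k] N)
    (hact : ∀ m a, F (RelHopfModule.act H (m ⊗ₜ[k] a)) = RelHopfModule.act (A := A) H (F m ⊗ₜ[k] a)) :
    M →ₗ[(coinvariants k H A)ᵐᵒᵖ] N where
  toFun := F
  map_add' := map_add F
  map_smul' b m := hact m b.unop.1

/-- Quasi-associativity of the action says that `M ⊗ A → M` is a morphism from the free module. It
is the augmentation of the bar resolution. -/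
theorem act_freeAct (y : M ⊗[k] A) (a : A) :
    RelHopfModule.act H (freeAct k H A M (y ⊗ₜ[k] a)) =
      RelHopfModule.act (A := A) H (RelHopfModule.act H y ⊗ₜ[k] a) := by
  induction y with
  | zero => simp
  | add x y hx hy => simp only [map_add, TensorProduct.add_tmul, hx, hy]
  | tmul m b => exact (RelHopfModule.act_quasi_assoc m b a).symm

theorem freeAct_map {V W : Type*} [AddCommGroup V] [Module k V] [RightComodule k H V]
    [AddCommGroup W] [Module k W] [RightComodule k H W] {F : V →ₗ[k] W}
    (hF : Colinear (RightComodule.coact : V →ₗ[k] V ⊗[k] H) RightComodule.coact F)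
    (y : V ⊗[k] A) (a : A) :
    TensorProduct.map F LinearMap.id (freeAct k H A V (y ⊗ₜ[k] a)) =
      freeAct k H A W (TensorProduct.map F LinearMap.id y ⊗ₜ[k] a) := by
  induction y with
  | zero => simp
  | add x y hx hy => simp only [map_add, TensorProduct.add_tmul, hx, hy]
  | tmul v b =>
    have h := act₃_naturality (CoquasiBialgebra.ω (k := k) (H := H)) hF
      (Colinear.id (RightComodule.coact : A →ₗ[k] A ⊗[k] H))
      (Colinear.id (RightComodule.coact : A →ₗ[k] A ⊗[k] H)) (v ⊗ₜ[k] (b ⊗ₜ[k] a))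
    have h' := congrArg (TensorProduct.map LinearMap.id (ComoduleAlgebra.mul (A := A) H)) h
    rw [TensorProduct.map_id, TensorProduct.map_map, LinearMap.id_comp, LinearMap.comp_id,
      TensorProduct.map_tmul, LinearMap.id_apply] at h'
    refine Eq.trans ?_ h'.symm
    refine (TensorProduct.map_map _ _ _ _ _).trans ?_
    rw [LinearMap.id_comp, LinearMap.comp_id]
    rfl

/-- The associator is trivial on a coinvariant last factor, so `B` acts on a free module through `A`
alone. Hence the free module can be induced factor by factor. -/
theorem free_smul {V : Type*} [AddCommGroup V] [Module k V] [RightComodule k H V] (v : V) (a : A)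
    (b : (coinvariants k H A)ᵐᵒᵖ) : b • (v ⊗ₜ[k] a) = v ⊗ₜ[k] (b • a) := by
  change TensorProduct.map LinearMap.id (ComoduleAlgebra.mul H) (act₃ CoquasiBialgebra.ω
    RightComodule.coact RightComodule.coact RightComodule.coact (v ⊗ₜ[k] (a ⊗ₜ[k] b.unop.1))) = _
  rw [act₃_ω_right isCoaction_coact isCoaction_coact b.unop.2]
  rfl

/-- `v ⊗ (a ⊗_B b) ↦ (v ⊗ a) ⊗_B b`. -/
def freeBal (k H A V : Type*) [Field k] [AddCommGroup H] [Module k H] [CoquasiBialgebra k H]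
    [AddCommGroup A] [Module k A] [ComoduleAlgebra k H A] [AddCommGroup V] [Module k V]
    [RightComodule k H V] : V ⊗[k] BalTensor k (coinvariants k H A) A A →ₗ[k]
      BalTensor k (coinvariants k H A) (V ⊗[k] A) A :=
  TensorProduct.lift
    { toFun := fun v => BalTensor.mapLeft A
        { toFun := fun a => v ⊗ₜ[k] a
          map_add' := fun a b => TensorProduct.tmul_add v a b
          map_smul' := fun b a => (free_smul v a b).symm }
      map_add' := fun v w => BalTensor.hom_ext fun a b => by
        change BalTensor.tmul k ((v + w) ⊗ₜ[k] a) b =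
          BalTensor.tmul k (v ⊗ₜ[k] a) b + BalTensor.tmul k (w ⊗ₜ[k] a) b
        rw [TensorProduct.add_tmul, BalTensor.tmul, TensorProduct.add_tmul, map_add]
        rfl
      map_smul' := fun r v => BalTensor.hom_ext fun a b => by
        change BalTensor.tmul k ((r • v) ⊗ₜ[k] a) b = r • BalTensor.tmul k (v ⊗ₜ[k] a) b
        rw [← TensorProduct.smul_tmul', BalTensor.tmul, ← TensorProduct.smul_tmul', map_smul]
        rfl }

/-- Generators lift to generators. Surjectivity is enough below: the composite with the Galois map
is already known to be injective there. -/
theorem freeBal_surjective (V : Type*) [AddCommGroup V] [Module k V] [RightComodule k H V] :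
    Function.Surjective (freeBal k H A V) := by
  intro x
  induction x using BalTensor.induction with
  | h0 => exact ⟨0, map_zero _⟩
  | ha x y hx hy =>
    obtain ⟨a, rfl⟩ := hx
    obtain ⟨b, rfl⟩ := hy
    exact ⟨a + b, map_add _ _ _⟩
  | ht n b =>
    induction n with
    | zero => exact ⟨0, by rw [map_zero, BalTensor.tmul, TensorProduct.zero_tmul, map_zero]⟩
    | add x y hx hy =>
      obtain ⟨p, hp⟩ := hx
      obtain ⟨q, hq⟩ := hy
      exact ⟨p + q, by rw [map_add, hp, hq, BalTensor.tmul, BalTensor.tmul, BalTensor.tmul,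
        TensorProduct.add_tmul, map_add]⟩
    | tmul v a => exact ⟨v ⊗ₜ[k] BalTensor.tmul k a b, rfl⟩

end Tower

/-! ### Bijectivity of `can_M` through the bar resolution -/

section GaloisAll

open RightComodule

variable {k H A M : Type*} [Field k] [AddCommGroup H] [Module k H] [CoquasiHopfAlgebra k H]
  [AddCommGroup A] [Module k A] [ComoduleAlgebra k H A]
  [AddCommGroup M] [Module k M] [RelHopfModule k H A M]

theorem canMap_naturality {N : Type*} [AddCommGroup N] [Module k N] [RelHopfModule k H A N]
    {F : M →ₗ[k] N} (hF : Colinear (coact : M →ₗ[k] M ⊗[k] H) coact F)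
    (hact : ∀ m a, F (RelHopfModule.act H (m ⊗ₜ[k] a)) = RelHopfModule.act (A := A) H (F m ⊗ₜ[k] a))
    (x : BalTensor k (coinvariants k H A) M A) :
    canMap k H A N (BalTensor.mapLeft A (toLinearMapB F hact) x) =
      TensorProduct.map F LinearMap.id (canMap k H A M x) := by
  induction x using BalTensor.induction with
  | h0 => simp
  | ha x y hx hy => simp only [map_add, hx, hy]
  | ht m a => exact canPre_naturality hF hact (m ⊗ₜ[k] a)

theorem canMap_freeBal (V : Type*) [AddCommGroup V] [Module k V] [RightComodule k H V]
    (x : V ⊗[k] BalTensor k (coinvariants k H A) A A) :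
    canMap k H A (V ⊗[k] A) (freeBal k H A V x) =
      twist k H V A (TensorProduct.map LinearMap.id (canMap k H A A) x) := by
  induction x with
  | zero => simp
  | add x y hx hy => simp only [map_add, hx, hy]
  | tmul v x =>
    induction x using BalTensor.induction with
    | h0 => simp
    | ha x y hx hy => simp only [map_add, TensorProduct.tmul_add, hx, hy]
    | ht a b => exact canPre_free v a b

/-- Composed with `freeBal`, the Galois map of `V ⊗ A` becomes `twist ∘ (V ⊗ can)`, a bijection.
Since `freeBal` is onto, the Galois map itself is bijective. -/
theorem canMap_free_bijective (hG : IsGaloisExtension k H A) (V : Type*) [AddCommGroup V]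
    [Module k V] [RightComodule k H V] : Function.Bijective (canMap k H A (V ⊗[k] A)) := by
  have h : Function.Bijective (canMap k H A (V ⊗[k] A) ∘ freeBal k H A V) := by
    have e : canMap k H A (V ⊗[k] A) ∘ freeBal k H A V = twist k H V A ∘
        TensorProduct.congr (LinearEquiv.refl k V) (LinearEquiv.ofBijective _ hG) :=
      funext fun x => canMap_freeBal V x
    rw [e]
    exact (twist_bijective V A).comp (LinearEquiv.bijective _)
  refine ⟨fun x y hxy => ?_, h.2.of_comp⟩
  obtain ⟨x, rfl⟩ := freeBal_surjective V x
  obtain ⟨y, rfl⟩ := freeBal_surjective V y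
  rw [h.1 hxy]

variable (M) in
/-- If `A` is a Galois extension, then `can_M` is bijective for every relative Hopf module. -/
theorem canMap_bijective (hG : IsGaloisExtension k H A) : Function.Bijective (canMap k H A M) := by
  set act : M ⊗[k] A →ₗ[k] M := RelHopfModule.act H with hact_def
  -- The insertions of `1` split the fork `d₁, d₂ : (M ⊗ A) ⊗ A ⇉ M ⊗ A → M`. They need only be
  -- `k`-linear, since they are applied to the targets `- ⊗ H` and never to the balanced tensor
  -- products.
  set s : M →ₗ[k] M ⊗[k] A := (TensorProduct.mk k M A).flip (ComoduleAlgebra.one k H)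
  set s' : M ⊗[k] A →ₗ[k] (M ⊗[k] A) ⊗[k] A :=
    (TensorProduct.mk k (M ⊗[k] A) A).flip (ComoduleAlgebra.one k H)
  have has : act ∘ₗ s = LinearMap.id := LinearMap.ext fun m => RelHopfModule.act_one m
  have hsurj : Function.Surjective act := fun m => ⟨s m, LinearMap.congr_fun has m⟩
  have hc : Colinear (coact : M ⊗[k] A →ₗ[k] (M ⊗[k] A) ⊗[k] H) coact act := colinear_act
  have ha : ∀ (y : M ⊗[k] A) (a : A), act (RelHopfModule.act H (y ⊗ₜ[k] a)) =
      RelHopfModule.act (A := A) H (act y ⊗ₜ[k] a) := act_freeAct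
  set d₁ : (M ⊗[k] A) ⊗[k] A →ₗ[k] M ⊗[k] A := TensorProduct.map act LinearMap.id
  set d₂ : (M ⊗[k] A) ⊗[k] A →ₗ[k] M ⊗[k] A := freeAct k H A M
  have hc₁ : Colinear (coact : (M ⊗[k] A) ⊗[k] A →ₗ[k] ((M ⊗[k] A) ⊗[k] A) ⊗[k] H) coact d₁ :=
    hc.mulCoact (Colinear.id _)
  have ha₁ : ∀ (y : (M ⊗[k] A) ⊗[k] A) (a : A), d₁ (RelHopfModule.act H (y ⊗ₜ[k] a)) =
      RelHopfModule.act (A := A) H (d₁ y ⊗ₜ[k] a) := freeAct_map hc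
  have hc₂ : Colinear (coact : (M ⊗[k] A) ⊗[k] A →ₗ[k] ((M ⊗[k] A) ⊗[k] A) ⊗[k] H) coact d₂ :=
    colinear_act (M := M ⊗[k] A)
  have ha₂ : ∀ (y : (M ⊗[k] A) ⊗[k] A) (a : A), d₂ (RelHopfModule.act H (y ⊗ₜ[k] a)) =
      RelHopfModule.act (A := A) H (d₂ y ⊗ₜ[k] a) := fun y a =>
    act_freeAct (k := k) (H := H) (M := M ⊗[k] A) y a
  have hd₁ : d₁ ∘ₗ s' = s ∘ₗ act := LinearMap.ext fun y => rfl
  have hd₂ : d₂ ∘ₗ s' = LinearMap.id := LinearMap.ext fun y =>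
    RelHopfModule.act_one (k := k) (H := H) (A := A) (M := M ⊗[k] A) y
  have hdd : act ∘ₗ d₁ = act ∘ₗ d₂ :=
    TensorProduct.ext' fun y a => (act_freeAct y a).symm
  have hf := canMap_free_bijective hG M
  refine ⟨(injective_iff_map_eq_zero _).mpr fun x hx => ?_, fun w => ?_⟩
  · obtain ⟨y, rfl⟩ := BalTensor.mapLeft_surjective (g := toLinearMapB act ha) hsurj x
    rw [canMap_naturality hc ha] at hx
    -- With `w = can(y)` one has `w = (d₂ - d₁)(s'(w))`, because `d₂ s' = id` and `d₁ s' = s ∘ act`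
    -- kills `w`. Lifting `s'(w)` to `z` writes `y` as a difference that the action identifies with
    -- zero.
    obtain ⟨z, hz⟩ := (canMap_free_bijective hG (M ⊗[k] A)).2
      (TensorProduct.map s' LinearMap.id (canMap k H A (M ⊗[k] A) y))
    have hy : y = BalTensor.mapLeft A (toLinearMapB d₂ ha₂) z -
        BalTensor.mapLeft A (toLinearMapB d₁ ha₁) z := by
      apply hf.1
      rw [map_sub, canMap_naturality hc₂ ha₂, canMap_naturality hc₁ ha₁, hz,
        TensorProduct.map_map, TensorProduct.map_map, hd₁, hd₂, LinearMap.id_comp,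
        TensorProduct.map_id, LinearMap.id_apply, ← LinearMap.id_comp LinearMap.id,
        ← TensorProduct.map_map, hx, map_zero, sub_zero]
    rw [hy, map_sub, BalTensor.mapLeft_mapLeft, BalTensor.mapLeft_mapLeft, sub_eq_zero]
    congr 2
    exact LinearMap.ext fun y => (LinearMap.congr_fun hdd y).symm
  · obtain ⟨y, hy⟩ := hf.2 (TensorProduct.map s LinearMap.id w)
    refine ⟨BalTensor.mapLeft A (toLinearMapB act ha) y, ?_⟩
    rw [canMap_naturality hc ha, hy, TensorProduct.map_map, has, LinearMap.id_comp,
      TensorProduct.map_id, LinearMap.id_apply]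

end GaloisAll


/-! ## Faithful flatness and the counit of the adjunction -/

section Flat

/-- Bundled modules take their `k`-structure from the algebra map. The scalar tower forces it to
agree with a given one, which allows `LeftFaithfullyFlat` to be used on unbundled modules. -/
theorem moduleOfAlgebraModule_eq {k : Type*} {R N : Type*} [Field k] [Ring R]
    [Algebra k R] [AddCommGroup N] [i : Module k N] [Module R N] [IsScalarTower k R N] :
    i = ModuleCat.moduleOfAlgebraModule (k := k) (ModuleCat.of R N) :=
  Module.ext' _ _ fun r n => (algebraMap_smul R r n).symm

/-- Faithful flatness for modules that are not bundled. -/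
theorem LeftFaithfullyFlat.exact_iff {k B A : Type u} [Field k] [Ring B] [Algebra k B]
    [AddCommGroup A] [Module k A] [Module B A] (h : LeftFaithfullyFlat k B A)
    {N₁ N₂ N₃ : Type u}
    [AddCommGroup N₁] [i₁ : Module k N₁] [Module Bᵐᵒᵖ N₁] [IsScalarTower k Bᵐᵒᵖ N₁]
    [AddCommGroup N₂] [i₂ : Module k N₂] [Module Bᵐᵒᵖ N₂] [IsScalarTower k Bᵐᵒᵖ N₂]
    [AddCommGroup N₃] [i₃ : Module k N₃] [Module Bᵐᵒᵖ N₃] [IsScalarTower k Bᵐᵒᵖ N₃]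
    (f : N₁ →ₗ[Bᵐᵒᵖ] N₂) (g : N₂ →ₗ[Bᵐᵒᵖ] N₃) : Function.Exact f g ↔
      Function.Exact (BalTensor.mapLeft (k := k) A f) (BalTensor.mapLeft (k := k) A g) := by
  obtain rfl := moduleOfAlgebraModule_eq (k := k) (R := Bᵐᵒᵖ) (N := N₁)
  obtain rfl := moduleOfAlgebraModule_eq (k := k) (R := Bᵐᵒᵖ) (N := N₂)
  obtain rfl := moduleOfAlgebraModule_eq (k := k) (R := Bᵐᵒᵖ) (N := N₃)
  exact h (ModuleCat.of _ N₁) (ModuleCat.of _ N₂) (ModuleCat.of _ N₃) (ModuleCat.ofHom f)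
    (ModuleCat.ofHom g)

variable {k B A : Type u} [Field k] [Ring B] [Algebra k B]
  [AddCommGroup A] [Module k A] [Module B A] {N₁ N₂ : Type u}
  [AddCommGroup N₁] [Module k N₁] [Module Bᵐᵒᵖ N₁] [IsScalarTower k Bᵐᵒᵖ N₁]
  [AddCommGroup N₂] [Module k N₂] [Module Bᵐᵒᵖ N₂] [IsScalarTower k Bᵐᵒᵖ N₂]

theorem LeftFaithfullyFlat.injective_iff (h : LeftFaithfullyFlat k B A) (f : N₁ →ₗ[Bᵐᵒᵖ] N₂) :
    Function.Injective f ↔ Function.Injective (BalTensor.mapLeft (k := k) A f) := by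
  have e := h.exact_iff (0 : N₁ →ₗ[Bᵐᵒᵖ] N₁) f
  have e0 : BalTensor.mapLeft (k := k) A (0 : N₁ →ₗ[Bᵐᵒᵖ] N₁) = 0 :=
    LinearMap.ext BalTensor.mapLeft_zero
  rw [e0, LinearMap.exact_zero_iff_injective, LinearMap.exact_zero_iff_injective] at e
  exact e

theorem LeftFaithfullyFlat.surjective_iff (h : LeftFaithfullyFlat k B A) (f : N₁ →ₗ[Bᵐᵒᵖ] N₂) :
    Function.Surjective f ↔ Function.Surjective (BalTensor.mapLeft (k := k) A f) := by
  have e := h.exact_iff f (0 : N₂ →ₗ[Bᵐᵒᵖ] N₂)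
  have e0 : BalTensor.mapLeft (k := k) A (0 : N₂ →ₗ[Bᵐᵒᵖ] N₂) = 0 :=
    LinearMap.ext BalTensor.mapLeft_zero
  rw [e0, LinearMap.exact_zero_iff_surjective, LinearMap.exact_zero_iff_surjective] at e
  exact e

end Flat

/-! ### The map `M^{co H} ⊗_B A → M` and the defect of coinvariance -/

section Counit

open RightComodule

variable {k H A M N : Type*} [Field k] [AddCommGroup H] [Module k H] [CoquasiBialgebra k H]
  [AddCommGroup A] [Module k A] [ComoduleAlgebra k H A]
  [AddCommGroup M] [Module k M] [RelHopfModule k H A M]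
  [AddCommGroup N] [Module k N] [Module (coinvariants k H A)ᵐᵒᵖ N]
  [IsScalarTower k (coinvariants k H A)ᵐᵒᵖ N]

variable (k H A M) in
/-- `m ⊗_B a ↦ ma`. -/
def balAct : BalTensor k (coinvariants k H A) M A →ₗ[k] M :=
  BalTensor.lift (RelHopfModule.act H) fun m b a => act_act_mid m b.1 a b.2

variable (k) in
/-- `n ⊗_B a ↦ ι(n)a`. -/
def counitMap (ι : N →ₗ[(coinvariants k H A)ᵐᵒᵖ] M) :
    BalTensor k (coinvariants k H A) N A →ₗ[k] M :=
  balAct k H A M ∘ₗ BalTensor.mapLeft A ι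

theorem counitMap_tmul (ι : N →ₗ[(coinvariants k H A)ᵐᵒᵖ] M) (n : N) (a : A) :
    counitMap k ι (BalTensor.tmul k n a) = RelHopfModule.act H (ι n ⊗ₜ[k] a) := rfl

/-- Right multiplication of a coinvariant: `m(ab) = (ma)b`. -/
theorem act_act_left {m : M} (hm : m ∈ coinvariants k H M) (a b : A) :
    RelHopfModule.act H (RelHopfModule.act H (m ⊗ₜ[k] a) ⊗ₜ[k] b) =
      RelHopfModule.act H (m ⊗ₜ[k] ComoduleAlgebra.mul H (a ⊗ₜ[k] b)) := by
  rw [RelHopfModule.act_quasi_assoc, applyCoact_left m a b hm, TensorProduct.map_tmul,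
    LinearMap.id_apply]

variable (k H A M) in
/-- The coaction of the first factor of `M ⊗_B A`. -/
def balCoact : BalTensor k (coinvariants k H A) M A →ₗ[k]
    BalTensor k (coinvariants k H A) M A ⊗[k] H :=
  BalTensor.lift (TensorProduct.map (balancedRel k (coinvariants k H A) M A).mkQ LinearMap.id ∘ₗ
    mulCoact coact (trivCoact H A)) (by
    intro m b a
    simp only [LinearMap.comp_apply, mulCoact_trivCoact]
    have e : coact (MulOpposite.op b • m) = _ := coact_act_coinv m b.1 b.2
    rw [e]
    induction (coact m : M ⊗[k] H) with
    | zero => simp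
    | add x y hx hy => simp only [map_add, hx, hy]
    | tmul x h => exact congrArg (· ⊗ₜ[k] h) (BalTensor.balanced (k := k) x b a))

theorem balCoact_tmul (m : M) (a : A) : balCoact k H A M (BalTensor.tmul k m a) =
    TensorProduct.map (balancedRel k (coinvariants k H A) M A).mkQ LinearMap.id
      (mulCoact coact (trivCoact H A) (m ⊗ₜ[k] a)) := rfl

/-- Gives `M ⊗ H` a right `B`-action through the first factor. It is activated only locally: on a
free module over a Hopf module it would compete with the action through `A`. -/
theorem rightModule_smulCommClass : SMulCommClass k (coinvariants k H A)ᵐᵒᵖ M where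
  smul_comm r b m := by
    change r • RelHopfModule.act H (m ⊗ₜ[k] b.unop.1) = RelHopfModule.act H ((r • m) ⊗ₜ[k] b.unop.1)
    rw [← TensorProduct.smul_tmul', map_smul]

attribute [local instance] rightModule_smulCommClass

variable (k H A M) in
/-- `m ↦ m₀ ⊗ m₁ - m ⊗ 1`, whose kernel consists of the coinvariants. -/
def coinvDefect : M →ₗ[(coinvariants k H A)ᵐᵒᵖ] M ⊗[k] H where
  toFun m := coact m - m ⊗ₜ[k] (CoquasiBialgebra.one k : H)
  map_add' x y := by rw [map_add, TensorProduct.add_tmul]; abel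
  map_smul' b m := by
    have e : coact (b • m) = _ := coact_act_coinv m b.unop.1 b.unop.2
    rw [e, RingHom.id_apply, smul_sub]
    rfl

/-- The induced defect map is the defect of `balCoact` followed by the natural map `(M ⊗_B A) ⊗ H →
(M ⊗ H) ⊗_B A`, called `g` in the proof. -/
theorem mapLeft_coinvDefect_eq_zero {x : BalTensor k (coinvariants k H A) M A}
    (hx : balCoact k H A M x = x ⊗ₜ[k] (CoquasiBialgebra.one k : H)) :
    BalTensor.mapLeft A (coinvDefect k H A M) x = 0 := by
  set g : BalTensor k (coinvariants k H A) M A ⊗[k] H →ₗ[k]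
      BalTensor k (coinvariants k H A) (M ⊗[k] H) A := TensorProduct.lift (LinearMap.flip
    { toFun := fun h => BalTensor.mapLeft A
        { toFun := fun m => m ⊗ₜ[k] h
          map_add' := fun x y => TensorProduct.add_tmul x y h
          map_smul' := fun b m => rfl }
      map_add' := fun h h' => BalTensor.hom_ext fun m a => by
        change BalTensor.tmul k (m ⊗ₜ[k] (h + h')) a =
          BalTensor.tmul k (m ⊗ₜ[k] h) a + BalTensor.tmul k (m ⊗ₜ[k] h') a
        rw [TensorProduct.tmul_add, BalTensor.tmul, TensorProduct.add_tmul, map_add]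
        rfl
      map_smul' := fun r h => BalTensor.hom_ext fun m a => by
        change BalTensor.tmul k (m ⊗ₜ[k] (r • h)) a = r • BalTensor.tmul k (m ⊗ₜ[k] h) a
        rw [TensorProduct.tmul_smul, BalTensor.tmul, ← TensorProduct.smul_tmul', map_smul]
        rfl }) with hg
  have hgt : ∀ m a h, g (BalTensor.tmul k m a ⊗ₜ[k] h) = BalTensor.tmul k (m ⊗ₜ[k] h) a :=
    fun _ _ _ => rfl
  have key : ∀ x, BalTensor.mapLeft A (coinvDefect k H A M) x =
      g (balCoact k H A M x - x ⊗ₜ[k] (CoquasiBialgebra.one k : H)) := by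
    intro x
    induction x using BalTensor.induction with
    | h0 => simp
    | ha x y hx hy =>
      simp only [map_add, map_sub, TensorProduct.add_tmul, hx, hy]
      abel
    | ht m a =>
      rw [BalTensor.mapLeft_tmul, balCoact_tmul, map_sub, hgt, mulCoact_trivCoact]
      change BalTensor.tmul k (coact m - m ⊗ₜ[k] (CoquasiBialgebra.one k : H)) a = _
      rw [BalTensor.tmul, TensorProduct.sub_tmul, map_sub]
      congr 1
      induction (coact m : M ⊗[k] H) with
      | zero => simp
      | add x y hx hy => simp only [map_add, TensorProduct.add_tmul, hx, hy]
      | tmul x h => rfl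
  rw [key, hx, sub_self, map_zero]

end Counit

/-! ### Comparison of the counit with `can_M` -/

section CounitGalois

open RightComodule

variable {k H A M N : Type*} [Field k] [AddCommGroup H] [Module k H] [CoquasiHopfAlgebra k H]
  [AddCommGroup A] [Module k A] [ComoduleAlgebra k H A]
  [AddCommGroup M] [Module k M] [RelHopfModule k H A M]
  [AddCommGroup N] [Module k N] [Module (coinvariants k H A)ᵐᵒᵖ N]
  [IsScalarTower k (coinvariants k H A)ᵐᵒᵖ N]

/-- The associator is trivial on coinvariant `m`, and `a ↦ ma` is then colinear. As `betaCoact` is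
injective, questions about the counit become questions about `can_M`; both directions of (a) use
this. -/
theorem canMap_mapLeft_coinvariant {ι : N →ₗ[(coinvariants k H A)ᵐᵒᵖ] M}
    (hι : ∀ n, ι n ∈ coinvariants k H M) (x : BalTensor k (coinvariants k H A) N A) :
    canMap k H A M (BalTensor.mapLeft A ι x) = betaCoact coact (counitMap k ι x) := by
  induction x using BalTensor.induction with
  | h0 => simp
  | ha x y hx hy => simp only [map_add, hx, hy]
  | ht n a => exact canPre_coinvariant (hι n) a

theorem colinear_canMap (x : BalTensor k (coinvariants k H A) M A) :
    mulCoact coact (antipodeCoact k H) (canMap k H A M x) =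
      TensorProduct.map (canMap k H A M) LinearMap.id (balCoact k H A M x) := by
  induction x using BalTensor.induction with
  | h0 => simp
  | ha x y hx hy => simp only [map_add, hx, hy]
  | ht m a =>
    rw [balCoact_tmul, TensorProduct.map_map, LinearMap.id_comp]
    exact colinear_canPre.apply (m ⊗ₜ[k] a)

end CounitGalois

/-! ### Bijectivity of the counit for faithfully flat Galois extensions -/

section CounitFlat

open RightComodule

variable {k H A M N : Type u} [Field k] [AddCommGroup H] [Module k H] [CoquasiHopfAlgebra k H]
  [AddCommGroup A] [Module k A] [ComoduleAlgebra k H A]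
  [AddCommGroup M] [Module k M] [RelHopfModule k H A M]
  [AddCommGroup N] [Module k N] [Module (coinvariants k H A)ᵐᵒᵖ N]
  [IsScalarTower k (coinvariants k H A)ᵐᵒᵖ N]

attribute [local instance] rightModule_smulCommClass

/-- If `A` is a faithfully flat Galois extension, then `M^{co H} ⊗_B A → M` is bijective. -/
theorem counitMap_bijective (hF : LeftFaithfullyFlat k (coinvariants k H A) A)
    (hG : IsGaloisExtension k H A) {ι : N →ₗ[(coinvariants k H A)ᵐᵒᵖ] M}
    (hinj : Function.Injective ι) (hι : ∀ m, m ∈ Set.range ι ↔ m ∈ coinvariants k H M) :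
    Function.Bijective (counitMap k ι) := by
  have hι' : ∀ n, ι n ∈ coinvariants k H M := fun n => (hι _).1 ⟨n, rfl⟩
  have hc := canMap_bijective M hG
  have hb := betaCoact_injective (isCoaction_coact : IsCoaction (coact : M →ₗ[k] M ⊗[k] H))
  constructor
  · intro x y hxy
    refine (hF.injective_iff ι).1 hinj (hc.1 ?_)
    rw [canMap_mapLeft_coinvariant hι', canMap_mapLeft_coinvariant hι', hxy]
  · intro m
    obtain ⟨y, hy⟩ := hc.2 (betaCoact coact m)
    -- The map `can_M` is bijective and colinear, and its value at `y` is coinvariant in `M ⊗ H^S`,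
    -- so `y` is coinvariant too.
    have h1 : balCoact k H A M y = y ⊗ₜ[k] (CoquasiBialgebra.one k : H) := by
      have hci : Function.Injective (TensorProduct.map (canMap k H A M)
          (LinearMap.id : H →ₗ[k] H)) :=
        (TensorProduct.congr (LinearEquiv.ofBijective _ hc) (LinearEquiv.refl k H)).injective
      apply hci
      rw [← colinear_canMap, hy, mulCoact_betaCoact isCoaction_coact, TensorProduct.map_tmul, hy,
        LinearMap.id_apply]
    have hex : Function.Exact ι (coinvDefect k H A M) := fun m => by
      rw [hι]
      exact sub_eq_zero
    -- Tensoring the exact sequence `N → M → M ⊗ H` with `A` over `B` stays exact, so the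
    -- coinvariant `y` comes from `N ⊗_B A`.
    obtain ⟨z, rfl⟩ := ((hF.exact_iff ι (coinvDefect k H A M)).1 hex y).1
      (mapLeft_coinvDefect_eq_zero h1)
    refine ⟨z, hb ?_⟩
    rw [← canMap_mapLeft_coinvariant hι', hy]

end CounitFlat


/-! ## The adjunction between induction and coinvariants -/

section Unit

open RightComodule

variable {k H A N : Type*} [Field k] [AddCommGroup H] [Module k H] [CoquasiBialgebra k H]
  [AddCommGroup A] [Module k A] [ComoduleAlgebra k H A]
  [AddCommGroup N] [Module k N] [Module (coinvariants k H A)ᵐᵒᵖ N]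

variable (k H A N) in
/-- `n ↦ n ⊗_B 1`. -/
def unitMap : N →ₗ[(coinvariants k H A)ᵐᵒᵖ]
    coinvariantsB k H A (BalTensor k (coinvariants k H A) N A) where
  toFun n := ⟨BalTensor.tmul k n (ComoduleAlgebra.one k H), by
    refine (inducedCoact_tmul n _).trans ?_
    rw [ComoduleAlgebra.coact_one]
    rfl⟩
  map_add' x y := Subtype.ext (by
    change BalTensor.tmul k (x + y) _ = BalTensor.tmul k x _ + BalTensor.tmul k y _
    rw [BalTensor.tmul, TensorProduct.add_tmul, map_add]
    rfl)
  map_smul' b n := Subtype.ext (by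
    change BalTensor.tmul k (MulOpposite.op b.unop • n) (ComoduleAlgebra.one k H) =
      BalTensor.tmul k n (ComoduleAlgebra.mul H (ComoduleAlgebra.one k H ⊗ₜ[k] b.unop.1))
    rw [BalTensor.balanced, ComoduleAlgebra.one_mul, coinv_smul_def, ComoduleAlgebra.mul_one])

theorem unitMap_coe (n : N) : (unitMap k H A N n : BalTensor k (coinvariants k H A) N A) =
    BalTensor.tmul k n (ComoduleAlgebra.one k H) := rfl

end Unit

section CounitMap

open RightComodule

variable {k H A M N : Type*} [Field k] [AddCommGroup H] [Module k H] [CoquasiHopfAlgebra k H]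
  [AddCommGroup A] [Module k A] [ComoduleAlgebra k H A]
  [AddCommGroup M] [Module k M] [RelHopfModule k H A M]
  [AddCommGroup N] [Module k N] [Module (coinvariants k H A)ᵐᵒᵖ N]
  [IsScalarTower k (coinvariants k H A)ᵐᵒᵖ N] {ι : N →ₗ[(coinvariants k H A)ᵐᵒᵖ] M}

theorem counitMap_colinear (hι : ∀ n, ι n ∈ coinvariants k H M)
    (v : BalTensor k (coinvariants k H A) N A) :
    coact (counitMap k ι v) =
      TensorProduct.map (counitMap k ι) LinearMap.id (inducedCoact k H A N v) := by
  induction v using BalTensor.induction with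
  | h0 => simp
  | ha x y hx hy => simp only [map_add, hx, hy]
  | ht n a =>
    rw [inducedCoact_tmul, TensorProduct.map_map]
    exact (act_coinvariant_colinear (A := A) (hι n)).apply a

theorem counitMap_act (hι : ∀ n, ι n ∈ coinvariants k H M)
    (v : BalTensor k (coinvariants k H A) N A) (a : A) :
    counitMap k ι (inducedAct k H A N (v ⊗ₜ[k] a)) =
      RelHopfModule.act H (counitMap k ι v ⊗ₜ[k] a) := by
  induction v using BalTensor.induction with
  | h0 => simp
  | ha x y hx hy => simp only [map_add, TensorProduct.add_tmul, hx, hy]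
  | ht n b => exact (act_act_left (hι n) b a).symm

end CounitMap

/-! ### Isomorphisms of Hopf modules, the adjunction and the equivalence -/

section Adjunction

open RightComodule
open scoped ModuleCat

variable {k H A : Type u} [Field k] [AddCommGroup H] [Module k H] [CoquasiHopfAlgebra k H]
  [AddCommGroup A] [Module k A] [ComoduleAlgebra k H A]

theorem isIso_of_bijective {M N : HopfModuleCat k H A} (f : M ⟶ N)
    (hf : Function.Bijective (HopfModuleHom.hom f)) : IsIso f := by
  set e := LinearEquiv.ofBijective (HopfModuleHom.hom f) hf with he
  have hl : e.symm.toLinearMap ∘ₗ HopfModuleHom.hom f = LinearMap.id :=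
    LinearMap.ext fun x => e.symm_apply_apply x
  have hr : HopfModuleHom.hom f ∘ₗ e.symm.toLinearMap = LinearMap.id :=
    LinearMap.ext fun x => e.apply_symm_apply x
  have hc : Colinear (coact : M.carrier →ₗ[k] M.carrier ⊗[k] H) coact (HopfModuleHom.hom f) :=
    LinearMap.ext f.colinear
  refine ⟨⟨⟨e.symm.toLinearMap, fun m => (hc.of_inverse hl hr).apply m, fun m a => ?_⟩,
    HopfModuleHom.ext hl, HopfModuleHom.ext hr⟩⟩
  apply hf.1
  refine (LinearMap.congr_fun hr _).trans ?_
  rw [f.map_act]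
  exact congrArg (fun x => RelHopfModule.act H (x ⊗ₜ[k] a)) (LinearMap.congr_fun hr m).symm

theorem bijective_of_isIso {M N : HopfModuleCat k H A} (f : M ⟶ N) [IsIso f] :
    Function.Bijective (HopfModuleHom.hom f) := by
  refine Function.bijective_iff_has_inverse.mpr ⟨HopfModuleHom.hom (inv f), fun x => ?_, fun x => ?_⟩
  · exact LinearMap.congr_fun (congrArg HopfModuleHom.hom (IsIso.hom_inv_id f)) x
  · exact LinearMap.congr_fun (congrArg HopfModuleHom.hom (IsIso.inv_hom_id f)) x

/-- The inclusion of the coinvariants. -/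
def coinvInclusion (M : HopfModuleCat k H A) :
    ((coinvFunctor k H A).obj M) →ₗ[(coinvariants k H A)ᵐᵒᵖ] M.carrier :=
  (coinvariantsB k H A M.carrier).subtype

theorem coinvInclusion_mem (M : HopfModuleCat k H A) (m : (coinvFunctor k H A).obj M) :
    coinvInclusion M m ∈ coinvariants k H M.carrier := m.2

/-- The counit of the adjunction. -/
def counitHom (M : HopfModuleCat k H A) :
    (inductionFunctor k H A).obj ((coinvFunctor k H A).obj M) ⟶ M where
  hom := counitMap k (coinvInclusion M)
  colinear v := counitMap_colinear (coinvInclusion_mem M) v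
  map_act v a := counitMap_act (coinvInclusion_mem M) v a

variable (k H A) in
/-- Induction is left adjoint to taking coinvariants. -/
def inductionAdjunction : inductionFunctor k H A ⊣ coinvFunctor k H A :=
  Adjunction.mkOfUnitCounit
    { unit :=
        { app := fun N => ModuleCat.ofHom (unitMap k H A N)
          naturality := fun N N' f => by
            ext n
            rfl }
      counit :=
        { app := fun M => counitHom M
          naturality := fun M M' f => by
            refine HopfModuleHom.ext (BalTensor.hom_ext fun m a => ?_)
            exact (f.map_act (coinvInclusion M m) a).symm }
      left_triangle := by
        ext N
        refine HopfModuleHom.ext (BalTensor.hom_ext fun n a => ?_)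
        change BalTensor.tmul k n (ComoduleAlgebra.mul H (ComoduleAlgebra.one k H ⊗ₜ[k] a)) =
          BalTensor.tmul k n a
        rw [ComoduleAlgebra.one_mul]
      right_triangle := by
        ext M m
        exact Subtype.ext (RelHopfModule.act_one (coinvInclusion M m)) }

/-- A faithfully flat Galois extension gives an equivalence. -/
theorem exists_equivalence (hF : LeftFaithfullyFlat k (coinvariants k H A) A)
    (hG : IsGaloisExtension k H A) :
    ∃ e : HopfModuleCat k H A ≌ ModuleCat.{u} (coinvariants k H A)ᵐᵒᵖ,
      e.functor = coinvFunctor k H A ∧ e.inverse = inductionFunctor k H A := by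
  have hc : ∀ M : HopfModuleCat k H A, Function.Bijective (counitMap k (coinvInclusion M)) :=
    fun M => counitMap_bijective hF hG Subtype.val_injective fun m =>
      ⟨fun ⟨n, hn⟩ => hn ▸ coinvInclusion_mem M n, fun hm => ⟨⟨m, hm⟩, rfl⟩⟩
  have i1 : ∀ M, IsIso ((inductionAdjunction k H A).counit.app M) := fun M =>
    isIso_of_bijective (counitHom M) (hc M)
  have i2 : ∀ N, IsIso ((inductionAdjunction k H A).unit.app N) := by
    intro N
    rw [ConcreteCategory.isIso_iff_bijective]
    set u := ((inductionAdjunction k H A).unit.app N).hom with hu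
    -- By the triangle identity the induced unit is a section of a bijective counit, hence
    -- bijective. Faithful flatness then reflects this back to the unit.
    have ht : counitMap k (coinvInclusion ((inductionFunctor k H A).obj N)) ∘
        BalTensor.mapLeft (k := k) A u = id := by
      have := (inductionAdjunction k H A).left_triangle_components N
      exact congrArg (fun f => (HopfModuleHom.hom f : _ → _)) this
    have hb : Function.Bijective (BalTensor.mapLeft (k := k) A u) := by
      have h2 := hc ((inductionFunctor k H A).obj N)
      refine (Function.Bijective.of_comp_iff' h2 _).1 ?_
      rw [ht]
      exact Function.bijective_id
    exact ⟨(hF.injective_iff u).2 hb.1, (hF.surjective_iff u).2 hb.2⟩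
  exact ⟨(inductionAdjunction k H A).toEquivalence.symm, rfl, rfl⟩

/-- If the coinvariants are part of an equivalence, then the unit and the counit of the adjunction
are bijective. -/
theorem unit_counit_bijective [(coinvFunctor k H A).IsEquivalence] :
    (∀ M : HopfModuleCat k H A, Function.Bijective (counitMap k (coinvInclusion M))) ∧
      ∀ N : ModuleCat.{u} (coinvariants k H A)ᵐᵒᵖ, Function.Bijective (unitMap k H A N) := by
  refine ⟨fun M => ?_, fun N => ?_⟩
  -- In any adjunction whose right adjoint is an equivalence, unit and counit are isomorphisms. Thus
  -- it does not matter which natural isomorphisms the given equivalence carries.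
  · exact bijective_of_isIso ((inductionAdjunction k H A).counit.app M)
  · exact (ConcreteCategory.isIso_iff_bijective ((inductionAdjunction k H A).unit.app N)).1
      inferInstance

end Adjunction


/-! ## Kernels of morphisms of relative Hopf modules -/

section Kernel

open RightComodule
open scoped ModuleCat

/-- Over a field `- ⊗ H` is exact, so the coaction sends the kernel into `ker F ⊗ H`. The coaction
axioms are obtained afterwards by restriction along the inclusion. -/
theorem exists_kernel_coaction {k H M N : Type*} [Field k] [AddCommGroup H] [Module k H]
    [AddCommGroup M] [Module k M] [AddCommGroup N] [Module k N] {σ : M →ₗ[k] M ⊗[k] H}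
    {τ : N →ₗ[k] N ⊗[k] H} {F : M →ₗ[k] N} (hF : Colinear σ τ F) :
    ∃ ρ : LinearMap.ker F →ₗ[k] LinearMap.ker F ⊗[k] H,
      Colinear ρ σ (LinearMap.ker F).subtype := by
  obtain ⟨g, hg⟩ := (LinearMap.ker F).subtype.exists_leftInverse_of_injective
    (Submodule.ker_subtype _)
  -- Any linear retraction `g` onto the kernel will do, since it is only applied to elements already
  -- in `ker F ⊗ H`.
  refine ⟨TensorProduct.map g LinearMap.id ∘ₗ σ ∘ₗ (LinearMap.ker F).subtype, ?_⟩
  refine LinearMap.ext fun x => ?_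
  have hex : Function.Exact (TensorProduct.map (LinearMap.ker F).subtype (LinearMap.id : H →ₗ[k] H))
      (TensorProduct.map F LinearMap.id) :=
    Module.Flat.rTensor_exact H (LinearMap.exact_subtype_ker_map F)
  obtain ⟨w, hw⟩ := (hex (σ x)).1 (by
    rw [← hF.apply, LinearMap.mem_ker.1 x.2, map_zero])
  change σ x = TensorProduct.map _ _ (TensorProduct.map g LinearMap.id (σ x))
  rw [← hw, TensorProduct.map_map, TensorProduct.map_map]
  rw [LinearMap.comp_assoc, hg]
  rfl

section

variable {k H A M K : Type*} [Field k] [AddCommGroup H] [Module k H] [CoquasiBialgebra k H]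
  [AddCommGroup A] [Module k A] [ComoduleAlgebra k H A]
  [AddCommGroup M] [Module k M] [RelHopfModule k H A M] [AddCommGroup K] [Module k K]

theorem map_id_injective {k V W X : Type*} [Field k] [AddCommGroup V] [Module k V]
    [AddCommGroup W] [Module k W] [AddCommGroup X] [Module k X] {f : V →ₗ[k] W}
    (hf : Function.Injective f) :
    Function.Injective (TensorProduct.map f (LinearMap.id : X →ₗ[k] X)) := by
  obtain ⟨g, hg⟩ := f.exists_leftInverse_of_injective (LinearMap.ker_eq_bot.2 hf)
  refine Function.LeftInverse.injective (g := TensorProduct.map g LinearMap.id) fun x => ?_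
  rw [TensorProduct.map_map, hg, LinearMap.id_comp, TensorProduct.map_id, LinearMap.id_apply]

theorem IsCoaction.of_injective {ρ : K →ₗ[k] K ⊗[k] H} {σ : M →ₗ[k] M ⊗[k] H}
    (hσ : IsCoaction σ) {ι : K →ₗ[k] M} (hι : Function.Injective ι) (h : Colinear ρ σ ι) :
    IsCoaction ρ where
  coassoc v := by
    apply map_id_injective hι
    have e1 : ∀ x : K ⊗[k] H, TensorProduct.map ι LinearMap.id
        (TensorProduct.assoc k K H H (TensorProduct.map ρ LinearMap.id x)) =
        TensorProduct.assoc k M H H (TensorProduct.map σ LinearMap.id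
          (TensorProduct.map ι LinearMap.id x)) := by
      intro x
      induction x with
      | zero => simp only [map_zero]
      | add x y hx hy => simp only [map_add, hx, hy]
      | tmul x y =>
        simp only [TensorProduct.map_tmul, h.apply, LinearMap.id_apply]
        induction ρ x with
        | zero => simp only [TensorProduct.zero_tmul, map_zero]
        | add x y hx hy => simp only [TensorProduct.add_tmul, map_add, hx, hy]
        | tmul x y => rfl
    rw [e1, ← h.apply, hσ.coassoc, h.apply, TensorProduct.map_map, TensorProduct.map_map]
    rfl
  counit v := by
    apply hι
    refine Eq.trans ?_ (hσ.counit (ι v))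
    rw [h.apply]
    induction ρ v with
    | zero => simp
    | add x y hx hy => simp only [map_add, hx, hy]
    | tmul x y => simp

/-- The structure of a relative Hopf module on a subspace that is stable under the coaction and
the action. -/
@[reducible]
def RelHopfModule.ofInjective {ι : K →ₗ[k] M} (hι : Function.Injective ι) (ρ : K →ₗ[k] K ⊗[k] H)
    (h : Colinear ρ coact ι) (act : K ⊗[k] A →ₗ[k] K)
    (hact : ∀ x a, ι (act (x ⊗ₜ[k] a)) = RelHopfModule.act H (ι x ⊗ₜ[k] a)) :
    RelHopfModule k H A K where
  coact := ρ
  coact_coassoc := (isCoaction_coact.of_injective hι h).coassoc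
  coact_counit := (isCoaction_coact.of_injective hι h).counit
  act := act
  coact_act m a := by
    have hact' : ι ∘ₗ act = RelHopfModule.act H ∘ₗ TensorProduct.map ι LinearMap.id :=
      TensorProduct.ext' hact
    apply map_id_injective hι
    have e := (h.prod (Colinear.id (coact : A →ₗ[k] A ⊗[k] H))).apply (m ⊗ₜ[k] a)
    rw [← h.apply, hact, RelHopfModule.coact_act, TensorProduct.map_map, hact',
      LinearMap.id_comp, ← LinearMap.comp_id CoquasiBialgebra.mul.toLinearMap,
      ← TensorProduct.map_map, ← e]
    rfl
  act_one m := by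
    apply hι
    rw [hact, RelHopfModule.act_one]
  act_quasi_assoc m a b := by
    have hact' : ∀ x, ι (act x) = RelHopfModule.act H (TensorProduct.map ι LinearMap.id x) :=
      LinearMap.congr_fun (TensorProduct.ext' hact :
        ι ∘ₗ act = RelHopfModule.act H ∘ₗ TensorProduct.map ι LinearMap.id)
    apply hι
    have e := (h.prod ((Colinear.id (coact : A →ₗ[k] A ⊗[k] H)).prod (Colinear.id
      (coact : A →ₗ[k] A ⊗[k] H)))).applyCoact (CoquasiBialgebra.ω (k := k) (H := H))
        (m ⊗ₜ[k] (a ⊗ₜ[k] b))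
    rw [hact, hact, RelHopfModule.act_quasi_assoc, hact', TensorProduct.map_map]
    refine congrArg (RelHopfModule.act H) ?_
    rw [TensorProduct.map_id] at e
    refine (congrArg (TensorProduct.map LinearMap.id (ComoduleAlgebra.mul H)) e).trans ?_
    rw [TensorProduct.map_map]
    rfl

end

variable {k H A : Type u} [Field k] [AddCommGroup H] [Module k H] [CoquasiHopfAlgebra k H]
  [AddCommGroup A] [Module k A] [ComoduleAlgebra k H A]

/-- If every relative Hopf module is generated by its coinvariants, then a morphism that is
injective on coinvariants is injective. -/
theorem injective_of_coinvariants
    (hc : ∀ M : HopfModuleCat k H A, Function.Surjective (counitMap k (coinvInclusion M)))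
    {M N : HopfModuleCat k H A} (F : M ⟶ N)
    (hF : ∀ m ∈ coinvariants k H M.carrier, HopfModuleHom.hom F m = 0 → m = 0) :
    Function.Injective (HopfModuleHom.hom F) := by
  have hcol : Colinear (coact : M.carrier →ₗ[k] M.carrier ⊗[k] H) coact (HopfModuleHom.hom F) :=
    LinearMap.ext F.colinear
  set K := LinearMap.ker (HopfModuleHom.hom F) with hK
  obtain ⟨ρ, hρ⟩ : ∃ ρ : K →ₗ[k] K ⊗[k] H, Colinear ρ coact K.subtype :=
    exists_kernel_coaction hcol
  set aK : K ⊗[k] A →ₗ[k] K := LinearMap.codRestrict K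
    (RelHopfModule.act H ∘ₗ TensorProduct.map K.subtype LinearMap.id) (fun x => by
      induction x with
      | zero => simp
      | add x y hx hy => rw [map_add]; exact K.add_mem hx hy
      | tmul x a =>
        refine LinearMap.mem_ker.2 ((F.map_act _ _).trans ?_)
        have := LinearMap.mem_ker.1 x.2
        rw [Submodule.subtype_apply, this, TensorProduct.zero_tmul, map_zero])
  let _ : RelHopfModule k H A K := RelHopfModule.ofInjective (ι := K.subtype)
    Subtype.val_injective ρ hρ aK fun x a => rfl
  -- Coinvariants of the kernel are coinvariants of `M` killed by `F`, hence zero. So the counit of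
  -- `K` is zero as well as surjective.
  have hz : ∀ v, counitMap k (coinvInclusion (HopfModuleCat.mk (k := k) (H := H) (A := A) K)) v =
      0 := by
    intro v
    have e : counitMap k (coinvInclusion (HopfModuleCat.mk (k := k) (H := H) (A := A) K)) = 0 := by
      refine BalTensor.hom_ext fun n a => ?_
      have hn : coinvInclusion (HopfModuleCat.mk (k := k) (H := H) (A := A) K) n = 0 := by
        set x : K := coinvInclusion (HopfModuleCat.mk (k := k) (H := H) (A := A) K) n
        have hx : ρ x = x ⊗ₜ[k] (CoquasiBialgebra.one k : H) :=
          coinvInclusion_mem (HopfModuleCat.mk (k := k) (H := H) (A := A) K) n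
        refine Subtype.ext (hF x.1 ?_ x.2)
        refine (hρ.apply x).trans ?_
        rw [hx]
        rfl
      rw [counitMap_tmul, hn, TensorProduct.zero_tmul, map_zero]
      rfl
    rw [e]
    rfl
  refine (injective_iff_map_eq_zero _).2 fun m hm => ?_
  obtain ⟨v, hv⟩ := hc (HopfModuleCat.mk (k := k) (H := H) (A := A) K) ⟨m, hm⟩
  rw [hz] at hv
  exact (congrArg Subtype.val hv).symm

end Kernel

/-! ## Right exactness of the tensor product and faithful flatness -/

section RightExact

variable {k B N₁ N₂ N₃ A : Type*} [Field k] [Ring B] [Algebra k B]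
  [AddCommGroup N₁] [Module k N₁] [Module Bᵐᵒᵖ N₁] [IsScalarTower k Bᵐᵒᵖ N₁]
  [AddCommGroup N₂] [Module k N₂] [Module Bᵐᵒᵖ N₂] [IsScalarTower k Bᵐᵒᵖ N₂]
  [AddCommGroup N₃] [Module k N₃] [Module Bᵐᵒᵖ N₃] [IsScalarTower k Bᵐᵒᵖ N₃]
  [AddCommGroup A] [Module k A] [Module B A]

/-- Right exactness over `k` descends to the balanced quotients because the balancing relations lift
along a surjective `g`. -/
theorem BalTensor.mapLeft_exact {f : N₁ →ₗ[Bᵐᵒᵖ] N₂} {g : N₂ →ₗ[Bᵐᵒᵖ] N₃}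
    (h : Function.Exact f g) (hg : Function.Surjective g) :
    Function.Exact (BalTensor.mapLeft (k := k) A f) (BalTensor.mapLeft (k := k) A g) := by
  have hex : Function.Exact (TensorProduct.map (f.restrictScalars k) (LinearMap.id : A →ₗ[k] A))
      (TensorProduct.map (g.restrictScalars k) (LinearMap.id : A →ₗ[k] A)) :=
    rTensor_exact A (f := f.restrictScalars k) (g := g.restrictScalars k) h hg
  have hmk : ∀ x : N₂ ⊗[k] A, BalTensor.mapLeft A g ((balancedRel k B N₂ A).mkQ x) =
      (balancedRel k B N₃ A).mkQ (TensorProduct.map (g.restrictScalars k) LinearMap.id x) :=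
    fun x => rfl
  intro y
  constructor
  · intro hy
    obtain ⟨y, rfl⟩ := Submodule.mkQ_surjective _ y
    rw [hmk, Submodule.mkQ_apply, Submodule.Quotient.mk_eq_zero] at hy
    have hle : balancedRel k B N₃ A ≤ (balancedRel k B N₂ A).map
        (TensorProduct.map (g.restrictScalars k) LinearMap.id) := by
      rw [balancedRel, Submodule.span_le]
      rintro _ ⟨n, b, a, rfl⟩
      obtain ⟨n, rfl⟩ := hg n
      refine ⟨_, Submodule.subset_span ⟨n, b, a, rfl⟩, ?_⟩
      rw [map_sub, TensorProduct.map_tmul, TensorProduct.map_tmul]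
      change g _ ⊗ₜ[k] _ - _ = _
      rw [map_smul]
      rfl
    obtain ⟨r, hr, hry⟩ := hle hy
    obtain ⟨z, hz⟩ := (hex (y - r)).1 (by rw [map_sub, hry, sub_self])
    refine ⟨(balancedRel k B N₁ A).mkQ z, ?_⟩
    change (balancedRel k B N₂ A).mkQ (TensorProduct.map (f.restrictScalars k) LinearMap.id z) = _
    rw [hz, map_sub, sub_eq_self, Submodule.mkQ_apply, Submodule.Quotient.mk_eq_zero]
    exact hr
  · rintro ⟨x, rfl⟩
    rw [BalTensor.mapLeft_mapLeft]
    have : g ∘ₗ f = 0 := LinearMap.ext fun n => (h (f n)).2 ⟨n, rfl⟩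
    rw [this, BalTensor.mapLeft_zero]

end RightExact

/-! ### Faithful flatness from the unit and the counit -/

section FaithfullyFlat

open scoped ModuleCat

variable {k H A : Type u} [Field k] [AddCommGroup H] [Module k H] [CoquasiHopfAlgebra k H]
  [AddCommGroup A] [Module k A] [ComoduleAlgebra k H A]

/-- If the unit and the counit of the adjunction are bijective, then `A` is faithfully flat over
its coinvariants. -/
theorem leftFaithfullyFlat_of_unit_counit
    (hc : ∀ M : HopfModuleCat k H A, Function.Bijective (counitMap k (coinvInclusion M)))
    (hu : ∀ N : ModuleCat.{u} (coinvariants k H A)ᵐᵒᵖ, Function.Bijective (unitMap k H A N)) :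
    LeftFaithfullyFlat k (coinvariants k H A) A := by
  have hone : ∀ (N : ModuleCat.{u} (coinvariants k H A)ᵐᵒᵖ) (n : N),
      BalTensor.tmul k n (ComoduleAlgebra.one k H : A) = 0 → n = 0 := fun N n hn =>
    (hu N).1 (Subtype.ext (by rw [unitMap_coe, hn, map_zero]; rfl))
  have hinj : ∀ {N N' : ModuleCat.{u} (coinvariants k H A)ᵐᵒᵖ} (f : N ⟶ N'),
      Function.Injective f.hom → Function.Injective (BalTensor.mapLeft (k := k) A f.hom) := by
    intro N N' f hf
    -- The coinvariants of `N ⊗_B A` are the elements `n ⊗ 1`, by surjectivity of the unit. On these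
    -- the induced map is `f` itself, by injectivity of the unit.
    refine injective_of_coinvariants (fun M => (hc M).2) ((inductionFunctor k H A).map f)
      fun m hm h0 => ?_
    obtain ⟨n, hn⟩ := (hu N).2 ⟨m, hm⟩
    obtain rfl : BalTensor.tmul k n (ComoduleAlgebra.one k H) = m := congrArg Subtype.val hn
    have h1 : f.hom n = 0 := hone N' _ h0
    have h2 : n = 0 := hf (by rw [h1, map_zero])
    rw [h2, BalTensor.tmul, TensorProduct.zero_tmul, map_zero]
    rfl
  intro N₁ N₂ N₃ f g
  constructor
  · intro h
    -- Factoring `g` through its image reduces exactness to right exactness and preservation of the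
    -- injection of the image.
    set g' : N₂ ⟶ ModuleCat.of _ (LinearMap.range g.hom) := ModuleCat.ofHom g.hom.rangeRestrict
    set i : ModuleCat.of _ (LinearMap.range g.hom) ⟶ N₃ :=
      ModuleCat.ofHom (LinearMap.range g.hom).subtype
    have he : Function.Exact f.hom g'.hom := fun x => by
      rw [← h x]
      exact Subtype.ext_iff
    have h2 := BalTensor.mapLeft_exact (k := k) (A := A) he g.hom.surjective_rangeRestrict
    intro x
    rw [← h2 x]
    have e : BalTensor.mapLeft (k := k) A g.hom x =
        BalTensor.mapLeft A i.hom (BalTensor.mapLeft A g'.hom x) :=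
      (BalTensor.mapLeft_mapLeft i.hom g'.hom x).symm
    rw [e]
    exact map_eq_zero_iff _ (hinj i Subtype.val_injective)
  · intro h
    have hgf : ∀ n, g.hom (f.hom n) = 0 := fun n =>
      hone N₃ _ ((h (BalTensor.tmul k (f.hom n) (ComoduleAlgebra.one k H))).2
        ⟨BalTensor.tmul k n (ComoduleAlgebra.one k H), rfl⟩)
    intro n
    refine ⟨fun hn => ?_, ?_⟩
    -- To show that `n` in the kernel of `g` lies in the image of `f`, it is tested in the cokernel
    -- `Q`. There `n ⊗ 1` vanishes because it lies in the image of `f ⊗_B A`, so `n` vanishes by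
    -- `hone`.
    · set Q : ModuleCat.{u} (coinvariants k H A)ᵐᵒᵖ :=
        ModuleCat.of _ (N₂ ⧸ LinearMap.range f.hom) with hQ
      set p : N₂ ⟶ Q := ModuleCat.ofHom (LinearMap.range f.hom).mkQ with hp
      set q : Q ⟶ N₃ := ModuleCat.ofHom ((LinearMap.range f.hom).liftQ g.hom (by
        rintro _ ⟨n, rfl⟩
        exact hgf n)) with hq
      have hps : Function.Surjective p.hom := Submodule.mkQ_surjective _
      have he : Function.Exact f.hom p.hom := fun x =>
        (Submodule.Quotient.mk_eq_zero _).trans Iff.rfl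
      have h2 := BalTensor.mapLeft_exact (k := k) (A := A) he hps
      obtain ⟨x, hx⟩ : BalTensor.tmul k n (ComoduleAlgebra.one k H : A) ∈
          Set.range (BalTensor.mapLeft (k := k) A f.hom) := (h _).1 (by
        rw [BalTensor.mapLeft_tmul, hn, BalTensor.tmul, TensorProduct.zero_tmul, map_zero])
      have h3 : p.hom n = 0 := hone Q _ ((h2 _).2 ⟨x, hx⟩)
      exact (he n).1 h3
    · rintro ⟨m, rfl⟩
      exact hgf m

end FaithfullyFlat


/-! ## Generation by coinvariants implies the Galois property -/

section Pairing

open CoquasiBialgebra CoquasiHopfAlgebra RightComodule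

variable {k H V W : Type*} [Field k] [AddCommGroup H] [Module k H]
  [AddCommGroup V] [Module k V] [AddCommGroup W] [Module k W]
  {ρ : V →ₗ[k] V ⊗[k] H} {σ : W →ₗ[k] W ⊗[k] H}

/-- `v ↦ s(v₁) ⊗ v₀`. -/
def coactLeft (s : H →ₗ[k] H) (ρ : V →ₗ[k] V ⊗[k] H) : V →ₗ[k] H ⊗[k] V :=
  (TensorProduct.comm k V H).toLinearMap ∘ₗ push s ρ

/-- `h ⊗ v ↦ ξ(h, v₁) v₀`. -/
def pairCoact (ξ : H ⊗[k] H →ₗ[k] k) (ρ : V →ₗ[k] V ⊗[k] H) : H ⊗[k] V →ₗ[k] V :=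
  (TensorProduct.rid k V).toLinearMap ∘ₗ TensorProduct.map LinearMap.id ξ ∘ₗ
    (TensorProduct.leftComm k H V H).toLinearMap ∘ₗ TensorProduct.map LinearMap.id ρ

theorem Colinear.coactLeft {F : V →ₗ[k] W} (hF : Colinear ρ σ F) (s : H →ₗ[k] H) (v : V) :
    coactLeft s σ (F v) = TensorProduct.map LinearMap.id F (coactLeft s ρ v) := by
  change TensorProduct.comm k W H (TensorProduct.map LinearMap.id s (σ (F v))) =
    TensorProduct.map LinearMap.id F
      (TensorProduct.comm k V H (TensorProduct.map LinearMap.id s (ρ v)))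
  rw [hF.apply]
  induction ρ v with
  | zero => simp
  | add x y hx hy => simp only [map_add, hx, hy]
  | tmul x y => simp

theorem Colinear.pairCoact {F : V →ₗ[k] W} (hF : Colinear ρ σ F) (ξ : H ⊗[k] H →ₗ[k] k)
    (x : H ⊗[k] V) :
    pairCoact ξ σ (TensorProduct.map LinearMap.id F x) = F (pairCoact ξ ρ x) := by
  induction x with
  | zero => simp
  | add x y hx hy => simp only [map_add, hx, hy]
  | tmul h v =>
    simp only [CoquasiHopf.pairCoact, LinearMap.comp_apply, TensorProduct.map_tmul,
      LinearMap.id_apply, hF.apply]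
    induction ρ v with
    | zero => simp
    | add x y hx hy => simp only [map_add, TensorProduct.tmul_add, hx, hy]
    | tmul x y => simp

/-- The composite is `v ↦ ξ(s(v₂), v₁) v₀`, and the condition on `ξ` and `s` is `ξ(s(h₂), h₁) =
ε(h)`. -/
theorem pairCoact_coactLeft [Coalgebra k H] (hρ : IsCoaction ρ) {ξ : H ⊗[k] H →ₗ[k] k}
    {s : H →ₗ[k] H} (hξ : ∀ h : H, ξ (TensorProduct.comm k H H (TensorProduct.map LinearMap.id s
      (Coalgebra.comul h))) = Coalgebra.counit (R := k) h) (v : V) :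
    pairCoact ξ ρ (coactLeft s ρ v) = v := by
  have e := congrArg (fun x => TensorProduct.rid k V (TensorProduct.map LinearMap.id
    (ξ ∘ₗ (TensorProduct.comm k H H).toLinearMap) x)) (hρ.push_comul LinearMap.id s v)
  simp only [push_id] at e
  rw [← push_apply, push_push] at e
  refine Eq.trans ?_ (e.trans ?_)
  · simp only [pairCoact, coactLeft, LinearMap.comp_apply, push_apply]
    induction ρ v with
    | zero => simp
    | add x y hx hy => simp only [map_add, hx, hy]
    | tmul x y =>
      simp only [LinearEquiv.coe_coe, TensorProduct.map_tmul, LinearMap.id_apply,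
        TensorProduct.comm_tmul]
      induction ρ x with
      | zero => simp
      | add x y hx hy => simp only [map_add, TensorProduct.add_tmul, TensorProduct.tmul_add, hx, hy]
      | tmul x y => simp
  · refine Eq.trans ?_ (hρ.counit v)
    rw [push_apply]
    congr 3
    exact LinearMap.ext hξ

/-- The condition reads `s(h₂)₁ ⊗ s(h₂)₂h₁ = s(h) ⊗ 1`. It holds exactly what makes `s(v₁) ⊗ v₀`
coinvariant in `H ⊗ V`. -/
theorem mulCoact_coactLeft [CoquasiBialgebra k H] (hρ : IsCoaction ρ) {s : H →ₗ[k] H}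
    (hs : ∀ h : H, TensorProduct.map LinearMap.id mul.toLinearMap (TensorProduct.assoc k H H H
      (TensorProduct.map (Coalgebra.comul ∘ₗ s) LinearMap.id (TensorProduct.comm k H H
        (Coalgebra.comul (R := k) h)))) = s h ⊗ₜ[k] (one k : H)) (v : V) :
    mulCoact Coalgebra.comul ρ (coactLeft s ρ v) = coactLeft s ρ v ⊗ₜ[k] (one k : H) := by
  set K : H ⊗[k] H →ₗ[k] H ⊗[k] H := TensorProduct.map LinearMap.id mul.toLinearMap ∘ₗ
    (TensorProduct.assoc k H H H).toLinearMap ∘ₗ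
      TensorProduct.map (Coalgebra.comul ∘ₗ s) LinearMap.id ∘ₗ
        (TensorProduct.comm k H H).toLinearMap with hK
  set J : V ⊗[k] (H ⊗[k] H) →ₗ[k] (H ⊗[k] V) ⊗[k] H :=
    TensorProduct.map (TensorProduct.comm k V H).toLinearMap LinearMap.id ∘ₗ
      (TensorProduct.assoc k V H H).symm.toLinearMap with hJ
  have e := congrArg (fun x => J (TensorProduct.map LinearMap.id K x))
    (hρ.push_comul LinearMap.id LinearMap.id v)
  simp only [push_id] at e
  rw [TensorProduct.map_id, LinearMap.id_comp, ← push_apply, push_push] at e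
  refine Eq.trans ?_ (e.trans ?_)
  · simp only [coactLeft, LinearMap.comp_apply, push_apply]
    induction ρ v with
    | zero => simp
    | add x y hx hy => simp only [map_add, hx, hy]
    | tmul x c =>
      change TensorProduct.map LinearMap.id mul.toLinearMap
        (TensorProduct.tensorTensorTensorComm k H H V H (Coalgebra.comul (s c) ⊗ₜ[k] ρ x)) =
        J (TensorProduct.map LinearMap.id K (TensorProduct.assoc k V H H (ρ x ⊗ₜ[k] c)))
      induction ρ x with
      | zero => simp
      | add x y hx hy =>
        simp only [map_add, TensorProduct.add_tmul, TensorProduct.tmul_add, hx, hy]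
      | tmul x y =>
        simp only [hK, hJ, LinearMap.comp_apply, LinearEquiv.coe_coe, TensorProduct.map_tmul,
          TensorProduct.assoc_tmul, TensorProduct.comm_tmul, LinearMap.id_apply]
        induction (Coalgebra.comul (s c) : H ⊗[k] H) with
        | zero => simp
        | add x y hx hy =>
          simp only [map_add, TensorProduct.add_tmul, TensorProduct.tmul_add, hx, hy]
        | tmul p q => simp
  · have hKs : K ∘ₗ Coalgebra.comul = (TensorProduct.mk k H H).flip (one k) ∘ₗ s :=
      LinearMap.ext hs
    rw [hKs]
    simp only [coactLeft, LinearMap.comp_apply, push_apply]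
    induction ρ v with
    | zero => simp
    | add x y hx hy => simp only [map_add, TensorProduct.add_tmul, hx, hy]
    | tmul x y => simp [hJ]

end Pairing

/-! ### The functional `ω⁻¹(S(h₁), α(h₂)h₃, g)` -/

section AntipodePairing

open CoquasiBialgebra CoquasiHopfAlgebra RightComodule

variable (k H : Type*) [Field k] [AddCommGroup H] [Module k H] [CoquasiHopfAlgebra k H]

/-- `h ⊗ g ↦ ω⁻¹(S(h₁), α(h₂)h₃, g)`. -/
def antipodePairing : H ⊗[k] H →ₗ[k] k :=
  ωInv ∘ₗ (TensorProduct.assoc k H H H).toLinearMap ∘ₗ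
    TensorProduct.map (TensorProduct.map S (convL α LinearMap.id) ∘ₗ Coalgebra.comul) LinearMap.id

variable {k H}

/-- Since `Δ(h₁β(h₂)) = h₁ ⊗ h₂β(h₃)`, the left side is the second antipode axiom for the
reassociator. -/
theorem antipodePairing_betaR (h : H) : antipodePairing k H (TensorProduct.map (betaR k H) S
    (Coalgebra.comul h)) = Coalgebra.counit (R := k) h := by
  rw [← ωInv_antipode h]
  refine congrArg ωInv ?_
  have e1 : convL (α (k := k)) (betaR k H) = convL α LinearMap.id ∘ₗ betaR k H := by
    refine LinearMap.ext fun x => ?_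
    simp only [convL, LinearMap.comp_apply, comul_convR, TensorProduct.map_map]
    rfl
  have e2 : (TensorProduct.map S (convL (α (k := k)) LinearMap.id) ∘ₗ Coalgebra.comul) ∘ₗ
      betaR k H = TensorProduct.map S (convL α (betaR k H)) ∘ₗ Coalgebra.comul (A := H) := by
    refine LinearMap.ext fun x => ?_
    simp only [LinearMap.comp_apply, comul_convR, TensorProduct.map_map, e1]
    rfl
  change TensorProduct.assoc k H H H (TensorProduct.map _ _ (TensorProduct.map _ _ _)) =
    TensorProduct.map _ _ (TensorProduct.map LinearMap.id Coalgebra.comul (Coalgebra.comul h))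
  rw [TensorProduct.map_map, e2, LinearMap.id_comp,
    show TensorProduct.map (LinearMap.id : H →ₗ[k] H) (Coalgebra.comul (R := k) (A := H))
      (Coalgebra.comul h) = TensorProduct.assoc k H H H (TensorProduct.map Coalgebra.comul
        LinearMap.id (Coalgebra.comul h)) from (Coalgebra.coassoc_apply h).symm,
    TensorProduct.map_map_assoc, TensorProduct.map_map]
  rfl

/-- Writing `h = S(d)`, the antihomomorphism `S` turns `ξ(s(h₂), h₁)` into `ξ(s(S(d₁)), S(d₂))`, the
previous lemma. The same substitution reduces `mul_of_comp_S` to `d₁β(d₂)S(d₃) = β(d)1`. -/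
theorem antipodePairing_of_comp_S (hS : Function.Surjective (S : H →ₗ[k] H)) {s : H →ₗ[k] H}
    (hs : s ∘ₗ S = betaR k H) (h : H) :
    antipodePairing k H (TensorProduct.comm k H H (TensorProduct.map LinearMap.id s
      (Coalgebra.comul h))) = Coalgebra.counit (R := k) h := by
  obtain ⟨d, rfl⟩ := hS h
  rw [counit_S, ← antipodePairing_betaR d, comul_S, ← hs]
  congr 1
  induction (Coalgebra.comul d : H ⊗[k] H) with
  | zero => simp
  | add x y hx hy => simp only [map_add, hx, hy]
  | tmul x y => simp

theorem mul_of_comp_S (hS : Function.Surjective (S : H →ₗ[k] H)) {s : H →ₗ[k] H}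
    (hs : s ∘ₗ S = betaR k H) (h : H) :
    TensorProduct.map LinearMap.id mul.toLinearMap (TensorProduct.assoc k H H H
      (TensorProduct.map (Coalgebra.comul ∘ₗ s) LinearMap.id (TensorProduct.comm k H H
        (Coalgebra.comul (R := k) h)))) = s h ⊗ₜ[k] (one k : H) := by
  obtain ⟨d, rfl⟩ := hS h
  have e1 : TensorProduct.map (Coalgebra.comul ∘ₗ s) LinearMap.id (TensorProduct.comm k H H
      (Coalgebra.comul (R := k) (S (k := k) d))) =
      TensorProduct.map (TensorProduct.map LinearMap.id (betaR k H)) S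
        (TensorProduct.map Coalgebra.comul LinearMap.id (Coalgebra.comul (R := k) d)) := by
    rw [comul_S]
    induction (Coalgebra.comul d : H ⊗[k] H) with
    | zero => simp
    | add x y hx hy => simp only [map_add, hx, hy]
    | tmul x y =>
      have := LinearMap.congr_fun hs x
      simp only [LinearMap.comp_apply] at this
      simp [this, comul_convR]
  have e2 : s (S (k := k) d) = betaR k H d := LinearMap.congr_fun hs d
  rw [e1, e2, ← TensorProduct.map_map_assoc,
    show TensorProduct.assoc k H H H (TensorProduct.map Coalgebra.comul LinearMap.id
      (Coalgebra.comul (R := k) d)) = TensorProduct.map LinearMap.id Coalgebra.comul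
        (Coalgebra.comul d) from Coalgebra.coassoc_apply d]
  simp only [betaR, convR, LinearMap.comp_apply]
  induction (Coalgebra.comul d : H ⊗[k] H) with
  | zero => simp
  | add x y hx hy => simp only [map_add, TensorProduct.add_tmul, hx, hy]
  | tmul x y =>
    have := id_β_S (k := k) y
    simp only [TensorProduct.map_tmul, LinearMap.id_apply]
    refine (congrArg (fun z => x ⊗ₜ[k] z) this).trans ?_
    simp [TensorProduct.smul_tmul]

/-- The left side is `ξ(h₁β(h₂), S(h₃)) h₄` with `ξ` the antipode pairing, so
`antipodePairing_betaR` collapses it to `ε(h₁)h₂`. -/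
theorem pairCoact_antipodeCoact_betaL (h : H) :
    pairCoact (antipodePairing k H) (antipodeCoact k H)
      (TensorProduct.map LinearMap.id (betaL k H) (Coalgebra.comul h)) = h := by
  have e1 := map_convL_comul (β (k := k)) LinearMap.id LinearMap.id h
  rw [e1]
  have e2 := congrArg (fun x => TensorProduct.lid k H (TensorProduct.map
    (antipodePairing k H ∘ₗ TensorProduct.map (betaR k H) S) LinearMap.id
      ((TensorProduct.assoc k H H H).symm x))) (Coalgebra.coassoc_apply (R := k) h)
  have e3 : antipodePairing k H ∘ₗ TensorProduct.map (betaR k H) S ∘ₗ Coalgebra.comul =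
      Coalgebra.counit := LinearMap.ext antipodePairing_betaR
  refine Eq.trans ?_ (e2.symm.trans ?_)
  · induction (Coalgebra.comul h : H ⊗[k] H) with
    | zero => simp
    | add x y hx hy => simp only [map_add, hx, hy]
    | tmul x y =>
      simp only [pairCoact, antipodeCoact, LinearMap.comp_apply, TensorProduct.map_tmul,
        LinearMap.id_apply, LinearMap.lTensor_tmul]
      induction (Coalgebra.comul y : H ⊗[k] H) with
      | zero => simp
      | add x y hx hy => simp only [map_add, TensorProduct.tmul_add, hx, hy]
      | tmul z w => simp
  · change TensorProduct.lid k H (TensorProduct.map _ _ ((TensorProduct.assoc k H H H).symm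
      (TensorProduct.assoc k H H H (TensorProduct.map Coalgebra.comul LinearMap.id
        (Coalgebra.comul h))))) = h
    rw [LinearEquiv.symm_apply_apply, TensorProduct.map_map, LinearMap.comp_assoc, e3]
    refine (congrArg (TensorProduct.lid k H) (Coalgebra.rTensor_counit_comul (R := k) h)).trans ?_
    rw [TensorProduct.lid_tmul, one_smul]

end AntipodePairing

/-! ### The regular comodule and maps between `A` and `H ⊗ A` -/

section Regular

open CoquasiBialgebra CoquasiHopfAlgebra RightComodule

/-- The regular comodule. -/
instance regularComodule (k H : Type*) [Field k] [AddCommGroup H] [Module k H] [Coalgebra k H] :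
    RightComodule k H H where
  coact := Coalgebra.comul
  coact_coassoc := isCoaction_comul.coassoc
  coact_counit := isCoaction_comul.counit

variable {k H A M : Type*} [Field k] [AddCommGroup H] [Module k H] [CoquasiBialgebra k H]
  [AddCommGroup A] [Module k A] [ComoduleAlgebra k H A]

theorem colinear_smul (b : (coinvariants k H A)ᵐᵒᵖ) :
    Colinear (coact : A →ₗ[k] A ⊗[k] H) coact
      (RelHopfModule.act H ∘ₗ (TensorProduct.mk k A A).flip b.unop.1) := by
  refine LinearMap.ext fun a => ?_
  refine (coact_act_coinv a b.unop.1 b.unop.2).trans ?_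
  rfl

theorem map_smul_free (b : (coinvariants k H A)ᵐᵒᵖ) (x : H ⊗[k] A) :
    TensorProduct.map LinearMap.id
      (RelHopfModule.act H ∘ₗ (TensorProduct.mk k A A).flip b.unop.1) x = b • x := by
  induction x with
  | zero => rw [map_zero, smul_zero]
  | add x y hx hy => rw [map_add, smul_add, hx, hy]
  | tmul h a => rw [free_smul]; rfl

variable (A) in
/-- `a ↦ s(a₁) ⊗ a₀` is linear over the coinvariants. -/
def coactLeftB (s : H →ₗ[k] H) : A →ₗ[(coinvariants k H A)ᵐᵒᵖ] H ⊗[k] A where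
  toFun := coactLeft s coact
  map_add' := map_add _
  map_smul' b a := by
    rw [RingHom.id_apply, ← map_smul_free, ← (colinear_smul b).coactLeft]
    rfl

variable (A) in
/-- `h ⊗ a ↦ ξ(h, a₁) a₀` is linear over the coinvariants. -/
def pairCoactB (ξ : H ⊗[k] H →ₗ[k] k) : H ⊗[k] A →ₗ[(coinvariants k H A)ᵐᵒᵖ] A where
  toFun := pairCoact ξ coact
  map_add' := map_add _
  map_smul' b x := by
    rw [RingHom.id_apply, ← map_smul_free, (colinear_smul b).pairCoact]
    rfl

theorem freeBal_coactLeft (s : H →ₗ[k] H) (x : BalTensor k (coinvariants k H A) A A) :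
    freeBal k H A H (coactLeft s (balCoact k H A A) x) =
      BalTensor.mapLeft A (coactLeftB A s) x := by
  induction x using BalTensor.induction with
  | h0 => simp
  | ha x y hx hy => simp only [map_add, hx, hy]
  | ht a b =>
    change freeBal k H A H (TensorProduct.comm k _ H (TensorProduct.map LinearMap.id s
      (balCoact k H A A (BalTensor.tmul k a b)))) = BalTensor.tmul k (TensorProduct.comm k A H
        (TensorProduct.map LinearMap.id s (coact a))) b
    rw [balCoact_tmul, mulCoact_trivCoact]
    induction (coact a : A ⊗[k] H) with
    | zero => simp [BalTensor.tmul]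
    | add x y hx hy =>
      rw [map_add, map_add, map_add, map_add, map_add, hx, hy, map_add, map_add,
        BalTensor.tmul, BalTensor.tmul, BalTensor.tmul, TensorProduct.add_tmul, map_add]
    | tmul x h => rfl

end Regular

/-! ### The Galois property from the counit of `H ⊗ A` -/

section Galois

open CoquasiBialgebra CoquasiHopfAlgebra RightComodule
open scoped ModuleCat

variable {k H A : Type u} [Field k] [AddCommGroup H] [Module k H] [CoquasiHopfAlgebra k H]
  [AddCommGroup A] [Module k A] [ComoduleAlgebra k H A]

/-- The map `a ↦ s(a₁) ⊗ a₀`, with `s(h) = S⁻¹(h)₁ β(S⁻¹(h)₂)`, embeds `A` into the coinvariants of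
`H ⊗ A` with a `B`-linear retraction. On coinvariants the Galois map of `H ⊗ A` is injective because
the counit is, and the retraction carries this back to `A ⊗_B A`. -/
theorem canMap_injective_of_counitMap (hS : Function.Bijective (S : H →ₗ[k] H))
    (hc : Function.Injective (counitMap k
      (coinvInclusion (HopfModuleCat.mk (k := k) (H := H) (A := A) (H ⊗[k] A))))) :
    Function.Injective (canMap k H A A) := by
  set e := LinearEquiv.ofBijective (S : H →ₗ[k] H) hS with he
  set s : H →ₗ[k] H := betaR k H ∘ₗ e.symm.toLinearMap with hs_def
  have hs : s ∘ₗ S = betaR k H :=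
    LinearMap.ext fun x => congrArg (betaR k H) (e.symm_apply_apply x)
  set M : HopfModuleCat k H A := HopfModuleCat.mk (H ⊗[k] A) with hM
  set t : A →ₗ[(coinvariants k H A)ᵐᵒᵖ] (coinvFunctor k H A).obj M :=
    LinearMap.codRestrict (coinvariantsB k H A (H ⊗[k] A)) (coactLeftB A s) fun a =>
      mulCoact_coactLeft isCoaction_coact (mul_of_comp_S hS.2 hs) a with ht
  have hit : coinvInclusion M ∘ₗ t = coactLeftB A s := rfl
  have hcan : Colinear (balCoact k H A A) (mulCoact coact (antipodeCoact k H))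
      (canMap k H A A) := LinearMap.ext colinear_canMap
  refine (injective_iff_map_eq_zero _).2 fun z hz => ?_
  -- The Galois map of `H ⊗ A` is `H ⊗ can` up to `twist`, and colinearity of `can` lets it pass the
  -- embedding. Thus `can(z) = 0` kills the image of `z`.
  have h1 : canMap k H A (H ⊗[k] A) (BalTensor.mapLeft A (coactLeftB A s) z) = 0 := by
    rw [← freeBal_coactLeft, canMap_freeBal, ← hcan.coactLeft, hz, map_zero, map_zero]
  rw [← hit, ← BalTensor.mapLeft_mapLeft] at h1
  have h2 := (canMap_mapLeft_coinvariant (coinvInclusion_mem M) _).symm.trans h1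
  have h3 : BalTensor.mapLeft A t z = 0 := by
    apply hc
    rw [map_zero]
    exact betaCoact_injective (isCoaction_coact (V := H ⊗[k] A)) (h2.trans (map_zero _).symm)
  have h4 : pairCoactB A (antipodePairing k H) ∘ₗ coactLeftB A s = LinearMap.id :=
    LinearMap.ext fun a => pairCoact_coactLeft isCoaction_coact
      (antipodePairing_of_comp_S hS.2 hs) a
  have h5 : BalTensor.mapLeft (k := k) A (LinearMap.id : A →ₗ[(coinvariants k H A)ᵐᵒᵖ] A) =
      LinearMap.id := BalTensor.hom_ext fun a b => rfl
  calc z = BalTensor.mapLeft A (pairCoactB A (antipodePairing k H) ∘ₗ coactLeftB A s) z := by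
        rw [h4, h5, LinearMap.id_apply]
    _ = 0 := by
        rw [← BalTensor.mapLeft_mapLeft, ← hit, ← BalTensor.mapLeft_mapLeft, h3, map_zero, map_zero]

/-- Lifting `h ⊗ 1` along the counit gives a preimage of `h₁ ⊗ (1 ⊗ β(h₂)h₃)` under `H ⊗ can`.
Pairing the factor `H` with the coaction of `A ⊗ H^S` leaves `1 ⊗ h`, and left multiplication by `a`
then reaches `a ⊗ h`. -/
theorem canMap_surjective_of_counitMap (hc : Function.Surjective (counitMap k
      (coinvInclusion (HopfModuleCat.mk (k := k) (H := H) (A := A) (H ⊗[k] A))))) :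
    Function.Surjective (canMap k H A A) := by
  set M : HopfModuleCat k H A := HopfModuleCat.mk (H ⊗[k] A) with hM
  have hone : (ComoduleAlgebra.one k H : A) ∈ coinvariants k H A := ComoduleAlgebra.coact_one
  have hcan : Colinear (balCoact k H A A) (mulCoact coact (antipodeCoact k H))
      (canMap k H A A) := LinearMap.ext colinear_canMap
  have hone' : Colinear (antipodeCoact k H)
      (mulCoact (coact : A →ₗ[k] A ⊗[k] H) (antipodeCoact k H))
        (TensorProduct.mk k A H (ComoduleAlgebra.one k H)) := by
    refine LinearMap.ext fun h => ?_
    change TensorProduct.map LinearMap.id mul.toLinearMap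
      (TensorProduct.tensorTensorTensorComm k A H H H (coact (ComoduleAlgebra.one k H) ⊗ₜ[k]
        antipodeCoact k H h)) = TensorProduct.map _ LinearMap.id (antipodeCoact k H h)
    rw [ComoduleAlgebra.coact_one]
    induction antipodeCoact k H h with
    | zero => simp
    | add x y hx hy => simp only [map_add, TensorProduct.tmul_add, hx, hy]
    | tmul x y => simp [CoquasiBialgebra.one_mul]
  have h1 : ∀ h : H, ∃ x, canMap k H A A x = ComoduleAlgebra.one k H ⊗ₜ[k] h := by
    intro h
    obtain ⟨v, hv⟩ := hc (h ⊗ₜ[k] ComoduleAlgebra.one k H)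
    obtain ⟨w, hw⟩ := freeBal_surjective (k := k) (H := H) (A := A) H
      (BalTensor.mapLeft A (coinvInclusion M) v)
    have e1 := canMap_mapLeft_coinvariant (coinvInclusion_mem M) v
    have e2 : TensorProduct.map LinearMap.id (canMap k H A A) w =
        TensorProduct.map LinearMap.id (TensorProduct.mk k A H (ComoduleAlgebra.one k H) ∘ₗ
          betaL k H) (Coalgebra.comul (R := k) h) := by
      apply (twist_bijective H A).1
      refine (canMap_freeBal H w).symm.trans ((congrArg _ hw).trans (e1.trans ?_))
      refine (congrArg (betaCoact coact) hv).trans ?_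
      change TensorProduct.map LinearMap.id (betaL k H) (TensorProduct.map LinearMap.id
        mul.toLinearMap (TensorProduct.tensorTensorTensorComm k H H A H
          (Coalgebra.comul h ⊗ₜ[k] coact (ComoduleAlgebra.one k H)))) = _
      rw [ComoduleAlgebra.coact_one]
      induction (Coalgebra.comul h : H ⊗[k] H) with
      | zero => simp
      | add x y hx hy => simp only [map_add, TensorProduct.add_tmul, hx, hy]
      | tmul x y =>
        simp only [TensorProduct.tensorTensorTensorComm_tmul, TensorProduct.map_tmul,
          LinearMap.id_apply, LinearMap.comp_apply, TensorProduct.mk_apply, twist_mid hone]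
        congr 2
        exact CoquasiBialgebra.mul_one y
    -- As `can` is colinear, pairing before and after it agree. After it, the coinvariant `1` in `A`
    -- leaves only the coaction of `H^S`.
    refine ⟨pairCoact (antipodePairing k H) (balCoact k H A A) w, ?_⟩
    rw [← hcan.pairCoact, e2, ← LinearMap.id_comp LinearMap.id, ← TensorProduct.map_map,
      hone'.pairCoact, pairCoact_antipodeCoact_betaL, TensorProduct.mk_apply]
  have hmul : ∀ (y : A ⊗[k] A) (b : A), ComoduleAlgebra.mul (k := k) H
      (RelHopfModule.act H (y ⊗ₜ[k] b)) =
        RelHopfModule.act (A := A) H (ComoduleAlgebra.mul (k := k) H y ⊗ₜ[k] b) :=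
    act_freeAct (M := A)
  intro z
  induction z with
  | zero => exact ⟨0, map_zero _⟩
  | add x y hx hy =>
    obtain ⟨x, rfl⟩ := hx
    obtain ⟨y, rfl⟩ := hy
    exact ⟨x + y, map_add _ _ _⟩
  | tmul a h =>
    obtain ⟨x, hx⟩ := h1 h
    -- Naturality of the Galois map for the multiplication `A ⊗ A → A`, a morphism from the free
    -- module. The twist is trivial at `a ⊗ (1 ⊗ h)` because `1` is coinvariant.
    refine ⟨BalTensor.mapLeft A (toLinearMapB (ComoduleAlgebra.mul H) hmul)
      (freeBal k H A A (a ⊗ₜ[k] x)), ?_⟩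
    rw [canMap_naturality (M := A ⊗[k] A) colinear_mul hmul, canMap_freeBal,
      TensorProduct.map_tmul, hx, LinearMap.id_apply, twist_mid hone, TensorProduct.map_tmul,
      ComoduleAlgebra.mul_one, LinearMap.id_apply]

/-- If the antipode is bijective and every relative Hopf module is the induction of its
coinvariants, then `A` is a Galois extension. -/
theorem isGaloisExtension_of_counitMap (hS : Function.Bijective (S : H →ₗ[k] H))
    (hc : ∀ M : HopfModuleCat k H A, Function.Bijective (counitMap k (coinvInclusion M))) :
    IsGaloisExtension k H A :=
  ⟨canMap_injective_of_counitMap hS (hc _).1, canMap_surjective_of_counitMap (hc _).2⟩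

end Galois

end CoquasiHopf

end

theorem theorema (k H A : Type u) [Field k] [AddCommGroup H] [Module k H]
    [CoquasiHopf.CoquasiHopfAlgebra k H]
    [AddCommGroup A] [Module k A] [CoquasiHopf.ComoduleAlgebra k H A] :
    (Function.Bijective (CoquasiHopf.CoquasiHopfAlgebra.S : H →ₗ[k] H) →
      ((CoquasiHopf.LeftFaithfullyFlat k (CoquasiHopf.coinvariants k H A) A ∧
          CoquasiHopf.IsGaloisExtension k H A) ↔
        ∃ e : CoquasiHopf.HopfModuleCat k H A ≌
            ModuleCat.{u} (CoquasiHopf.coinvariants k H A)ᵐᵒᵖ,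
          e.functor = CoquasiHopf.coinvFunctor k H A ∧
            e.inverse = CoquasiHopf.inductionFunctor k H A)) ∧
    (CoquasiHopf.IsGaloisExtension k H A →
      ∀ M : CoquasiHopf.HopfModuleCat k H A,
        Function.Bijective (CoquasiHopf.canMap k H A M.carrier)) := by
  refine ⟨fun hS => ⟨fun h => CoquasiHopf.exists_equivalence h.1 h.2, fun ⟨e, he, _⟩ => ?_⟩,
    fun hG M => CoquasiHopf.canMap_bijective M.carrier hG⟩
  have : (CoquasiHopf.coinvFunctor k H A).IsEquivalence := he ▸ e.isEquivalence_functor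
  obtain ⟨hc, hu⟩ := CoquasiHopf.unit_counit_bijective (k := k) (H := H) (A := A)
  exact ⟨CoquasiHopf.leftFaithfullyFlat_of_unit_counit hc hu,
    CoquasiHopf.isGaloisExtension_of_counitMap hS hc⟩
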